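/- All graphs are finite, simple and undirected. For a graph $G$ and positive integers $a_1,\dots,a_r$, write $G\overset{v}{\to}(a_1,\dots,a_r)$ if for every coloring of the vertices of $G$ with $r$ colors $1,\dots,r$ there is some $i\in\{1,\dots,r\}$ such that $G$ contains a clique on $a_i$ vertices all of which have color $i$. Let $\mathrm{cl}(G)$ be the largest number of pairwise adjacent vertices of $G$, and let $$F_v(a_1,\dots,a_r;q)=\min\{|V(G)| : G\overset{v}{\to}(a_1,\dots,a_r)\text{ and }\mathrm{cl}(G)<q\}$$ be the vertex Folkman number. Write $F_v(2_r;q)$ for $F_v(\underbrace{2,\dots,2}_{r};q)$. **Theorem.** Let $r$ and $k$ be integers such that $-1\le k\le 5$ and $r\ge k+2$. Then $F_v(2_r;r-k+1)$ exists (there is a graph $G$ with $G\overset{v}{\to}(2_r)$ and $\mathrm{cl}(G)<r-k+1$), and (a) $F_v(2_r;r-k+1)\ge r+2k+3$; (b) $F_v(2_r;r-k+1)=r+2k+3$ if $k\in\{0,2,3,4,5\}$ and $r\ge 2k+2$, or $k\in\{-1,1\}$ and $r\ge 2k+3$. -/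

import Mathlib

/-- The vertex arrow relation of `G` with `(a₁, …, a_r)`: every colouring of the vertices of `G`
with `r` colours has, for some colour `i`, an `a i`-clique all of whose vertices have colour `i`. -/
def VertexArrows {V : Type*} (G : SimpleGraph V) {r : ℕ} (a : Fin r → ℕ) : Prop :=
  ∀ c : V → Fin r, ∃ i : Fin r, ∃ Q : Finset V, G.IsNClique (a i) Q ∧ ∀ v ∈ Q, c v = i

/-- The set of orders `|V(G)|` of the finite graphs `G` in the class `H_v(a₁, …, a_r; q)`: those
that vertex-arrow `(a₁, …, a_r)` and have clique number less than `q`. -/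
def vertexFolkmanOrders {r : ℕ} (a : Fin r → ℕ) (q : ℤ) : Set ℕ :=
  {n | ∃ G : SimpleGraph (Fin n), VertexArrows G a ∧ (G.cliqueNum : ℤ) < q}

/-- The vertex Folkman number `F_v(a₁, …, a_r; q)`: the minimum of the orders above (with the
junk value `0` if there is no such graph). -/
noncomputable def vertexFolkman {r : ℕ} (a : Fin r → ℕ) (q : ℤ) : ℕ :=
  sInf (vertexFolkmanOrders a q)

/-- The constant sequence `(2_r) = (2, …, 2)` of length `r`. -/
def twos (r : ℕ) : Fin r → ℕ := fun _ => 2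

/-!
Let `j = k + 1`, so `0 ≤ j ≤ 6`. A graph arrows `(2_r)` exactly if it is not `r`-colourable, and the
clique condition says that cliques have at most `r + 1 - j` vertices. Everything is phrased for the
complement `H` of the graph on a finite set `S` of its vertices: colourings become covers by cliques of
`H`, and cliques become independent sets of `H`.

**Lower bound** (`le_card_of_not_cover`). If `S` is not covered by `r` cliques and independent sets
have at most `r + 1 - j` vertices, then `r + 1 + 2 j ≤ S.card`, by induction on `S`. Deleting a
triangle of `H` lowers `r` and `j` by one and `S.card` by three, so `H` may be assumed triangle-free;
and `S` may be assumed critical. Covers are then matchings, and every vertex is left unmatched by some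
maximum matching. By Gallai's lemma (`gallai`), either a maximum matching leaves one vertex at most
unmatched, or `S` splits into two parts without edges of `H` between them, to which the induction
hypothesis applies. In the first case `2 r + 1 ≤ S.card`, and if the bound failed, the triangle-free
graph `H`, on at least `4 s - 1` vertices, would have independence number at most `s = r + 1 - j ≤ 6`. This
contradicts the Ramsey bound `R(3, s + 1) ≤ 4 s - 1` (`card_lt_of_indepLE`).

**Ramsey bounds.** For `s ≤ 5` these follow from degree bounds and parity. For `s = 6`, that is
`R(3, 7) ≤ 23` (`card_le_twentyTwo`), let `far v` be the set of vertices neither equal nor adjacent to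
`v`. Summing `deg v ^ 2 + edges (far v)` over all `v` gives the number of vertices times the number of
edges (`sum_sq_add_far`), which turns lower bounds for the edges of `far v` into lower bounds for the
edges of the graph. For 23 vertices it follows that some vertex `v` and all its neighbours have degree
six, and that `far v` has sixteen vertices, at most 33 edges and at most six vertices of degree five.
Such graphs are determined by an exhaustive search (`exists_rep_sixteen`) along chains
`C₅ ⊂ 8 ⊂ 11 ⊂ 16` and `C₅ ⊂ 7 ⊂ 10 ⊂ 16` of graphs that are the far graph of a vertex in the next;
a second search shows that `v` and its neighbours cannot be attached to any of them
(`Rep.not_noGlue`). The searches are evaluated by the kernel, and proved complete beforehand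
(`search_complete`, `glue_sound`).

**Upper bound.** Joins of graphs add chromatic and clique numbers (`Realizable.join`). The bound is
attained by joins of complete graphs with complements of triangle-free graphs on 5, 13, 17, 21 and 25
vertices, and by the join of two pentagons. Graphs of clique number two that are not `r`-colourable are
given by the shift graph (`exists_realizable`).
-/

namespace Folkman

/-! ### The exhaustive searches -/

/-- `List.filter`, written with recursors so that the kernel evaluates it without unfolding
instances. -/
def filt {α : Type} (p : α → Bool) (l : List α) : List α :=
  List.rec [] (fun x _ ih => Bool.rec ih (x :: ih) (p x)) l

/-- `k x`, with `x` evaluated to a literal first: the kernel evaluates lazily and would otherwise repeat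
the computation of `x` in every use. -/
def force {α : Type} (x : ℕ) (k : ℕ → α) : α := Nat.casesOn x (k 0) fun n => k (Nat.succ n)

/-- `k l`, with all entries of `l` evaluated first. -/
def forceList {α : Type} : List ℕ → (List ℕ → α) → α
  | [], k => k []
  | x :: xs, k => force x fun y => forceList xs fun ys => k (y :: ys)

/-- `k l`, with all entries of the lists in `l` evaluated first. -/
def forceLists {α : Type} : List (List ℕ) → (List (List ℕ) → α) → α
  | [], k => k []
  | x :: xs, k => forceList x fun y => forceLists xs fun ys => k (y :: ys)

/-- Auxiliary to `addVertex`: `prev` lists the independent sets with one element less than those of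
the first remaining list. -/
def addLayer (b row : ℕ) : List ℕ → List (List ℕ) → List (List ℕ)
  | prev, [] => [(filt (fun s => Nat.beq (Nat.land s row) 0) prev).map fun s => Nat.lor s b]
  | prev, l :: ls =>
    (l ++ (filt (fun s => Nat.beq (Nat.land s row) 0) prev).map fun s => Nat.lor s b) ::
      addLayer b row l ls

/-- A vertex with mask `b = 2 ^ m` and neighbours `row` among the vertices below `m` is added to the
lists of independent sets by size. -/
def addVertex (b row : ℕ) : List (List ℕ) → List (List ℕ)
  | [] => []
  | l :: ls => l :: addLayer b row l ls

/-- The lists of independent sets after the vertices with the given rows, the first having mask `b`,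
are added to `I`. -/
def layersFrom : ℕ → List ℕ → List (List ℕ) → List (List ℕ)
  | _, [], I => I
  | b, row :: g, I => layersFrom (Nat.mul 2 b) g (addVertex b row I)

/-- The independent sets, as bit masks and listed by size, of a graph given by its rows. Throughout, a
graph on the vertices `0, …, n - 1` is encoded by the list of its `n` rows; bit `i` of row `j` is set
if `i < j` and `i` is adjacent to `j`. -/
def layers (g : List ℕ) : List (List ℕ) := layersFrom 1 g [[0]]

/-- A candidate neighbourhood, in a graph already known, of a new vertex. -/
structure Cone where
  /-- The vertices, as a bit mask. -/
  mask : ℕ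
  /-- The number of vertices. -/
  size : ℕ
  /-- The bits of the members of a fixed list of independent sets that are disjoint from the cone. -/
  missed : ℕ

/-- `k l`, with the list structure of `l`, but not its entries, evaluated first. -/
def forceSpine {α β : Type} : List β → (List β → α) → α
  | [], k => k []
  | x :: xs, k => forceSpine xs fun ys => k (x :: ys)

/-- `k l`, with all fields of the entries of `l` evaluated first. -/
def forceCones {α : Type} : List Cone → (List Cone → α) → α
  | [], k => k []
  | x :: xs, k => force x.mask fun a => force x.size fun b => force x.missed fun n =>
      forceCones xs fun ys => k (⟨a, b, n⟩ :: ys)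

/-- Bit `t` is set if entry `t` of `sets` is disjoint from `c`. -/
def missedBits (c : ℕ) (sets : List ℕ) : ℕ :=
  List.rec 0 (fun s _ ih => Bool.rec (Nat.mul 2 ih) (Nat.succ (Nat.mul 2 ih))
    (Nat.beq (Nat.land s c) 0)) sets

/-- The sets, among those given by the bits of `n`, that the next cone has to meet. Each entry
`(m, lm)` of `us` stands for a set `W` of chosen cones: `m` has the bits of the sets missed by all of
`W`, and the first entry of `lm` those of the sets just too large to be missed
by two more cones. -/
def required (n : ℕ) (us : List (ℕ × List ℕ)) : ℕ :=
  List.rec 0 (fun u _ ih => Nat.lor (Nat.land (Nat.land u.1 n) (u.2.headD 0)) ih) us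

/-- All choices of `r` cones out of `cs`, in the order of the list and with sizes adding up to at most
`e`, such that no independent set together with the chosen cones missing it is too large. The list
`cs` is sorted by size, whence the test that aborts a branch. -/
def search : ℕ → ℕ → List Cone → List (ℕ × List ℕ) → List (List ℕ) :=
  Nat.rec (fun _ _ _ => [[]]) fun r ihr e cs us =>
    List.rec [] (fun x xs ih =>
      Bool.rec []
      ((force (Nat.sub e (Nat.mul r x.size)) fun e' => force (required x.missed us) fun R =>
        forceSpine (filt (fun y => Bool.rec false (Nat.ble y.size e')
          (Nat.beq (Nat.land y.missed R) 0)) (x :: xs)) fun cs' =>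
        (ihr (Nat.sub e x.size) cs'
          (us ++ us.map fun u => (Nat.land u.1 x.missed, u.2.tail))).map (x.mask :: ·)) ++ ih)
      (Nat.ble (Nat.mul (Nat.succ r) x.size) e)) cs

/-- The independent sets in the given lists as candidate neighbourhoods; `n` is the size of the sets in
the first list. -/
def cones (sets : List ℕ) : ℕ → List (List ℕ) → List Cone
  | _, [] => []
  | n, l :: ls => (l.map fun c => ⟨c, n, missedBits c sets⟩) ++ cones sets (Nat.succ n) ls

/-- For each list in turn, the bits of the positions of its members in the concatenation of the lists,
counted from `a`. -/
def blocks : ℕ → List (List ℕ) → List ℕ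
  | _, [] => []
  | a, l :: ls => Nat.mul (2 ^ a) (Nat.sub (2 ^ l.length) 1) :: blocks (a + l.length) ls

/-- The lists of independent sets of the sizes `k, k - 1, …, 1`. -/
def descending (k : ℕ) (I : List (List ℕ)) : List (List ℕ) :=
  (List.range k).map fun j => I.getD (k - j) []

/-- The triangle-free extensions of the graph `g` by a vertex `v` with `d` neighbours that are themselves
new: every new neighbour `u` of `v` is given by its cone in `g`, an independent set, and the sizes of
the cones add up to at most `e`. If `W` is a set of new neighbours and `B` an independent set of `g`
missed by their cones, then `W ∪ B` is independent, so `W.card + B.card ≤ k + 1` is required. -/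
def extensions (g : List ℕ) (k d e : ℕ) : List (List ℕ) :=
  forceLists (layers g) fun I =>
  forceList (descending k I).flatten fun sets =>
  forceList (blocks 0 (descending k I)) fun lm =>
  forceCones (filt (fun x => Nat.ble x.size e) (cones sets 0 I)) fun cs =>
  search d e cs [(Nat.sub (2 ^ sets.length) 1, lm)]

/-- The number of bits set among the lowest `n` bits. -/
def bitCount : ℕ → ℕ → ℕ
  | 0, _ => 0
  | n + 1, x => Nat.add (Nat.mod x 2) (bitCount n (Nat.div x 2))

/-- The number of edges of a graph with at most sixteen vertices. -/
def edgeCount (g : List ℕ) : ℕ := (g.map (bitCount 16)).sum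

/-- The graph `g` with new vertices of the cones `f`, and a last vertex adjacent to all of these. -/
def extend (g f : List ℕ) : List ℕ :=
  g ++ (f ++ [Nat.mul (2 ^ g.length) (Nat.sub (2 ^ f.length) 1)])

/-- The lowest `n` hexadecimal digits, lowest first. -/
def digits : ℕ → ℕ → List ℕ
  | 0, _ => []
  | n + 1, P => Nat.mod P 16 :: digits n (Nat.div P 16)

/-- The rows in one number, with sixteen bits each and the last row lowest. -/
def packRows : ℕ → List ℕ → ℕ
  | A, [] => A
  | A, r :: rs => packRows (Nat.add (Nat.mul A 65536) r) rs

/-- Whether `a` and `b` are adjacent, for the packed rows `A` of a graph with `m + 1` vertices. -/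
def adjBit (A m a b : ℕ) : ℕ :=
  Nat.land (Nat.lor (Nat.shiftRight A (Nat.add (Nat.mul 16 (Nat.sub m a)) b))
    (Nat.shiftRight A (Nat.add (Nat.mul 16 (Nat.sub m b)) a))) 1

/-- The row of the vertex `q` after the relabelling whose previous labels are `prev`, latest first. -/
def rowOf (A m q : ℕ) (prev : List ℕ) : ℕ → ℕ :=
  List.rec (fun acc => acc)
    (fun p _ ih acc => ih (Nat.add (Nat.mul 2 acc) (adjBit A m p q))) prev

/-- Whether the relabelling `ps` of the graph `A`, continuing `prev`, has the given rows. -/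
def checkRows (A m : ℕ) : List ℕ → List ℕ → List ℕ → Bool
  | _, [], [] => true
  | prev, q :: ps, r :: rs => Nat.beq (rowOf A m q prev 0) r && checkRows A m (q :: prev) ps rs
  | _, _, _ => false

/-- The mask with the bits in the list. -/
def orPows : List ℕ → ℕ
  | [] => 0
  | p :: ps => Nat.lor (Nat.shiftLeft 1 p) (orPows ps)

/-- Whether the hexadecimal digits of `P` are a permutation turning the graph `g` into `h`. -/
def isRelabelling (P : ℕ) (g h : List ℕ) : Bool :=
  force (packRows 0 g) fun A =>
  forceList (digits g.length P) fun ps =>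
    Nat.beq (orPows ps) (Nat.sub (2 ^ g.length) 1) && checkRows A (Nat.sub g.length 1) [] ps h

/-- Whether `p` holds for corresponding entries; the second list may be longer. -/
def all2 {α β : Type} (p : α → β → Bool) : List α → List β → Bool
  | [], _ => true
  | _ :: _, [] => false
  | a :: as, b :: bs => p a b && all2 p as bs

/-- A check that every extension of `g` to a graph with at most `E` edges is, by the relabelling in its
certificate, a member of `reps`. The digits of a certificate above the sixteenth give the index of
this member. -/
def checkStage (k d E : ℕ) (reps : List (List ℕ)) (g : List ℕ) (certs : List ℕ) : Bool :=
  forceLists (extensions g k d (Nat.sub (Nat.sub E (edgeCount g)) d)) fun fs =>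
  all2 (fun f c => isRelabelling c (extend g f) (reps.getD (Nat.div c 18446744073709551616) []))
    fs certs

/-- Capacities are stored in unary: list entry `i` has the bits of the vertices of capacity more than
`i`. The capacities of the vertices in `c` are lowered by one. -/
def consume (c : ℕ) : List ℕ → List ℕ
  | [] => []
  | C :: Cs => Nat.lor (Nat.xor C (Nat.land C c)) (Nat.land (Cs.headD 0) c) :: consume c Cs

/-- The capacity of the vertex `w`. -/
def capOf (w : ℕ) : List ℕ → ℕ
  | [] => 0
  | C :: Cs => bif Nat.testBit C w then Nat.succ (capOf w Cs) else 0

/-- Whether there is no choice of `r` of the candidates `cs` that respects the capacities, leaves at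
most `slack` of the capacity of the vertices in `ws` unused, and in which no independent set is missed
by two of those chosen. A candidate is a pair of a set and the bits of the independent sets missing
it. The search branches on the candidates through the first vertex of `ws`; if none of these is chosen,
the capacity of this vertex stays unused. -/
def glue : ℕ → List ℕ → List ℕ → ℕ → List (ℕ × ℕ) → Bool :=
  Nat.rec (fun _ _ _ _ => false) fun _ ihr ws =>
    List.rec (fun _ _ cs => cs.isEmpty)
      (fun w ws ihw caps slack cs =>
        List.rec (motive := fun _ => Bool)
          (Bool.rec
            (ihw caps (Nat.sub slack (capOf w caps)) (filt (fun y => !Nat.testBit y.1 w) cs)) true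
            (Nat.ble (Nat.succ slack) (capOf w caps)))
          (fun x xs ih =>
            (forceList (consume x.1 caps) fun caps' =>
              ihr (w :: ws) caps' slack
                (filt (fun y => Bool.rec false (Nat.beq (Nat.land y.1 (caps'.headD 0)) y.1)
                  (Nat.beq (Nat.land y.2 x.2) 0))
                  (x :: xs ++ filt (fun y => !Nat.testBit y.1 w) cs))) && ih)
          (filt (fun y => Nat.testBit y.1 w) cs))
      ws

/-- `k l`, with all entries of the pairs in `l` evaluated first. -/
def forcePairs {α : Type} : List (ℕ × ℕ) → (List (ℕ × ℕ) → α) → α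
  | [], k => k []
  | x :: xs, k => force x.1 fun a => force x.2 fun b => forcePairs xs fun ys => k ((a, b) :: ys)

/-- The capacities six minus the degree, for the packed rows `A` of a graph with `n` vertices. -/
def startCaps (A n : ℕ) : List ℕ :=
  (List.range n).foldl (fun caps q => consume (rowOf A (Nat.sub n 1) q (List.range n).reverse 0) caps)
    (List.replicate 6 (Nat.sub (2 ^ n) 1))

/-- Whether the sixteen-vertex graph `h` is not the graph far from a vertex `v` in a triangle-free graph
with 23 vertices and independence number six in which `v` and all its neighbours have degree six.
The six neighbours of `v` have independent sets of five vertices as neighbourhoods in `h`; degrees are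
at most six, and an independent set of five vertices is not missed by two of the six sets.
If `h` has `e` edges, the capacities add up to `96 - 2 e`, and the six sets use `30` of this. -/
def noGlue (h : List ℕ) : Bool :=
  forceList ((layers h).getD 5 []) fun sets =>
  force (packRows 0 h) fun A =>
  forceList (startCaps A h.length) fun caps =>
  forcePairs (sets.map fun c => (c, missedBits c sets)) fun cs =>
  glue 6 (List.range h.length).reverse caps (Nat.sub 66 (Nat.mul 2 (edgeCount h))) cs

/-! ### The graphs found by the searches -/

/-- The cycle of length five. -/
def cycleFive : List ℕ := [0, 1, 1, 2, 12]

/-- The triangle-free graphs with eight vertices, at most eleven edges and independence number three,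
up to isomorphism. -/
def reps8 : List (List ℕ) :=
  [[0, 1, 1, 2, 12, 1, 6, 96], [0, 1, 1, 2, 12, 6, 9, 96]]

/-- Triangle-free graphs with eleven vertices and independence number four that include all those with
at most sixteen edges, up to isomorphism. -/
def reps11 : List (List ℕ) :=
  [[0, 1, 1, 2, 12, 1, 6, 96, 1, 38, 768], [0, 1, 1, 2, 12, 1, 6, 96, 8, 18, 768], [0, 1, 1, 2,
   12, 1, 6, 96, 8, 50, 768], [0, 1, 1, 2, 12, 1, 6, 96, 9, 34, 768], [0, 1, 1, 2, 12, 1, 6, 96,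
   12, 18, 768], [0, 1, 1, 2, 12, 1, 6, 96, 12, 48, 768], [0, 1, 1, 2, 12, 1, 6, 96, 40, 144,
   768]]

/-- Triangle-free graphs with sixteen vertices and independence number five, each with a vertex of
degree four whose far graph has at most sixteen edges. Completeness, for at most 33 edges, is the
content of `stage_sixteen`. -/
def reps16 : List (List ℕ) :=
  [[0, 1, 1, 2, 12, 1, 6, 96, 1, 38, 768, 12, 112, 400, 1169, 30720], [0, 1, 1, 2, 12, 1, 6, 96,
   1, 38, 768, 12, 112, 402, 1169, 30720], [0, 1, 1, 2, 12, 1, 6, 96, 1, 38, 768, 12, 112, 912,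
   1169, 30720], [0, 1, 1, 2, 12, 1, 6, 96, 1, 38, 768, 12, 400, 1041, 368, 30720], [0, 1, 1, 2,
   12, 1, 6, 96, 1, 38, 768, 12, 400, 368, 1105, 30720], [0, 1, 1, 2, 12, 1, 6, 96, 1, 38, 768,
   12, 400, 368, 1169, 30720], [0, 1, 1, 2, 12, 1, 6, 96, 1, 38, 768, 12, 400, 1136, 1169,
   30720], [0, 1, 1, 2, 12, 1, 6, 96, 1, 38, 768, 12, 784, 1136, 1169, 30720], [0, 1, 1, 2, 12,
   1, 6, 96, 1, 38, 768, 12, 784, 1136, 1170, 30720], [0, 1, 1, 2, 12, 1, 6, 96, 1, 38, 768, 96,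
   140, 912, 1169, 30720], [0, 1, 1, 2, 12, 1, 6, 96, 1, 38, 768, 96, 392, 402, 1161, 30720], [0,
   1, 1, 2, 12, 1, 6, 96, 1, 38, 768, 96, 392, 402, 1169, 30720], [0, 1, 1, 2, 12, 1, 6, 96, 1,
   38, 768, 264, 146, 1136, 1161, 30720], [0, 1, 1, 2, 12, 1, 6, 96, 1, 38, 768, 44, 112, 146,
   649, 30720], [0, 1, 1, 2, 12, 1, 6, 96, 1, 38, 768, 104, 140, 145, 306, 30720], [0, 1, 1, 2,
   12, 1, 6, 96, 1, 38, 768, 104, 140, 274, 1169, 30720], [0, 1, 1, 2, 12, 1, 6, 96, 1, 38, 768,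
   104, 140, 400, 1169, 30720], [0, 1, 1, 2, 12, 1, 6, 96, 1, 38, 768, 104, 274, 392, 1153,
   30720], [0, 1, 1, 2, 12, 1, 6, 96, 1, 38, 768, 104, 274, 392, 1161, 30720], [0, 1, 1, 2, 12,
   1, 6, 96, 1, 38, 768, 104, 274, 392, 1169, 30720], [0, 1, 1, 2, 12, 1, 6, 96, 1, 38, 768, 104,
   274, 1153, 396, 30720], [0, 1, 1, 2, 12, 1, 6, 96, 1, 38, 768, 104, 274, 1153, 904, 30720],
   [0, 1, 1, 2, 12, 1, 6, 96, 1, 38, 768, 104, 274, 1160, 904, 30720], [0, 1, 1, 2, 12, 1, 6, 96,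
   1, 38, 768, 104, 392, 1153, 306, 30720], [0, 1, 1, 2, 12, 1, 6, 96, 1, 38, 768, 104, 392,
   1153, 402, 30720], [0, 1, 1, 2, 12, 1, 6, 96, 1, 38, 768, 104, 400, 1153, 396, 30720], [0, 1,
   1, 2, 12, 1, 6, 96, 1, 38, 768, 137, 146, 296, 1136, 30720], [0, 1, 1, 2, 12, 1, 6, 96, 1, 38,
   768, 140, 274, 1041, 360, 30720], [0, 1, 1, 2, 12, 1, 6, 96, 1, 38, 768, 140, 400, 1041, 360,
   30720], [0, 1, 1, 2, 12, 1, 6, 96, 1, 38, 768, 268, 336, 1033, 1170, 30720], [0, 1, 1, 2, 12,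
   1, 6, 96, 8, 18, 768, 292, 1064, 897, 1169, 30720], [0, 1, 1, 2, 12, 1, 6, 96, 8, 18, 768,
   352, 896, 1068, 1169, 30720], [0, 1, 1, 2, 12, 1, 6, 96, 8, 18, 768, 352, 896, 1097, 1158,
   30720], [0, 1, 1, 2, 12, 1, 6, 96, 8, 50, 768, 132, 336, 1128, 1169, 30720], [0, 1, 1, 2, 12,
   1, 6, 96, 8, 50, 768, 272, 140, 1128, 1169, 30720], [0, 1, 1, 2, 12, 1, 6, 96, 8, 50, 768,
   262, 1064, 1153, 337, 30720], [0, 1, 1, 2, 12, 1, 6, 96, 8, 50, 768, 336, 388, 1064, 1153,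
   30720], [0, 1, 1, 2, 12, 1, 6, 96, 8, 50, 768, 336, 388, 1064, 1161, 30720], [0, 1, 1, 2, 12,
   1, 6, 96, 8, 50, 768, 336, 388, 1064, 1169, 30720], [0, 1, 1, 2, 12, 1, 6, 96, 8, 50, 768,
   336, 388, 1153, 1068, 30720], [0, 1, 1, 2, 12, 1, 6, 96, 8, 50, 768, 336, 388, 1153, 1128,
   30720], [0, 1, 1, 2, 12, 1, 6, 96, 8, 50, 768, 336, 644, 1168, 1128, 30720], [0, 1, 1, 2, 12,
   1, 6, 96, 9, 34, 768, 336, 644, 1064, 1168, 30720], [0, 1, 1, 2, 12, 1, 6, 96, 9, 34, 768,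
   336, 644, 1064, 1169, 30720]]

/-- The relabellings identifying the extensions of `cycleFive` with members of `reps8`. -/
def certs8 : List ℕ :=
  [0x76543210, 0x76542301, 0x76531402, 0x76520413, 0x76510324, 0x10000000076543210,
   0x10000000076534120, 0x10000000076524031, 0x10000000075613042, 0x10000000075602143]

/-- The relabellings identifying the extensions of the graphs in `reps8` with members of `reps11`. -/
def certs11 : List (List ℕ) :=
  [[0xa9876543210, 0x765432a8910, 0x765341a8920, 0x100000a9876543210, 0x200000a9876543210,
   0x200000a9850743216, 0x100000a9876534120, 0x200000a9876534120, 0x200000a9850734126,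
   0x100000a9842375601, 0x200000a9842375601, 0x200000a9831475602, 0x423570a8961,
   0x100000a9842357061, 0x200000a9842357061, 0x200000a9831457062, 0x423a9875601,
   0x200000507a9826413, 0x300000a9876543210, 0x200000507a8916324, 0x400000a9876543210,
   0x500000a9876543210, 0x200000765a8910324, 0x500000a9850743216, 0x300000a9876534120,
   0x500000a9876534120, 0x200000765a8920413, 0x500000a9850734126, 0x200000314a9862705,
   0x200000423a9861705, 0x500000a8942357061, 0x600000a9876543210, 0x500000a8931457062,
   0x600000a9876534120, 0x300000570a8942361, 0x300000570a8931462, 0x400000a9842375601,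
   0x200000314a8902567, 0x200000423a8901567, 0x500000a9842375601, 0x500000a9831475602],
   [0x20000082a76549301, 0x20000083a75649210, 0x400000765a9801234, 0x20000085a43279610,
   0x20000086a42379501, 0x400000432a9810567]]

/-- The relabellings identifying the extensions of the graphs in `reps11` with members of `reps16`. -/
def certs16 : List (List ℕ) :=
  [[0xfedcba9876543210, 0xfedcb80a76543219, 0x1fedcba9876543210, 0x2fedcba9876543210,
   0x1fdecb80a76543219, 0x3fedcba9876543210, 0x4fedcba9876543210, 0x5fedcba9876543210,
   0x6fedcba9876543210, 0x3fecdb80a76543219, 0x7fedcba9876543210, 0x8fedcba9876543210,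
   0x8fedcb80a76543219, 0x7fedcb80a76543219, 0x6fedcb80a76543219, 0x4fdecb80a76543219,
   0x5fdecb80a76543219, 0xfedcba9876534120, 0xfedcb80a76534129, 0x1fedcba9876534120,
   0x2fedcba9876534120, 0x1fdecb80a76534129, 0x3fedcba9876534120, 0x4fedcba9876534120,
   0x5fedcba9876534120, 0x6fedcba9876534120, 0x3fecdb80a76534129, 0x7fedcba9876534120,
   0x8fedcba9876534120, 0x8fedcb80a76534129, 0x7fedcb80a76534129, 0x6fedcb80a76534129,
   0x4fdecb80a76534129, 0x5fdecb80a76534129, 0x39251abf634c08ed7, 0x3d74fa31cb56e8902,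
   0x89125a67b34c08edf, 0x9fedcba9876543210, 0x80125867b34c9adef, 0x39152abf643c08ed7,
   0x3d73fa42cb56e8901, 0x89215a67b43c08edf, 0x9fedcba9876534120, 0x80215867b43c9adef,
   0x320694bf5a8d13ec7, 0xafedcba9876543210, 0xbfedcba9876543210, 0xbfedcb423756a8901,
   0x3c78f4a9db65e3210, 0xbfedcba9876534120, 0xafedcba9876534120, 0xbfdecb314756a8902,
   0x329604bf58ac13ed7, 0x3d7af480cb65e3219, 0x82096457b8ac13edf, 0x81096357b8ac24def,
   0x9fedcb423756a8901, 0x9fedcb4237568a091, 0x81906357ba8c24def, 0x82906457ba8c13def,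
   0xbfdecb4237568a091, 0xafdecb80a76543219, 0xbfdecb80a76543219, 0xbfdecb3147568a092,
   0xbfdecb80a76534129, 0xafdecb80a76534129, 0xcfedcba9876543210, 0xcfdecb423756a8901,
   0xcfedcba9876534120, 0xcfdecb314756a8902, 0x3fecdb314756a8902, 0x8fedcb423756a8901,
   0x7fedcb423756a8901, 0x3fecdb423756a8901, 0x8fedcb314756a8902, 0x7fedcb314756a8902,
   0x29064bf857c13eda, 0xdaf7480bc65e3219, 0x1fedcb423756a8901, 0x1fdecb314756a8902,
   0x2fedcb423756a8901, 0x4fdecb423756a8901, 0x5fedcb423756a8901, 0x6fedcb423756a8901,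
   0x4fdecb314756a8902, 0x6fedcb314756a8902, 0x5fedcb314756a8902, 0x3fecdb3147568a092,
   0x7fedcb4237568a091, 0x8fedcb4237568a091, 0x3fecdb4237568a091, 0x7fedcb3147568a092,
   0x8fedcb3147568a092, 0x20964bfa57c13ed8, 0xd8f74a9bc65e3210, 0x2fedcb4237568a091,
   0x1fdecb3147568a092, 0x1fdecb4237568a091, 0x4fdecb4237568a091, 0x5fedcb4237568a091,
   0x6fedcb4237568a091, 0x4fdecb3147568a092, 0x6fedcb3147568a092, 0x5fedcb3147568a092,
   0xcfedcb80a76543219, 0xcfedcb4237568a091, 0xcfedcb80a76534129, 0xcfedcb3147568a092,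
   0xdfedcba9876543210, 0x69251abf367c08ed4, 0x602518bf367c9aed4, 0xb9521a7c60d8b3f4e,
   0xb052187d69cab3f4e, 0xdfedcba9876534120, 0x69152abf467c08ed3, 0x601528bf467c9aed3,
   0xb9512a7c60d8b4f3e, 0xb051287d69cab4f3e, 0xefedcba9876543210, 0xffedcba9876543210,
   0x10fedcba9876543210, 0xefedcb80a76543219, 0xffedcb80a76543219, 0x1019063ad82c45b7fe,
   0x5d37f842cb56ea091, 0x5d37fa42cb56e8901, 0x11fedcba9876543210, 0x12fedcba9876543210,
   0x13fedcba9876543210, 0x14fedcba9876543210, 0x15fedcba9876543210, 0x16fedcba9876543210,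
   0x16fecdb80a76543219, 0x17fedcba9876543210, 0x18fedcba9876543210, 0x19fedcba9876543210,
   0x11fcedb80a76543219, 0x15fecdb80a76543219, 0x14fecdb80a76543219, 0x17fecdb80a76543219,
   0x18fecdb80a76543219, 0x19fecdb80a76543219, 0x12fedcb80a76543219, 0x13fedcb80a76543219,
   0xefecdba9876534120, 0x5d47f831cb56ea092, 0x5d47fa31cb56e8902, 0xffedcba9876534120,
   0x10fedcba9876534120, 0xefedcb80a76534129, 0xffedcb80a76534129, 0x1029064ad81c35b7fe,
   0x11fedcba9876534120, 0x13fedcba9876534120, 0x12fedcba9876534120, 0x14fedcba9876534120,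
   0x15fedcba9876534120, 0x16fedcba9876534120, 0x19fedcba9876534120, 0x16fecdb80a76534129,
   0x17fedcba9876534120, 0x18fedcba9876534120, 0x11fcedb80a76534129, 0x15fecdb80a76534129,
   0x14fecdb80a76534129, 0x19fecdb80a76534129, 0x17fecdb80a76534129, 0x18fecdb80a76534129,
   0x13fedcb80a76534129, 0x12fedcb80a76534129, 0x1afedcba9876543210, 0x1afedbca9876534120,
   0x1bfedcba9876543210, 0x11d8f47a9ec653b120, 0x17febdc314756a8902, 0x18febdc314756a8902,
   0x15febdc314756a8902, 0x14febdc314756a8902, 0x19febdc314756a8902, 0x1cfedcba9876543210,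
   0x18c48f7a9de653b120, 0x19febcd3147568a092, 0x1afedbc80a76534129, 0x1bfecdb80a76543219,
   0x11eaf4780cd653b129, 0x14febcd3147568a092, 0x15febcd3147568a092, 0x1cfecdb80a76543219,
   0x18d4af780ce653b129, 0x17febdc3147568a092, 0x18febdc3147568a092, 0x1bfedcba9876534120,
   0x11d8f37a9ec654b210, 0x17febdc423756a8901, 0x18febdc423756a8901, 0x15febdc423756a8901,
   0x14febdc423756a8901, 0x19febdc423756a8901, 0x18c38f7a9de654b210, 0x1cfedcba9876534120,
   0x19febcd4237568a091, 0x1afedbc80a76543219, 0x1bfecdb80a76534129, 0x11eaf3780cd654b219,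
   0x14febcd4237568a091, 0x15febcd4237568a091, 0x18d3af780ce654b219, 0x1cfecdb80a76534129,
   0x17febdc4237568a091, 0x18febdc4237568a091, 0x1dfedcba9876543210, 0x19106937c52b4ad8fe,
   0xac84f7a9de653b120, 0xb160937c52b4daf8e, 0x18c84f731be56ad902, 0x1cfebcd3147568a092,
   0xeb23f8756da04ce91, 0xec98f4765b32ade10, 0x1dfebdc314756a8902, 0x1bfebcd3147568a092,
   0x19025187d69ca3b4fe, 0xec0af3765d418be29, 0x1dfedcba9876534120, 0xac83f7a9de654b210,
   0x19206947c51b3ad8fe, 0xb260947c51b3daf8e, 0x18c83f742be56ad901, 0x1cfebcd4237568a091,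
   0xec98f3765b41ade20, 0xeb14f8756da03ce92, 0x1dfebdc423756a8901, 0x1bfebcd4237568a091,
   0x19015287d69ca4b3fe, 0xed0af4765c328be19, 0x1dfedbc4237568a091, 0x1dfecbd3147568a092,
   0x1afebdc423756a8901, 0x1afebdc314756a8902, 0x12c8f37a9db654e210, 0x13fecdb423756a8901,
   0x1620946a8d57b31cef, 0x620694dfa57b13ec8, 0x5c87f3a9db65e4120, 0x1610936a8d57b42cef,
   0x12c8f47a9db653e120, 0x13fecdb314756a8902, 0x610693dfa57b24ec8, 0x5c87f4a9db65e3210,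
   0xffedcb423756a8901, 0xffedcb314756a8902, 0xdfecbd4237568a091, 0xefedcb423756a8901,
   0xefedcb314756a8902, 0x10fedcb423756a8901, 0x10021584d39ca6b7fe, 0xefebdc4237568a091,
   0xefebdc3147568a092, 0x199152a7b60c84d3fe, 0x10febdc4237568a091, 0x199251a7b60d83c4fe,
   0x109215a4b30d86c7fe, 0xec23fa756b894de01, 0x1dfebdc80a76543219, 0x19196037d52c48bafe,
   0xada3f780be654c219, 0xffebdc4237568a091, 0x13fedbc4237568a091, 0x12daf3780bc654e219,
   0x16190368ab57c42def, 0xed14fa756b893ce02, 0xada4f780be653c129, 0x1dfebdc80a76534129,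
   0x19296047d51c38bafe, 0xffebdc3147568a092, 0x16290468ab57c31def, 0x13fedbc3147568a092,
   0x12daf4780bc653e129, 0xb169037d52c4b8fae, 0xb269047d51c3b8fae, 0xdfedcb423756a8901,
   0x629604bf857c13eda, 0x619603bf857c24eda, 0x1bfedcb423756a8901, 0x1bfecdb314756a8902,
   0x1cfecdb314756a8902, 0x18da4f731ce568b092, 0x1cfecdb423756a8901, 0x18da3f742ce568b091,
   0x1afecbd4237568a091, 0x1afecbd3147568a092, 0x5da7f380bc65e4129, 0x5da7f480bc65e3219],
   [0x37e5c6b3fa980214d, 0x77ed56fcba9802143, 0x87ed56fcba9802143, 0x39d14a672bf538ec0,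
   0x3c0f7ab45612e893d, 0x894d1a206bf538ec7, 0x94932bae8c5f1607d, 0x834c18206bf59ade7,
   0x34d932ac8b7f1065e, 0x743c928dab7f1065e, 0x85ed70fcba9862143, 0x39d14a052bf738ec6,
   0x3c6f5ab47012e893d, 0x894d1a260bf738ec5, 0x94932bae8c7f1065d, 0x834c18260bf79ade5,
   0x3ae8c9b0f7653412d, 0x7aed89fcb76534120, 0x8aed89fcb76534120, 0x36d1279a4bf805ec3,
   0x3c3fa7b28914e560d, 0x862c17439bf805eda, 0x92604b7e5c8f193ad, 0x802c15439bf867dea,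
   0x1b0c1259a4bf867de3, 0x1b3d148672bf59ace0, 0x3ae8c9b6f5073412d, 0x8ade89fcb50734126,
   0x7ade89fcb50734126, 0x1b6c1279a4bf805ed3, 0x1b3e148052bf79acd6, 0x37e5c6b9f83a0214d,
   0x87ce56fdb83a02149, 0x77ce56fdb83a02149, 0x34e3928cab7f1065d, 0x85cd70feb83a62149,
   0x749e32ad8b7f1065c, 0x32e6047c5baf1398d, 0x720e645c7baf1398d, 0x88dca3feb76594120,
   0x36e127384bfa05dc9, 0x3c9f87b2a314d560e, 0x862e17493bfa05dc8, 0x92604b7d5eaf1398c,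
   0x802e15493bfa67cd8, 0x1b9d14a672bf538ec0, 0x1b0e125384bfa67cd9, 0x32e0645c7baf1398d,
   0x88cda3feb50794126, 0x726e047d5baf1398c, 0x1b9d14a052bf738ec6, 0x1b6e127384bfa05dc9,
   0xe0125ca89bf367de4, 0x113841bad9c5f6270e, 0x144329c671bf5a8ed0, 0x153481bae9c5f6270d,
   0xc43d298cab5f6170e, 0x1a0e152a89bf376cd4, 0x183184bac9d5f6270e, 0x1c4d932ac8b5f1607e,
   0xd7ec56a98fbd02143, 0x7ec56a98fbd02143, 0x591d4a672bf538ec0, 0x691d4a672bf538ec0,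
   0x7ed5683afbc02149, 0x1914ca672bf538ed0, 0x27ed56a98fbc02143, 0x1314c8672bf59ade0,
   0x531d48672bf59aec0, 0x631d48672bf59aec0, 0xe6127ba89cf305ed4, 0xe5db70a98621fce43,
   0x1d7e6c5240a89fbd31, 0x193184bac9d5f2607e, 0x1b7e65c240a89bf3d1, 0xe7dc56a98021fbe43,
   0xd617b2a98cf450de3, 0x107ec56a98021fbd43, 0xf7ec56a98021fbd43, 0xe7ec5683a021fbd49,
   0x104932bac8d5f1607e, 0xf7ec5683a021fbd49, 0x1d5e0c7246a89fbd31, 0x1b5e07c246a89bf3d1,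
   0x193184bac9d7f2065e, 0x1a6e172a89bf350cd4, 0xc43d298cab7f0156e, 0x113841bad9c7f0256e,
   0x144329c051bf7a8ed6, 0x153481bae9c7f0256d, 0x1c4d932ac8b7f1065e, 0x183184bac9d7f0256e,
   0xf5ec70a98621fbd43, 0x105ec70a98621fbd43, 0xe5ec7083a621fbd49, 0xf5ec7083a621fbd49,
   0x104932bac8d7f1065e, 0x439b28cad7f1065e, 0x691d4a052bf738ec6, 0x591d4a052bf738ec6,
   0x493b2ad8c7f1065e, 0x1914ca052bf738ed6, 0x2493b2ae8c7f1065d, 0x1314c8052bf79ade6,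
   0x631d48052bf79aec6, 0x531d48052bf79aec6, 0xaed89765fbc34120, 0xaed89507fbc34126,
   0x1aed89765fbc34120, 0x2aed89765fbc34120, 0x1ade89507fbc34126, 0xdaec89765fbd34120,
   0x561d279a4bf805ec3, 0x661d279a4bf805ec3, 0x501d259a4bf867ec3, 0x601d259a4bf867ec3,
   0x112406c9a1bf875de3, 0x142046c9a1bf875ed3, 0x150251b7e6c8f94a3d, 0xe3148c756bf09ade2,
   0x1a3e184756bf0a9cd2, 0xc20d465c7b8f91a3e, 0x180152b7c6d8f94a3e, 0x1c2d6047c5b8f193ae,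
   0xf0125c9a4bf867de3, 0xf3148c672bf59ade0, 0xc31e84672bf5a9cd0, 0xc01d529a4bf876ce3,
   0xf8dba3765941fce20, 0x1a9d1a4756cf083be2, 0x192046b9a1df875ec3, 0x1efedcba9876543210,
   0x182640b9a1df875ce3, 0x1c0d1259a4bf867ec3, 0x194329b671df5a8ec0, 0x1efedcb765a9820413,
   0x184923b671df5a8ce0, 0x1c3e148672bf59adc0, 0x620d645c7b8f193ae, 0x520d645c7b8f193ae,
   0x526d047c5b8f193ae, 0x626d047c5b8f193ae, 0x112460c9a1bf857de3, 0x156271b5d0c8f94a3e,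
   0x142640c9a1bf857de3, 0x186172b5c0d8f94a3e, 0x1c2d0645c7b8f193ae, 0xe3148c570bf69ade2,
   0x1a3e184570bf6a9cd2, 0xc26d407c5b8f91a3e, 0xf6127b9a4cf805ed3, 0x194329c051df7a8eb6,
   0x1efdebc507a9826413, 0x1991a4c8b3e7f2065d, 0x119a41c8b3d7f0256e, 0x1c4e3928bac7f1065d,
   0x1891a4c8b3e7f0256d, 0x643d928bac7f1065e, 0x543e928bac7f1065d, 0x1ffedcba9876543210,
   0x20fedcba9876543210, 0x10b65f8240da37ce91, 0x106127b9a4df805ec3, 0x20fdebc76583a20419,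
   0x1ffdebc76583a20419, 0x1b8d3ab429570cf6e1, 0xc91da4052cf783be6, 0x184329c051df78abe6,
   0x1c9d14a052cf738eb6, 0x119a41c8b3d5f6270e, 0x1891a4c8b3d5f6270e, 0x1c4d3928bac5f1607e,
   0x643d928bac5f1607e, 0x543d928bac5f1607e, 0x1991a4c8b3d5f2607e, 0x20fdecba9850743216,
   0x10914ac672df538eb0, 0x1faed89fbc31475602, 0x1b8d3ab429756cf0e1, 0xc91da4672cf583be0,
   0x184329c671df58abe0, 0x1c9d14a672cf538eb0, 0x100125b9a4df867ec3, 0x20fdebc50783a26419,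
   0x1ffdebc50783a26419, 0xc61d729a4bf850ce3, 0xc31e84052bf7a9cd6, 0xf3148c052bf79ade6,
   0xf8dba3507941fce26, 0x182046b9a1df857ce3, 0x1c6d1279a4bf805ec3, 0x1a9d1a4570cf683be2,
   0x192640b9a1df857ec3, 0x1efedcba9850743216, 0x184923b051df7a8ce6, 0x1c3e148052bf79adc6,
   0xe0125c8a3bf967de4, 0x1594a1b8d3c5f6270e, 0x144923c671bf58ade0, 0xc49e23ac8b5f6170d,
   0x1a0d1528a3bf976ce4, 0x549d32ac8b5f1607e, 0x649e32ac8b5f1607d, 0xe6127b8a3cf905ed4,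
   0x1b7e65c2408a3bf9d1, 0x1d7d6c52408a3fbe91, 0x1b5d07c2468a3bf9e1, 0x1d5d0c72468a3fbe91,
   0x1a6d1728a3bf950ce4, 0xc49e23ac8b7f0156d, 0x1594a1b8d3c7f0256e, 0x144923c051bf78ade6,
   0x549d32ac8b7f1065e, 0x649e32ac8b7f1065d, 0xe8dba3765941fce20, 0xe914ab756cf038ed2,
   0x1dae9c8423756fbd01, 0x1bae98c423756bf0d1, 0x190152b7c6d8f493ae, 0xd91ab4765cf283de0,
   0xeaec89765341fbd20, 0xfaec89765341fbd20, 0x10aec89765341fbd20, 0xeaec89507341fbd26,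
   0xfaec89507341fbd26, 0x102604b7c5d8f193ae, 0x206c45b7daf1398e, 0x661e27384cfa05db9,
   0x561e27384cfa05db9, 0x1d8d3ba429756fce01, 0x108dba3765941fce20, 0xc20e465b7caf3189d,
   0xf914ab672cf538ed0, 0x1efdebc83a76549210, 0x192046c381efa75db9, 0x620e645b7caf1398d,
   0x520e645b7caf1398d, 0x196172c5b0eaf4398d, 0x116721c5b0daf3489e, 0x186172c5b0eaf3489d,
   0x1c2e0645b7caf1398d, 0x1ffedcb765a9820413, 0x20fedcb765a9820413, 0x10b98f5423d70ace61,
   0xc61e72384cfa50bd9, 0x182046c381efa57bd9, 0x1c6e127384cfa05db9, 0xe8dba3507941fce26,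
   0x196172b5c0d8f493ae, 0xe914ab570cf638ed2, 0x1bae98c423570bf6d1, 0x1dae9c8423570fbd61,
   0x260c47b5daf1398e, 0x601e25384cfa67db9, 0x501e25384cfa67db9, 0x190152c7b6eaf4398d,
   0x102604c7b5eaf1398d, 0x110521c7b6daf3489e, 0x180152c7b6eaf3489d, 0x1c2e6047b5caf1398d,
   0xc01e52384cfa76bd9, 0x182640c381efa75bd9, 0x1c0e125384cfa67db9, 0x526e047b5caf1398d,
   0x626e047b5caf1398d, 0x1d8d3ba429570fce61, 0xc26e407b5caf3189d, 0x1ffedcb507a9826413,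
   0x20fedcb507a9826413, 0x10b98f7423d56ace01, 0xf914ab052cf738ed6, 0x1efdebc83a50749216,
   0x192640c381efa57db9, 0x1612c7384bfa05ed9, 0x2260b47e5caf1398d, 0x1012c5384bfa67de9,
   0x142046c381bfa75ed9, 0x150251b7e6caf3489d, 0xf0125c384bfa67de9, 0x20fdebc83a50749216,
   0x103148b672df59aec0, 0x1f8eda3fcb91475602, 0x194923b671df58aec0, 0x1efedcb76583a20419,
   0x156271b5d0caf3489e, 0x142640c381bfa57de9, 0xf6127b384cfa05ed9, 0x20fdecb83a76549210,
   0x1ffdecb83a76549210, 0x10b65fa240e897cd31, 0x194923c051df78aeb6, 0x1efdebc50783a26419],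
   [0xe13906bf857c42eda, 0x475ec6b3fa980214d, 0x2002e1543967b8acdf, 0x1b19603bf58ac24de7,
   0x21fedcba9876543210, 0x1b4e3928cab7f1065d, 0x8c56f87db012ea394, 0xb0512b7c6d8f94a3e,
   0x11a8cd9b2f3147560e, 0x18ae8c9b2f3147560d, 0x17ae8c9b2f3147560d, 0x15ae8c9b2f3147560d,
   0x14ae8c9b2f3147560d, 0x19ae8c9b2f3147560d, 0x22fedcba9876543210, 0x1d051c29a4bf876ed3,
   0x20ae9c8423fdb61705, 0xcade98fcb50743216, 0x1bae8c9b6f5073412d, 0x11cfa35b68d074921e,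
   0x18c3fa5b68e074921d, 0x1cae8c9b6f5073412d, 0x15ae98c423570bf6d1, 0x14ae98c423570bf6d1,
   0x1a16309bf857d24cea, 0x1d13690cf58ab42ed7, 0x849e32ad8b7f1065c, 0xf19306bf857c42eda,
   0x217d65b240fec91a38, 0xcae98b507341cf2d6, 0x174923c671bf5a8de0, 0xec3f72a98d04b651e,
   0x1d7ec56fdba9802143, 0x1a139608da2c4b5f7e, 0xca9ed8423570fcb61, 0x229541adf802ce36b7,
   0xf4392c8dab7f1065e, 0x1e756bd012c8f94a3e, 0x1c65f82407dbea391, 0xfae9d8765fbc43210,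
   0x11aed98765fbc43210, 0x12aed98765fbc43210, 0x13aed98765fbc43210, 0x14aed98765fbc43210,
   0x15aed98765fbc43210, 0x16aed98765fbc43210, 0xea9dc8765fbe43210, 0x23fedcba9876543210,
   0x17a9dc8765fbe43210, 0x130521b7d6c8f94a3e, 0x1e42e39dfa671b85c0, 0x1dc2f3ab586174d90e,
   0x13c5af376d941b82e0, 0x17c53af4298be7d601, 0x23509c7a8d423bf6e1, 0x24fedcba9876543210,
   0x25fedcba9876543210, 0x26fedcba9876543210, 0x27fedcba9876543210, 0x28fedcba9876543210,
   0x29fedcba9876543210, 0x257e6d5240fcb91a38, 0x267e6d5240fcb91a38, 0x227e6d5240fcb91a38,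
   0x1e7e6c5fdb240a8931, 0x1f02e154396b7daf8c, 0x1f75e6c012b8f94a3d, 0x154923d051cf78abe6,
   0x1ea9e8dc7f4235b061, 0x1fae9d8423fbc01567, 0xfb65f8240da37ce91, 0x1dc978f50b432ade16,
   0x1cc53af429d708be61, 0x1ac63fa204d71b85e9, 0x25106932b45c78eafd, 0x264e2396718ab50cdf,
   0xec23af7568be4d901, 0x1ba9dc8765341fbe20, 0x1ca9dc8765341fbe20, 0x1aa9d8c507341bf2e6,
   0x1da98dcb6f5074321e, 0x13a9c8d423570bf6e1, 0xfa98cd423570bf6e1, 0xc19603bf857c24dea,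
   0x224e9325708ab61cdf], [0x1102185bf367ca9de4, 0x1510936ae85c7b2f4d, 0x1401285bf367ca9ed4,
   0x1113069bf28ac75de4, 0x1410369bf28ac75ed4, 0x15015287e69cab3f4d, 0x1708215bf367da9ce4,
   0x1716309bf28ad75ce4, 0x238d30a169bf275ce4, 0x297ec56fdb91a24038, 0x216217b0854e3d9fac,
   0x1116093bf524ca8de7, 0x1410693bf524ca8ed7, 0x1501852ae93c4b6f7d, 0x1105128bf69ac43de7,
   0x15103694e28cab5f7d, 0x1401528bf69ac43ed7, 0x1719603bf524da8ce7, 0x1702518bf69ad43ce7,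
   0x232e604193bf5a8cd7, 0x294ec32fdb80a67159, 0x212604b1937e5d8fac, 0x292e60475b139df8ca,
   0x21830ab1694e2d5f7c, 0x29aec98fdb50734126, 0x21951ab0287e6d3f4c, 0x29aec89fdb31457062,
   0x1108152bf934c76dea, 0x15106937e52c4b8fad, 0x1401852bf934c76eda, 0x1119036bf857c42dea,
   0x1410936bf857c42eda, 0x15012854e36c7b9fad, 0x1705812bf934d76cea, 0x1713906bf857d42cea,
   0x235d907136bf842cea, 0x294ec23fdb6178a095, 0x213814b052ae9d6f7c, 0x298d30a42b196ef5c7,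
   0x297ec65fdb2049a183, 0x215907b136ae8d2f4c, 0x295e907a8b163df2c4, 0xe432cda98671bf5e0,
   0x1a4e3c2a98671fbd50, 0xc015289da6c7b3f4e, 0x1c05812ad96c73b4fe, 0x13051287d69cab3f4e,
   0x1aae9d8765341fcb20, 0xe756cda89240bf3e1, 0x1a7e5c6a89240fbd31, 0xc103698da2c4b5f7e,
   0x1c13906ad82c45b7fe, 0x13130694d28cab5f7e, 0x235790b136ad8c2f4e, 0x22951da0287c6e3f4b,
   0x1319036ad85b7c2f4e, 0x24ade89fbc31457062, 0x277ec56fdb91a24038, 0x28aed89fbc31457062,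
   0x26951ca0287d6e3f4b, 0x25aed89fbc31457062, 0x267ed56fcb91a24038, 0x257ed56fcb91a24038,
   0x1aae8d9423570fcb61, 0x22830da1694c2e5f7b, 0x1308152ad93b4c6f7e, 0x24c4f89e7a31b5d062,
   0x287eb65fcd2049a183, 0x27aed98fbc50734126, 0x26aed98fbc50734126, 0x25c4f89d7a31b5e062,
   0x264ed32fcb80a67159, 0x25b7f23da461c8e095, 0x2195e1a7b6d3f0284c, 0x2183e0a4b2d5f1697c,
   0x21106392c45e78bafd, 0x2afedcba9876543210, 0x2bfedcba9876543210, 0x2bfecdb756a8942301,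
   0x2bae9d8570fbc31462, 0x2bae8d9341fcb50726, 0x2b830ba1694d2c5f7e, 0x2b7e6d5240fcb91a38,
   0x21018253c49ea6b7fd, 0x1a7e6c54329a1fbd80, 0xe765cd4329a1bf8e0, 0xc018523d49cab6f7e,
   0x1c082154d39ca6b7fe, 0x22260b41937d5e8fac, 0xe423cd7568a0bf9e1, 0x1a4e2c37568a0fbd91,
   0xc109365d78cab2f4e, 0x1c196037d58ca2b4fe, 0x21012586b73e49cafd, 0x22621b70854d3e9fac,
   0x2162e174c3b9f085ad, 0x2b95ba17d6c3f0284e, 0x2b590c7136ad8b2f4e, 0xea98cd765341bf2e0,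
   0xc012856d73c4b9fae, 0x1c025187d63c49bafe, 0x13021854d36c7b9fae, 0x232460c1937d5b8fae,
   0x22590d7136ac8e2f4b, 0x26590c7136ad8e2f4b, 0x25caf56d4791b2e038, 0x13160937d52c4b8fae,
   0xea89cd423570bf6e1, 0xc106932d45c7b8fae, 0x1c163094d25c78bafe, 0x26381c4052ad9e6f7b,
   0x254ed23fbc6178a095, 0x22381c4052ad9e6f7b, 0x238a30b1694d2c5f7e], [0xb3148b672df59ace0,
   0xa3814bac9d5f6270e, 0xb4239b671df58ace0, 0xa4923bac8d5f6170e, 0xb3148b052df79ace6,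
   0xa3814bac9d7f0256e, 0xb4239b051df78ace6, 0xa4923bac8d7f0156e, 0x19c0f79b85e4a6123d,
   0x19c6f59b87d4a0123e, 0x19c0f78b95e3a6214d, 0x19c6f58b97d3a0214e, 0x90215b493efa67dc8,
   0x761e27384bfa05dc9, 0x7c98f7aeb423d5601, 0x762e17493bfa05dc8, 0x7c89f7aeb314d5602,
   0x96217b493efa05dc8, 0x163481bae9c5f6270d, 0x123841bad9c5f6270e, 0x164392bae8d5f6170c,
   0x124932bad8c5f6170e, 0x1e4e293ad8051fcb76, 0x1e3e184ad9052fcb76, 0x1e4e293ad8671fcb50,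
   0x163481bae9c7f0256d, 0x123841bad9c7f0256e, 0x1e3e184ad9672fcb50, 0x164392bae8d7f0156c,
   0x124932bad8c7f0156e, 0x133184d672bf59ace0, 0x134293d051cf78abe6, 0xcb68f5240da3c79e1,
   0x1bc87f950b432da1e6, 0x210e1259a476d83bcf, 0x134293d671cf58abe0, 0xcb08f7246da3c59e1,
   0x1bc85f976b432da1e0, 0x216e1279a450d83bcf, 0x133184d052bf79ace6, 0xcb69f5130da4c78e2,
   0x1bc97f850b341da2e6, 0x210e2158a376d94bcf, 0xcb09f7136da4c58e2, 0x1bc95f876b341da2e0,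
   0x216e2178a350d94bcf, 0x2621d7493cfa05eb8, 0x1ad15af627c309b48e, 0x1ad25af617c408b39e,
   0x146172c5b0daf4398e, 0x146271c5b0daf3489e, 0x2b98f7423adce5601, 0x140152c7b6daf4398e,
   0x140251c7b6daf3489e, 0x1ad17af025c369b48e, 0x1ad27af015c468b39e], [0xb7ed56a89012fbc34,
   0xa75ec6b3f021a984d, 0xb75ec6b3f0219a48d, 0x1eade89314fbc02567, 0x575ec6b8f94a0123d,
   0x67de56fcb94a01238, 0xbaed98765432fbc10, 0xaa9ec8b1f4237560d, 0xba9ec8b1f4235706d,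
   0x6ade98fcb50743216, 0x5a9ec8b6f5074321d, 0x1e7ed65130fbc4298a, 0x57e5d6a89fbc01234,
   0x67e5d694afbc01238, 0x13ae9d8765432fcb10, 0x137e5d6a89012fbc34, 0x1cae89d314570cf6b2,
   0x234e2398ba671fdc50, 0x1c7e65c1309a4bf8d2, 0x5ae9d8765fbc43210, 0x6ae9d8507fbc43216,
   0x23b936f10c8a257de4], [0xcae8d9507fbc34126, 0xcae8d9314fcb57062, 0x1aa89cd507fbe34126,
   0x1aa89cd314fbe57062, 0xcae9d8765fbc43210, 0xcae9d8423fcb75601, 0x1aa98dc765fbe43210,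
   0x1aa98dc423fbe75601, 0x1da9d8c423756bf0e1, 0x1da9d8c765432bf1e0, 0x1da8c9d507341bf2e6,
   0x1da8c9d314570bf6e2]]

/-! ### Correctness of the lists of independent sets -/

theorem filt_eq {α : Type} (p : α → Bool) (l : List α) : filt p l = l.filter p := by
  induction l with
  | nil => rfl
  | cons x xs ih =>
    have : filt p (x :: xs) = Bool.rec (filt p xs) (x :: filt p xs) (p x) := rfl
    rw [this, ih, List.filter_cons]
    cases p x <;> rfl

theorem force_eq {α : Type} (x : ℕ) (k : ℕ → α) : force x k = k x := by
  cases x <;> rfl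

theorem forceList_eq {α : Type} (l : List ℕ) (k : List ℕ → α) : forceList l k = k l := by
  induction l generalizing k with
  | nil => rfl
  | cons x xs ih => simp [forceList, force_eq, ih]

theorem forceLists_eq {α : Type} (l : List (List ℕ)) (k : List (List ℕ) → α) :
    forceLists l k = k l := by
  induction l generalizing k with
  | nil => rfl
  | cons x xs ih => simp [forceLists, forceList_eq, ih]

theorem forceSpine_eq {α β : Type} (l : List β) (k : List β → α) : forceSpine l k = k l := by
  induction l generalizing k with
  | nil => rfl
  | cons x xs ih => simp [forceSpine, ih]

theorem forceCones_eq {α : Type} (l : List Cone) (k : List Cone → α) : forceCones l k = k l := by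
  induction l generalizing k with
  | nil => rfl
  | cons x xs ih => simp [forceCones, force_eq, ih]

theorem forcePairs_eq {α : Type} (l : List (ℕ × ℕ)) (k : List (ℕ × ℕ) → α) :
    forcePairs l k = k l := by
  induction l generalizing k with
  | nil => rfl
  | cons x xs ih => simp [forcePairs, force_eq, ih]

/-- The bits of `s` are the elements of `A`. -/
def Codes (s : ℕ) (A : Finset ℕ) : Prop := ∀ i, s.testBit i = true ↔ i ∈ A

/-- The set `A` of vertices is independent in the graph with rows `g`. -/
def RowIndep (g : List ℕ) (A : Finset ℕ) : Prop :=
  ∀ j ∈ A, ∀ i ∈ A, i < j → (g.getD j 0).testBit i = false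

theorem beq_iff {a b : ℕ} : Nat.beq a b = true ↔ a = b :=
  ⟨Nat.eq_of_beq_eq_true, fun h => h ▸ Nat.beq_refl a⟩

theorem land_eq_zero_iff {a b : ℕ} :
    Nat.beq (Nat.land a b) 0 = true ↔ ∀ i, a.testBit i = true → b.testBit i = false := by
  rw [beq_iff]
  constructor
  · intro h i hi
    have h' : (a &&& b).testBit i = false := by
      change (Nat.land a b).testBit i = false
      rw [h]; simp
    rw [Nat.testBit_and, hi] at h'
    simpa using h'
  · intro h
    apply Nat.eq_of_testBit_eq
    intro i
    change (a &&& b).testBit i = _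
    rw [Nat.testBit_and]
    cases ha : a.testBit i
    · simp
    · simp [h i ha]

theorem Codes.land_eq_zero_iff {a b : ℕ} {A B : Finset ℕ} (ha : Codes a A) (hb : Codes b B) :
    Nat.beq (Nat.land a b) 0 = true ↔ Disjoint A B := by
  rw [Folkman.land_eq_zero_iff, Finset.disjoint_left]
  refine forall_congr' fun i => ?_
  rw [ha i, ← hb i]
  simp

theorem getD_addLayer (b row : ℕ) (prev : List ℕ) (ls : List (List ℕ)) (j s : ℕ) :
    s ∈ (addLayer b row prev ls).getD j [] ↔ s ∈ ls.getD j [] ∨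
      ∃ t ∈ (prev :: ls).getD j [], Nat.beq (Nat.land t row) 0 = true ∧ s = Nat.lor t b := by
  induction ls generalizing prev j with
  | nil =>
    cases j with
    | zero =>
      change s ∈ (filt _ prev).map _ ↔ _
      rw [filt_eq, List.mem_map]
      simp only [List.mem_filter, and_assoc, List.getD_nil, List.not_mem_nil, false_or,
        List.getD_cons_zero, @eq_comm _ s]
    | succ j => simp [addLayer]
  | cons l ls ih =>
    cases j with
    | zero =>
      change s ∈ l ++ (filt _ prev).map _ ↔ _
      rw [filt_eq, List.mem_append, List.mem_map]
      simp only [List.mem_filter, and_assoc, List.getD_cons_zero, @eq_comm _ s]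
    | succ j =>
      simp only [addLayer, List.getD_cons_succ]
      rw [ih]

theorem mem_addVertex (b row : ℕ) (I : List (List ℕ)) (j s : ℕ) :
    s ∈ (addVertex b row I).getD j [] ↔ s ∈ I.getD j [] ∨
      ∃ i, j = i + 1 ∧ ∃ t ∈ I.getD i [], Nat.beq (Nat.land t row) 0 = true ∧ s = Nat.lor t b := by
  cases I with
  | nil => simp [addVertex]
  | cons l ls =>
    cases j with
    | zero => simp [addVertex]
    | succ j =>
      simp only [addVertex, List.getD_cons_succ]
      rw [getD_addLayer]
      constructor
      · rintro (h | h)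
        · exact Or.inl h
        · exact Or.inr ⟨j, rfl, h⟩
      · rintro (h | ⟨i, hi, h⟩)
        · exact Or.inl h
        · obtain rfl : j = i := by omega
          exact Or.inr h

theorem Codes.lor_two_pow {t m : ℕ} {A : Finset ℕ} (h : Codes t A) :
    Codes (Nat.lor t (2 ^ m)) (insert m A) := by
  intro i
  change (t ||| 2 ^ m).testBit i = true ↔ _
  rw [Nat.testBit_or, Nat.testBit_two_pow, Bool.or_eq_true, h i, Finset.mem_insert, or_comm]
  simp [eq_comm]

/-- `I` lists by size the independent sets of the first `m` vertices. -/
structure ListsIndep (g : List ℕ) (m : ℕ) (I : List (List ℕ)) : Prop where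
  sound : ∀ j, ∀ s ∈ I.getD j [], ∃ A ⊆ Finset.range m, Codes s A ∧ A.card = j ∧ RowIndep g A
  complete : ∀ A ⊆ Finset.range m, RowIndep g A → ∃ s ∈ I.getD A.card [], Codes s A

theorem ListsIndep.addVertex {g : List ℕ} {m : ℕ} {I : List (List ℕ)} (h : ListsIndep g m I) :
    ListsIndep g (m + 1) (addVertex (2 ^ m) (g.getD m 0) I) where
  sound := by
    intro j s hs
    rw [mem_addVertex] at hs
    obtain hs | ⟨i, rfl, t, ht, hd, rfl⟩ := hs
    · obtain ⟨A, hA, h1, h2, h3⟩ := h.sound j s hs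
      exact ⟨A, hA.trans (Finset.range_subset_range.2 (by omega)), h1, h2, h3⟩
    · obtain ⟨A, hA, h1, h2, h3⟩ := h.sound i t ht
      have hm : m ∉ A := fun hm => by simpa using hA hm
      refine ⟨insert m A, ?_, h1.lor_two_pow, by rw [Finset.card_insert_of_notMem hm, h2], ?_⟩
      · intro x hx
        rcases Finset.mem_insert.1 hx with rfl | hx
        · simp
        · have := Finset.mem_range.1 (hA hx)
          exact Finset.mem_range.2 (by omega)
      · intro y hy x hx hxy
        rcases Finset.mem_insert.1 hy with hy' | hy
        · rcases Finset.mem_insert.1 hx with hx' | hx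
          · omega
          · rw [hy']
            exact Folkman.land_eq_zero_iff.1 hd x ((h1 x).2 hx)
        · rcases Finset.mem_insert.1 hx with hx' | hx
          · have := Finset.mem_range.1 (hA hy)
            omega
          · exact h3 y hy x hx hxy
  complete := by
    intro A hA hI
    by_cases hm : m ∈ A
    · have hE : A.erase m ⊆ Finset.range m := by
        intro x hx
        have h1 := Finset.mem_range.1 (hA (Finset.mem_of_mem_erase hx))
        have h2 := Finset.ne_of_mem_erase hx
        exact Finset.mem_range.2 (by omega)
      obtain ⟨t, ht, hc⟩ := h.complete (A.erase m) hE fun y hy x hx =>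
        hI y (Finset.mem_of_mem_erase hy) x (Finset.mem_of_mem_erase hx)
      refine ⟨Nat.lor t (2 ^ m), ?_, ?_⟩
      · rw [mem_addVertex]
        refine Or.inr ⟨(A.erase m).card, (Finset.card_erase_add_one hm).symm, t, ht, ?_, rfl⟩
        rw [Folkman.land_eq_zero_iff]
        intro i hi
        have hi' := (hc i).1 hi
        exact hI m hm i (Finset.mem_of_mem_erase hi') (Finset.mem_range.1 (hE hi'))
      · have := hc.lor_two_pow (m := m)
        rwa [Finset.insert_erase hm] at this
    · have hE : A ⊆ Finset.range m := by
        intro x hx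
        have h1 := Finset.mem_range.1 (hA hx)
        have h2 : x ≠ m := fun h => hm (h ▸ hx)
        exact Finset.mem_range.2 (by omega)
      obtain ⟨t, ht, hc⟩ := h.complete A hE hI
      exact ⟨t, (mem_addVertex ..).2 (Or.inl ht), hc⟩

theorem listsIndep_layersFrom (g : List ℕ) (pre suf : List ℕ) (I : List (List ℕ))
    (hg : g = pre ++ suf) (hI : ListsIndep g pre.length I) :
    ListsIndep g g.length (layersFrom (2 ^ pre.length) suf I) := by
  induction suf generalizing pre I with
  | nil => simpa [layersFrom, hg] using hI
  | cons r rs ih =>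
    have h := hI.addVertex
    have hr : g.getD pre.length 0 = r := by simp [hg]
    rw [hr] at h
    have := ih (pre ++ [r]) (addVertex (2 ^ pre.length) r I) (by simp [hg]) (by simpa using h)
    have e : Nat.mul 2 (2 ^ pre.length) = 2 ^ (pre.length + 1) := by
      change 2 * 2 ^ pre.length = _
      ring
    rw [layersFrom, e]
    simpa using this

theorem listsIndep_layers (g : List ℕ) : ListsIndep g g.length (layers g) := by
  refine listsIndep_layersFrom g [] g [[0]] rfl ⟨?_, ?_⟩
  · intro j s hs
    cases j with
    | zero =>
      obtain rfl : s = 0 := by simpa using hs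
      exact ⟨∅, by simp, fun i => by simp, rfl, fun j hj => by simp at hj⟩
    | succ j => simp at hs
  · intro A hA _
    obtain rfl : A = ∅ := by simpa using hA
    exact ⟨0, by simp, fun i => by simp⟩

theorem testBit_missedBits (c : ℕ) (sets : List ℕ) (t : ℕ) :
    (missedBits c sets).testBit t = true ↔
      ∃ s, sets[t]? = some s ∧ Nat.beq (Nat.land s c) 0 = true := by
  induction sets generalizing t with
  | nil => simp [missedBits]
  | cons s l ih =>
    have e : missedBits c (s :: l) = Bool.rec (Nat.mul 2 (missedBits c l))
        (Nat.succ (Nat.mul 2 (missedBits c l))) (Nat.beq (Nat.land s c) 0) := rfl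
    rw [e]
    cases t with
    | zero =>
      cases h : Nat.beq (Nat.land s c) 0
      · change (2 * missedBits c l).testBit 0 = true ↔ _
        simpa using beq_iff.not.1 (Bool.eq_false_iff.1 h)
      · change (2 * missedBits c l + 1).testBit 0 = true ↔ _
        simpa using beq_iff.1 h
    | succ t =>
      rw [List.getElem?_cons_succ, ← ih t]
      cases h : Nat.beq (Nat.land s c) 0
      · change (2 * missedBits c l).testBit (t + 1) = true ↔ _
        rw [Nat.testBit_succ]
        simp
      · change (2 * missedBits c l + 1).testBit (t + 1) = true ↔ _
        rw [Nat.testBit_succ, show (2 * missedBits c l + 1) / 2 = missedBits c l by omega]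

theorem testBit_required {n t : ℕ} {us : List (ℕ × List ℕ)}
    (h : (required n us).testBit t = true) :
    ∃ u ∈ us, u.1.testBit t = true ∧ n.testBit t = true ∧ (u.2.headD 0).testBit t = true := by
  induction us with
  | nil => simp [required] at h
  | cons u us ih =>
    have e : required n (u :: us) = (u.1 &&& n &&& u.2.headD 0) ||| required n us := rfl
    rw [e, Nat.testBit_or, Bool.or_eq_true] at h
    rcases h with h | h
    · simp only [Nat.testBit_and, Bool.and_eq_true] at h
      exact ⟨u, by simp, h.1.1, h.1.2, h.2⟩
    · obtain ⟨v, hv, h⟩ := ih h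
      exact ⟨v, by simp [hv], h⟩

theorem testBit_blocks {a s t : ℕ} {ls : List (List ℕ)}
    (h : ((blocks a ls).getD s 0).testBit t = true) :
    a ≤ t ∧ ∃ x ∈ ls.getD s [], ls.flatten[t - a]? = some x := by
  induction ls generalizing a s with
  | nil => simp [blocks] at h
  | cons l ls ih =>
    cases s with
    | zero =>
      have h' : (2 ^ a * (2 ^ l.length - 1)).testBit t = true := h
      rw [Nat.testBit_two_pow_mul, Bool.and_eq_true, Nat.testBit_two_pow_sub_one] at h'
      simp only [decide_eq_true_eq, ge_iff_le] at h'
      refine ⟨h'.1, l[t - a], by simp, ?_⟩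
      simp [List.getElem?_append_left h'.2]
    | succ s =>
      have h' : ((blocks (a + l.length) ls).getD s 0).testBit t = true := by
        simpa [blocks] using h
      obtain ⟨h1, x, hx, h2⟩ := ih h'
      refine ⟨by omega, x, by simpa using hx, ?_⟩
      rw [List.flatten_cons, List.getElem?_append_right (by omega), ← h2]
      congr 1
      omega

theorem mem_cones {sets : List ℕ} {n j c : ℕ} {I : List (List ℕ)} (h : c ∈ I.getD j []) :
    (⟨c, n + j, missedBits c sets⟩ : Cone) ∈ cones sets n I := by
  induction I generalizing n j with
  | nil => simp at h
  | cons l ls ih =>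
    rw [cones, List.mem_append]
    cases j with
    | zero => exact Or.inl (List.mem_map.2 ⟨c, by simpa using h, rfl⟩)
    | succ j =>
      right
      have := ih (n := Nat.succ n) (j := j) (by simpa using h)
      rwa [show Nat.succ n + j = n + (j + 1) by omega] at this

theorem le_size_of_mem_cones {sets : List ℕ} {n : ℕ} {I : List (List ℕ)} {x : Cone}
    (h : x ∈ cones sets n I) : n ≤ x.size := by
  induction I generalizing n with
  | nil => simp [cones] at h
  | cons l ls ih =>
    rw [cones, List.mem_append] at h
    rcases h with h | h
    · obtain ⟨c, -, rfl⟩ := List.mem_map.1 h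
      exact le_rfl
    · exact (Nat.le_succ n).trans (ih h)

theorem pairwise_cones (sets : List ℕ) (n : ℕ) (I : List (List ℕ)) :
    (cones sets n I).Pairwise fun x y => x.size ≤ y.size := by
  induction I generalizing n with
  | nil => simp [cones]
  | cons l ls ih =>
    rw [cones, List.pairwise_append]
    refine ⟨?_, ih _, ?_⟩
    · rw [List.pairwise_map]
      exact List.pairwise_of_forall fun _ _ => le_rfl
    · intro x hx y hy
      obtain ⟨c, -, rfl⟩ := List.mem_map.1 hx
      exact (Nat.le_succ n).trans (le_size_of_mem_cones hy)

/-! ### Completeness of the search for extensions -/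

theorem search_cons (r e : ℕ) (x : Cone) (xs : List Cone) (us : List (ℕ × List ℕ))
    (h : (r + 1) * x.size ≤ e) :
    search (r + 1) e (x :: xs) us =
      (search r (e - x.size) ((x :: xs).filter fun y => Bool.rec false
          (Nat.ble y.size (e - r * x.size)) (Nat.beq (Nat.land y.missed (required x.missed us)) 0))
        (us ++ us.map fun u => (Nat.land u.1 x.missed, u.2.tail))).map (x.mask :: ·) ++
      search (r + 1) e xs us := by
  have h1 : search (r + 1) e (x :: xs) us = Bool.rec []
      ((force (Nat.sub e (Nat.mul r x.size)) fun e' => force (required x.missed us) fun R =>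
        forceSpine (filt (fun y => Bool.rec false (Nat.ble y.size e')
          (Nat.beq (Nat.land y.missed R) 0)) (x :: xs)) fun cs' =>
        (search r (Nat.sub e x.size) cs'
          (us ++ us.map fun u => (Nat.land u.1 x.missed, u.2.tail))).map (x.mask :: ·)) ++
        search (r + 1) e xs us)
      (Nat.ble (Nat.mul (Nat.succ r) x.size) e) := rfl
  have h2 : Nat.ble (Nat.mul (Nat.succ r) x.size) e = true := Nat.ble_eq ▸ h
  rw [h1, h2, force_eq, force_eq, forceSpine_eq, filt_eq]
  rfl

/-- The cone `x` describes the set `A`. -/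
structure Cone.Describes (sets : List ℕ) (x : Cone) (A : Finset ℕ) : Prop where
  codes : Codes x.mask A
  size : x.size = A.card
  missed : x.missed = missedBits x.mask sets

theorem exists_of_mem_descending {g : List ℕ} {n k j s : ℕ} {I : List (List ℕ)}
    (hI : ListsIndep g n I) (h : s ∈ (descending k I).getD j []) :
    ∃ B ⊆ Finset.range n, Codes s B ∧ RowIndep g B ∧ B.card + j = k := by
  have hj : j < k := by
    by_contra hj
    rw [List.getD_eq_default _ _ (by simpa [descending] using hj)] at h
    simp at h
  have e : (descending k I).getD j [] = I.getD (k - j) [] := by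
    simp [descending, List.getD_eq_getElem?_getD, hj]
  rw [e] at h
  obtain ⟨B, h1, h2, h3, h4⟩ := hI.sound _ _ h
  exact ⟨B, h1, h2, h4, by omega⟩

/-- The search finds every admissible family of cones. Here `D` are the vertices whose cones are still
to be chosen, and `W` those whose cones have been chosen. Two cones `A u` and `A u'` missing a set `B`
that is also missed by the cones of `W' ⊆ W` yield an independent set of size `W'.card + 2 + B.card`. -/
theorem search_complete {ι : Type*} [DecidableEq ι] {g : List ℕ} {n k : ℕ} {I : List (List ℕ)}
    (hI : ListsIndep g n I) (A : ι → Finset ℕ) (r : ℕ) :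
    ∀ (e : ℕ) (cs : List Cone) (us : List (ℕ × List ℕ)) (D W : Finset ι),
      D.card = r → Disjoint W D → ∑ u ∈ D, (A u).card ≤ e →
      (cs.Pairwise fun x y => x.size ≤ y.size) →
      (∀ u ∈ D, ∃ x ∈ cs, x.Describes (descending k I).flatten (A u)) →
      (∀ p ∈ us, ∃ W' ⊆ W, p.2 = (blocks 0 (descending k I)).drop W'.card ∧
        ∀ t, p.1.testBit t = true → ∀ s, (descending k I).flatten[t]? = some s →
          ∀ B, Codes s B → ∀ w ∈ W', Disjoint B (A w)) →
      (∀ W' ⊆ W ∪ D, ∀ B ⊆ Finset.range n, RowIndep g B → (∀ w ∈ W', Disjoint B (A w)) →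
        W'.card + B.card ≤ k + 1) →
      ∃ L : List ι, L.Nodup ∧ L.toFinset = D ∧ ∃ f ∈ search r e cs us,
        List.Forall₂ (fun u c => Codes c (A u)) L f := by
  induction r with
  | zero =>
    intro e cs us D W hD _ _ _ _ _ _
    obtain rfl := Finset.card_eq_zero.1 hD
    exact ⟨[], List.nodup_nil, rfl, [], List.mem_singleton.2 rfl, List.Forall₂.nil⟩
  | succ r ihr =>
    intro e cs us D W hD hWD hsum hsort hcs hus hhit
    induction cs with
    | nil =>
      obtain ⟨u, hu⟩ := Finset.card_pos.1 (show 0 < D.card by omega)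
      obtain ⟨x, hx, -⟩ := hcs u hu
      simp at hx
    | cons x xs ih =>
      rw [List.pairwise_cons] at hsort
      have hsize : ∀ u ∈ D, x.size ≤ (A u).card := by
        intro u hu
        obtain ⟨y, hy, hd⟩ := hcs u hu
        rcases List.mem_cons.1 hy with rfl | hy
        · exact hd.size.le
        · exact (hsort.1 y hy).trans hd.size.le
      have hx : (r + 1) * x.size ≤ e := by
        refine le_trans ?_ hsum
        rw [← hD, ← smul_eq_mul]
        exact Finset.card_nsmul_le_sum _ _ _ hsize
      rw [search_cons _ _ _ _ _ hx]
      by_cases hm : ∃ u ∈ D, x.Describes (descending k I).flatten (A u)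
      · obtain ⟨u, hu, hxu⟩ := hm
        have hcard : (D.erase u).card = r := by rw [Finset.card_erase_of_mem hu]; omega
        have hsum' := Finset.add_sum_erase D (fun u => (A u).card) hu
        have huW : u ∉ W := fun h => Finset.disjoint_left.1 hWD h hu
        obtain ⟨L, hL, hLD, f, hf, hLf⟩ := ihr (e - x.size) ((x :: xs).filter fun y =>
            Bool.rec false (Nat.ble y.size (e - r * x.size))
              (Nat.beq (Nat.land y.missed (required x.missed us)) 0))
            (us ++ us.map fun u => (Nat.land u.1 x.missed, u.2.tail))
            (D.erase u) (insert u W) hcard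
          (by
            rw [Finset.disjoint_insert_left]
            exact ⟨Finset.notMem_erase u D, hWD.mono_right (Finset.erase_subset u D)⟩)
          (by
            have := hxu.size
            omega)
          ((List.pairwise_cons.2 hsort).filter _)
          (by
            intro v hv
            have hvD := Finset.mem_of_mem_erase hv
            obtain ⟨y, hy, hd⟩ := hcs v hvD
            refine ⟨y, List.mem_filter.2 ⟨hy, ?_⟩, hd⟩
            have h1 : Nat.beq (Nat.land y.missed (required x.missed us)) 0 = true := by
              rw [land_eq_zero_iff]
              intro t ht
              by_contra hR
              rw [Bool.not_eq_false] at hR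
              obtain ⟨p, hp, hp1, hxt, hp2⟩ := testBit_required hR
              obtain ⟨W', hW', hpW, hW'B⟩ := hus p hp
              rw [hpW] at hp2
              have hp3 : ((blocks 0 (descending k I)).getD W'.card 0).testBit t = true := by
                rw [List.getD_eq_getElem?_getD, ← Nat.add_zero W'.card, ← List.getElem?_drop,
                  ← List.head?_eq_getElem?, ← List.headD_eq_head?_getD]
                exact hp2
              obtain ⟨-, s, hs, hst⟩ := testBit_blocks hp3
              rw [Nat.sub_zero] at hst
              obtain ⟨B, hB1, hB2, hB3, hB4⟩ := exists_of_mem_descending hI hs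
              rw [hd.missed, testBit_missedBits] at ht
              rw [hxu.missed, testBit_missedBits] at hxt
              obtain ⟨s', hs', hty⟩ := ht
              obtain ⟨s'', hs'', htx⟩ := hxt
              obtain rfl : s' = s := by rw [hst] at hs'; exact (Option.some.inj hs').symm
              obtain rfl : s'' = s' := by rw [hst] at hs''; exact (Option.some.inj hs'').symm
              rw [hB2.land_eq_zero_iff hd.codes] at hty
              rw [hB2.land_eq_zero_iff hxu.codes] at htx
              have hvu := Finset.ne_of_mem_erase hv
              have h2 := hhit (insert v (insert u W')) (by
                intro w hw
                simp only [Finset.mem_insert] at hw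
                rcases hw with rfl | rfl | hw
                · exact Finset.mem_union_right _ hvD
                · exact Finset.mem_union_right _ hu
                · exact Finset.mem_union_left _ (hW' hw)) B hB1 hB3 (by
                intro w hw
                simp only [Finset.mem_insert] at hw
                rcases hw with rfl | rfl | hw
                · exact hty
                · exact htx
                · exact hW'B t hp1 _ hst B hB2 w hw)
              rw [Finset.card_insert_of_notMem, Finset.card_insert_of_notMem] at h2
              · omega
              · exact fun h => huW (hW' h)
              · rw [Finset.mem_insert, not_or]
                exact ⟨hvu, fun h => Finset.disjoint_left.1 hWD (hW' h) hvD⟩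
            have h2 : Nat.ble y.size (e - r * x.size) = true := by
              rw [Nat.ble_eq, hd.size]
              have h3 := Finset.add_sum_erase (D.erase u) (fun u => (A u).card) hv
              have h4 := Finset.card_nsmul_le_sum ((D.erase u).erase v) (fun u => (A u).card)
                x.size fun w hw => hsize w (Finset.mem_of_mem_erase (Finset.mem_of_mem_erase hw))
              rw [Finset.card_erase_of_mem hv, hcard, smul_eq_mul] at h4
              have h5 := hsize u hu
              have h6 : 0 < r := by rw [← hcard]; exact Finset.card_pos.2 ⟨v, hv⟩
              obtain ⟨q, rfl⟩ : ∃ q, r = q + 1 := ⟨r - 1, by omega⟩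
              simp only [Nat.add_sub_cancel] at h4
              have h7 : (q + 1) * x.size = q * x.size + x.size := by ring
              omega
            simp only [h1, h2])
          (by
            intro p hp
            rcases List.mem_append.1 hp with hp | hp
            · obtain ⟨W', h1, h2⟩ := hus p hp
              exact ⟨W', h1.trans (Finset.subset_insert u W), h2⟩
            · obtain ⟨q, hq, rfl⟩ := List.mem_map.1 hp
              obtain ⟨W', h1, h2, h3⟩ := hus q hq
              refine ⟨insert u W', Finset.insert_subset_insert u h1, ?_, ?_⟩
              · rw [Finset.card_insert_of_notMem fun h => huW (h1 h), h2, List.tail_drop]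
              · intro t ht s hs B hB w hw
                have ht' : (q.1 &&& x.missed).testBit t = true := ht
                rw [Nat.testBit_and, Bool.and_eq_true, hxu.missed, testBit_missedBits] at ht'
                rcases Finset.mem_insert.1 hw with rfl | hw
                · obtain ⟨s', hs', h4⟩ := ht'.2
                  obtain rfl : s = s' := by rw [hs] at hs'; exact Option.some.inj hs'
                  exact (hB.land_eq_zero_iff hxu.codes).1 h4
                · exact h3 t ht'.1 s hs B hB w hw)
          (by
            intro W' hW'
            refine hhit W' (hW'.trans ?_)
            intro w hw
            simp only [Finset.mem_union, Finset.mem_insert, Finset.mem_erase] at hw ⊢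
            rcases hw with (rfl | hw) | hw
            · exact Or.inr hu
            · exact Or.inl hw
            · exact Or.inr hw.2)
        refine ⟨u :: L, ?_, ?_, x.mask :: f, ?_, List.Forall₂.cons hxu.codes hLf⟩
        · refine List.nodup_cons.2 ⟨fun h => ?_, hL⟩
          rw [← List.mem_toFinset, hLD] at h
          exact Finset.notMem_erase u D h
        · rw [List.toFinset_cons, hLD, Finset.insert_erase hu]
        · exact List.mem_append_left _ (List.mem_map_of_mem hf)
      · obtain ⟨L, h1, h2, f, hf, h3⟩ := ih hsort.2 (by
          intro u hu
          obtain ⟨y, hy, hd⟩ := hcs u hu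
          rcases List.mem_cons.1 hy with rfl | hy
          · exact absurd ⟨u, hu, hd⟩ hm
          · exact ⟨y, hy, hd⟩)
        exact ⟨L, h1, h2, f, List.mem_append_right _ hf, h3⟩

theorem extensions_complete {ι : Type*} [DecidableEq ι] {g : List ℕ} {k d e : ℕ}
    (A : ι → Finset ℕ) (D : Finset ι) (hA : ∀ u ∈ D, A u ⊆ Finset.range g.length)
    (hA' : ∀ u ∈ D, RowIndep g (A u)) (hD : D.card = d) (he : ∑ u ∈ D, (A u).card ≤ e)
    (hhit : ∀ W ⊆ D, ∀ B ⊆ Finset.range g.length, RowIndep g B →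
      (∀ w ∈ W, Disjoint B (A w)) → W.card + B.card ≤ k + 1) :
    ∃ L : List ι, L.Nodup ∧ L.toFinset = D ∧ ∃ f ∈ extensions g k d e,
      List.Forall₂ (fun u c => Codes c (A u)) L f := by
  rw [extensions, forceLists_eq, forceList_eq, forceList_eq, forceCones_eq, filt_eq]
  refine search_complete (k := k) (listsIndep_layers g) A d e _ _ D ∅ hD (Finset.disjoint_empty_left D) he
    ((pairwise_cones _ _ _).filter _) ?_ ?_ ?_
  · intro u hu
    obtain ⟨c, hc, h⟩ := (listsIndep_layers g).complete (A u) (hA u hu) (hA' u hu)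
    refine ⟨_, List.mem_filter.2 ⟨mem_cones hc, ?_⟩, h, by simp, rfl⟩
    rw [Nat.ble_eq, zero_add]
    exact (Finset.single_le_sum (f := fun u => (A u).card) (fun _ _ => Nat.zero_le _) hu).trans he
  · intro p hp
    obtain rfl := List.mem_singleton.1 hp
    exact ⟨∅, Finset.Subset.refl _, by simp, fun _ _ _ _ _ _ w hw => by simp at hw⟩
  · intro W hW
    exact hhit W (by simpa using hW)

/-! ### Edges of triangle-free graphs -/

section

open Classical

variable {V : Type*}

/-- The neighbours of `v` in `S`. -/
noncomputable def nb (H : SimpleGraph V) (S : Finset V) (v : V) : Finset V :=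
  S.filter fun x => H.Adj v x

/-- The vertices of `S` that are neither equal nor adjacent to `v`. -/
noncomputable def far (H : SimpleGraph V) (S : Finset V) (v : V) : Finset V :=
  S.filter fun x => x ≠ v ∧ ¬ H.Adj v x

/-- The degree of `v` in `S`. -/
noncomputable def deg (H : SimpleGraph V) (S : Finset V) (v : V) : ℕ := (nb H S v).card

/-- The number of edges of `H` inside `S`, as half the degree sum. -/
noncomputable def edges (H : SimpleGraph V) (S : Finset V) : ℕ := (∑ v ∈ S, deg H S v) / 2

/-- No two vertices of `S` are adjacent. -/
def Indep (H : SimpleGraph V) (S : Finset V) : Prop := ∀ x ∈ S, ∀ y ∈ S, ¬ H.Adj x y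

/-- Independent sets inside `S` have at most `a` vertices. -/
def IndepLE (H : SimpleGraph V) (a : ℕ) (S : Finset V) : Prop :=
  ∀ T ⊆ S, Indep H T → T.card ≤ a

/-- `H` has no triangles. -/
def TriangleFree (H : SimpleGraph V) : Prop := ∀ x y z, H.Adj x y → H.Adj y z → ¬ H.Adj x z

variable {H : SimpleGraph V} {S T : Finset V} {u v w x : V} {a : ℕ}

theorem mem_nb : x ∈ nb H S v ↔ x ∈ S ∧ H.Adj v x := by simp [nb]

theorem mem_far : x ∈ far H S v ↔ x ∈ S ∧ x ≠ v ∧ ¬ H.Adj v x := by simp [far]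

theorem nb_subset : nb H S v ⊆ S := Finset.filter_subset _ _

theorem far_subset : far H S v ⊆ S := Finset.filter_subset _ _

theorem IndepLE.mono (h : IndepLE H a S) (hT : T ⊆ S) : IndepLE H a T :=
  fun U hU => h U (hU.trans hT)

theorem Indep.mono (h : Indep H S) (hT : T ⊆ S) : Indep H T :=
  fun x hx y hy => h x (hT hx) y (hT hy)

theorem Indep.insert_of (h : Indep H S) (hv : ∀ x ∈ S, ¬ H.Adj v x) : Indep H (insert v S) := by
  intro x hx y hy
  rcases Finset.mem_insert.1 hx with rfl | hx' <;> rcases Finset.mem_insert.1 hy with rfl | hy'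
  · exact H.irrefl
  · exact hv y hy'
  · exact fun h => hv x hx' h.symm
  · exact h x hx' y hy'

theorem TriangleFree.indep_nb (ht : TriangleFree H) : Indep H (nb H S v) := by
  intro x hx y hy h
  exact ht v x y (mem_nb.1 hx).2 h (mem_nb.1 hy).2

theorem IndepLE.far (h : IndepLE H (a + 1) S) (hv : v ∈ S) : IndepLE H a (far H S v) := by
  intro T hT hI
  have hvT : v ∉ T := fun h => (mem_far.1 (hT h)).2.1 rfl
  have := h (insert v T) (by
    intro x hx
    rcases Finset.mem_insert.1 hx with rfl | hx
    · exact hv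
    · exact far_subset (hT hx)) (hI.insert_of fun x hx => (mem_far.1 (hT hx)).2.2)
  rw [Finset.card_insert_of_notMem hvT] at this
  omega

theorem IndepLE.deg_le (h : IndepLE H a S) (ht : TriangleFree H) : deg H S v ≤ a :=
  h _ nb_subset ht.indep_nb

theorem disjoint_nb_far : Disjoint (nb H S v) (far H S v) :=
  Finset.disjoint_left.2 fun _ hx hy => (mem_far.1 hy).2.2 (mem_nb.1 hx).2

theorem insert_nb_far (hv : v ∈ S) : insert v (nb H S v ∪ far H S v) = S := by
  ext x
  simp only [Finset.mem_insert, Finset.mem_union, mem_nb, mem_far]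
  by_cases hx : x = v
  · simp [hx, hv]
  · tauto

theorem card_far (hv : v ∈ S) : (far H S v).card + deg H S v + 1 = S.card := by
  conv_rhs => rw [← insert_nb_far (H := H) hv]
  rw [Finset.card_insert_of_notMem, Finset.card_union_of_disjoint disjoint_nb_far]
  · simp only [deg]; ring
  · simp [mem_nb, mem_far]

theorem nb_insert : nb H (insert v S) u = if H.Adj u v then insert v (nb H S u) else nb H S u := by
  rw [nb, nb, Finset.filter_insert]

theorem deg_insert (hv : v ∉ S) :
    deg H (insert v S) u = deg H S u + if H.Adj u v then 1 else 0 := by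
  rw [deg, deg, nb_insert]
  split_ifs
  · exact Finset.card_insert_of_notMem fun h => hv (nb_subset h)
  · rfl

theorem sum_deg_insert (hv : v ∉ S) :
    ∑ u ∈ insert v S, deg H (insert v S) u = ∑ u ∈ S, deg H S u + 2 * deg H S v := by
  rw [Finset.sum_insert hv]
  simp only [deg_insert hv, Finset.sum_add_distrib, H.irrefl, if_false, add_zero]
  have : ∑ u ∈ S, (if H.Adj u v then 1 else 0) = deg H S v := by
    rw [← Finset.card_filter, deg, nb]
    simp only [H.adj_comm]
  rw [this]
  ring

theorem two_mul_edges (H : SimpleGraph V) (S : Finset V) : 2 * edges H S = ∑ v ∈ S, deg H S v := by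
  have : 2 ∣ ∑ v ∈ S, deg H S v := by
    induction S using Finset.induction_on with
    | empty => simp
    | insert v S hv ih =>
      rw [sum_deg_insert hv]
      exact dvd_add ih (dvd_mul_right _ _)
  exact Nat.mul_div_cancel' this

theorem edges_insert (hv : v ∉ S) : edges H (insert v S) = edges H S + deg H S v := by
  have h1 := two_mul_edges H (insert v S)
  have h2 := two_mul_edges H S
  rw [sum_deg_insert hv] at h1
  omega

theorem edges_union_indep (hST : Disjoint S T) (hT : Indep H T) :
    edges H (S ∪ T) = edges H S + ∑ u ∈ T, deg H S u := by
  induction T using Finset.induction_on with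
  | empty => simp
  | insert v T hv ih =>
    rw [Finset.disjoint_insert_right] at hST
    rw [Finset.union_insert, edges_insert (by simp [hST.1, hv]), Finset.sum_insert hv,
      ih hST.2 (hT.mono (Finset.subset_insert v T))]
    have : deg H (S ∪ T) v = deg H S v := by
      rw [deg, deg, nb, nb, Finset.filter_union,
        Finset.filter_false_of_mem (s := T), Finset.union_empty]
      exact fun x hx => hT v (Finset.mem_insert_self v T) x (Finset.mem_insert_of_mem hx)
    rw [this]
    ring

theorem deg_eq_far (ht : TriangleFree H) (hv : v ∈ S) (hu : u ∈ nb H S v) :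
    deg H S u = deg H (far H S v) u + 1 := by
  have : nb H S u = insert v (nb H (far H S v) u) := by
    ext x
    simp only [mem_nb, Finset.mem_insert, mem_far]
    constructor
    · rintro ⟨hx, hux⟩
      by_cases hxv : x = v
      · exact Or.inl hxv
      · exact Or.inr ⟨⟨hx, hxv, fun h => ht v u x (mem_nb.1 hu).2 hux h⟩, hux⟩
    · rintro (rfl | ⟨⟨hx, -, -⟩, hux⟩)
      · exact ⟨hv, (mem_nb.1 hu).2.symm⟩
      · exact ⟨hx, hux⟩
  rw [deg, this, Finset.card_insert_of_notMem, deg]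
  simp [mem_nb, mem_far]

/-- As the neighbours of `v` are pairwise non-adjacent, every edge either lies in `far H S v` or has
exactly one end among them. -/
theorem edges_eq_far (ht : TriangleFree H) (hv : v ∈ S) :
    edges H S = edges H (far H S v) + ∑ u ∈ nb H S v, deg H S u := by
  have h1 : edges H S = edges H (insert v (far H S v ∪ nb H S v)) := by
    rw [Finset.union_comm, insert_nb_far hv]
  rw [h1, edges_insert (by simp [mem_nb, mem_far]),
    edges_union_indep disjoint_nb_far.symm ht.indep_nb, Finset.sum_congr rfl fun u hu =>
      deg_eq_far ht hv hu, Finset.sum_add_distrib, Finset.sum_const, smul_eq_mul, mul_one, add_assoc]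
  congr 2
  rw [deg]
  congr 1
  ext x
  simp only [mem_nb, Finset.mem_union, mem_far]
  tauto

theorem edges_eq_far' (ht : TriangleFree H) (hv : v ∈ S) :
    edges H S = edges H (far H S v) + (deg H S v + ∑ u ∈ nb H S v, deg H (far H S v) u) := by
  rw [edges_eq_far ht hv, Finset.sum_congr rfl fun u hu => deg_eq_far ht hv hu,
    Finset.sum_add_distrib, Finset.sum_const, smul_eq_mul, mul_one, deg]
  ring

theorem sum_nb_comm (f : V → ℕ) :
    ∑ v ∈ S, ∑ u ∈ nb H S v, f u = ∑ u ∈ S, deg H S u * f u := by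
  simp only [nb, deg, Finset.card_filter, Finset.sum_filter]
  rw [Finset.sum_comm]
  refine Finset.sum_congr rfl fun u _ => ?_
  rw [Finset.sum_mul]
  refine Finset.sum_congr rfl fun v _ => ?_
  rw [H.adj_comm]
  split_ifs <;> simp

theorem sum_sq_add_far (ht : TriangleFree H) :
    ∑ v ∈ S, (deg H S v ^ 2 + edges H (far H S v)) = S.card * edges H S := by
  have : ∑ v ∈ S, edges H S = S.card * edges H S := by simp
  rw [← this, Finset.sum_congr rfl fun v hv => edges_eq_far ht hv, Finset.sum_add_distrib,
    Finset.sum_add_distrib, sum_nb_comm, add_comm]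
  simp only [sq]

/-- If `d² + f` lies above a line in `d`, where `d` is the degree of `v` and `f` the number of
edges not meeting the closed neighbourhood of `v`, the sum over all `v` bounds the number of
edges. -/
theorem edges_of_line (ht : TriangleFree H) {A B : ℤ}
    (h : ∀ v ∈ S, A * deg H S v + B ≤ (deg H S v : ℤ) ^ 2 + edges H (far H S v)) :
    S.card * B ≤ (S.card - 2 * A) * (edges H S : ℤ) := by
  have h1 := Finset.sum_le_sum h
  have h2 : ∑ v ∈ S, ((deg H S v : ℤ) ^ 2 + edges H (far H S v)) = S.card * edges H S := by
    exact_mod_cast sum_sq_add_far (S := S) ht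
  have h3 : (2 : ℤ) * edges H S = ∑ v ∈ S, (deg H S v : ℤ) := by
    exact_mod_cast two_mul_edges H S
  rw [h2, Finset.sum_add_distrib, ← Finset.mul_sum, ← h3, Finset.sum_const, nsmul_eq_mul] at h1
  linarith

end

/-! ### Graphs given by rows -/

section

open Classical

variable {V : Type*} {H : SimpleGraph V} {S : Finset V} {v : V} {φ : ℕ → V} {g h : List ℕ}

/-- The labelling `φ` of the vertices of `S` identifies the graph induced by `H` on `S` with the graph
with rows `g`. -/
structure Rep (H : SimpleGraph V) (φ : ℕ → V) (g : List ℕ) (S : Finset V) : Prop where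
  inj : ∀ i < g.length, ∀ j < g.length, φ i = φ j → i = j
  image : (Finset.range g.length).image φ = S
  testBit : ∀ j < g.length, ∀ i,
    (g.getD j 0).testBit i = true ↔ i < j ∧ H.Adj (φ i) (φ j)

theorem Rep.card (hg : Rep H φ g S) : S.card = g.length := by
  rw [← hg.image, Finset.card_image_of_injOn, Finset.card_range]
  intro i hi j hj
  exact hg.inj i (by simpa using hi) j (by simpa using hj)

theorem Rep.mem (hg : Rep H φ g S) {i : ℕ} (hi : i < g.length) : φ i ∈ S := by
  rw [← hg.image]
  exact Finset.mem_image_of_mem φ (Finset.mem_range.2 hi)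

theorem Rep.sum (hg : Rep H φ g S) {M : Type*} [AddCommMonoid M] (f : V → M) :
    ∑ v ∈ S, f v = ∑ i ∈ Finset.range g.length, f (φ i) := by
  rw [← hg.image, Finset.sum_image]
  intro i hi j hj
  exact hg.inj i (by simpa using hi) j (by simpa using hj)

theorem Rep.rowIndep (hg : Rep H φ g S) {A : Finset ℕ} (hA : A ⊆ Finset.range g.length)
    (hI : ∀ i ∈ A, ∀ j ∈ A, ¬ H.Adj (φ i) (φ j)) : RowIndep g A := by
  intro j hj i hi _
  rw [Bool.eq_false_iff, ne_eq, hg.testBit j (Finset.mem_range.1 (hA hj))]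
  exact fun h => hI i hi j hj h.2

theorem Rep.indep (hg : Rep H φ g S) {A : Finset ℕ} (hA : A ⊆ Finset.range g.length)
    (hI : RowIndep g A) : ∀ i ∈ A, ∀ j ∈ A, ¬ H.Adj (φ i) (φ j) := by
  have key : ∀ i ∈ A, ∀ j ∈ A, i < j → ¬ H.Adj (φ i) (φ j) := by
    intro i hi j hj hij h
    have := hI j hj i hi hij
    rw [(hg.testBit j (Finset.mem_range.1 (hA hj)) i).2 ⟨hij, h⟩] at this
    simp at this
  intro i hi j hj h
  rcases lt_trichotomy i j with hij | rfl | hij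
  · exact key i hi j hj hij h
  · exact H.irrefl h
  · exact key j hj i hi hij h.symm

/-- The indices of the neighbours of `u`. -/
noncomputable def trace (H : SimpleGraph V) (φ : ℕ → V) (n : ℕ) (u : V) : Finset ℕ :=
  (Finset.range n).filter fun i => H.Adj u (φ i)

theorem Rep.card_trace (hg : Rep H φ g S) (u : V) : (trace H φ g.length u).card = deg H S u := by
  rw [trace, deg, nb, Finset.card_filter, Finset.card_filter, hg.sum]

theorem card_filter_trace {T : Finset V} {n i : ℕ} (hi : i < n) :
    (T.filter fun u => i ∈ trace H φ n u).card = deg H T (φ i) := by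
  rw [deg, nb]
  congr 1
  ext u
  simp [trace, hi, H.adj_comm]

theorem bitCount_eq (n x : ℕ) :
    bitCount n x = ∑ i ∈ Finset.range n, if x.testBit i = true then 1 else 0 := by
  induction n generalizing x with
  | zero => simp [bitCount]
  | succ n ih =>
    rw [Finset.sum_range_succ', bitCount, ih]
    change x % 2 + _ = _
    rw [add_comm]
    congr 1
    · simp only [Nat.testBit_succ]
      rfl
    · rcases Nat.mod_two_eq_zero_or_one x with h | h <;> simp [Nat.testBit_zero, h]

theorem sum_map_eq_sum_range (l : List ℕ) (f : ℕ → ℕ) :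
    (l.map f).sum = ∑ j ∈ Finset.range l.length, f (l.getD j 0) := by
  induction l with
  | nil => simp
  | cons x l ih =>
    rw [List.length_cons, Finset.sum_range_succ', List.map_cons, List.sum_cons, ih, add_comm]
    simp

theorem Rep.edgeCount_le (hg : Rep H φ g S) : edgeCount g ≤ edges H S := by
  have h1 : edgeCount g = ∑ j ∈ Finset.range g.length, bitCount 16 (g.getD j 0) :=
    sum_map_eq_sum_range g _
  have h2 : ∀ j ∈ Finset.range g.length, bitCount 16 (g.getD j 0) ≤
      ∑ i ∈ Finset.range j, if H.Adj (φ i) (φ j) then 1 else 0 := by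
    intro j hj
    rw [bitCount_eq, ← Finset.card_filter, ← Finset.card_filter]
    refine Finset.card_le_card fun i hi => ?_
    have := (hg.testBit j (Finset.mem_range.1 hj) i).1 (Finset.mem_filter.1 hi).2
    exact Finset.mem_filter.2 ⟨Finset.mem_range.2 this.1, this.2⟩
  have h3 : ∀ n, ∑ j ∈ Finset.range n, ∑ i ∈ Finset.range n, (if H.Adj (φ i) (φ j) then 1 else 0) =
      2 * ∑ j ∈ Finset.range n, ∑ i ∈ Finset.range j, if H.Adj (φ i) (φ j) then 1 else 0 := by
    intro n
    induction n with
    | zero => simp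
    | succ n ih =>
      have : ∑ i ∈ Finset.range n, (if H.Adj (φ n) (φ i) then 1 else 0) =
          ∑ i ∈ Finset.range n, if H.Adj (φ i) (φ n) then 1 else 0 := by
        simp only [H.adj_comm]
      simp only [Finset.sum_range_succ, Finset.sum_add_distrib, ih, H.irrefl, if_false, this]
      ring
  have h4 := two_mul_edges H S
  have h5 : ∑ v ∈ S, deg H S v = ∑ j ∈ Finset.range g.length, ∑ i ∈ Finset.range g.length,
      if H.Adj (φ i) (φ j) then 1 else 0 := by
    rw [hg.sum]
    refine Finset.sum_congr rfl fun j _ => ?_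
    rw [deg, nb, Finset.card_filter, hg.sum]
    simp only [H.adj_comm]
  rw [h5, h3] at h4
  have := Finset.sum_le_sum h2
  omega

/-- The labelling of `S` numbers the far vertices first, then the neighbours of `v` in the order of
`L`, and `v` last. -/
theorem Rep.extend (ht : TriangleFree H) (hv : v ∈ S) (hg : Rep H φ g (far H S v)) {L : List V}
    {f : List ℕ} (hL : L.Nodup) (hLn : L.toFinset = nb H S v)
    (hf : List.Forall₂ (fun u c => Codes c (trace H φ g.length u)) L f) :
    ∃ φ', Rep H φ' (extend g f) S := by
  have hlen : L.length = f.length := hf.length_eq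
  have hLm : ∀ u, u ∈ L ↔ u ∈ nb H S v := fun u => by rw [← hLn, List.mem_toFinset]
  set ψ : ℕ → V := fun i => if i < g.length then φ i else L.getD (i - g.length) v with hψ
  have ψ1 : ∀ i < g.length, ψ i = φ i := fun i hi => by simp [hψ, hi]
  have ψ2 : ∀ i (hi : i < L.length), ψ (g.length + i) = L[i] := fun i hi => by
    simp [hψ, List.getD_eq_getElem?_getD, hi]
  have ψ3 : ψ (g.length + L.length) = v := by simp [hψ, List.getD_eq_getElem?_getD]
  have hextlen : (Folkman.extend g f).length = g.length + L.length + 1 := by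
    simp [Folkman.extend, hlen, add_assoc]
  have hcard : S.card = g.length + L.length + 1 := by
    rw [← card_far (H := H) hv, hg.card, deg, ← hLn, List.toFinset_card_of_nodup hL]
  have himage : (Finset.range (g.length + L.length + 1)).image ψ = S := by
    symm
    refine Finset.eq_of_subset_of_card_le ?_ (Finset.card_image_le.trans (by simp [hcard]))
    intro x hx
    rw [← insert_nb_far (H := H) hv] at hx
    rw [Finset.mem_image]
    simp only [Finset.mem_insert, Finset.mem_union] at hx
    rcases hx with rfl | hx | hx
    · exact ⟨_, by simp, ψ3⟩
    · obtain ⟨i, hi, rfl⟩ := List.mem_iff_getElem.1 ((hLm x).2 hx)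
      exact ⟨g.length + i, Finset.mem_range.2 (by omega), ψ2 i hi⟩
    · rw [← hg.image, Finset.mem_image] at hx
      obtain ⟨i, hi, rfl⟩ := hx
      rw [Finset.mem_range] at hi
      exact ⟨i, Finset.mem_range.2 (by omega), ψ1 i hi⟩
  have hinj : Set.InjOn ψ (Finset.range (g.length + L.length + 1)) :=
    Finset.injOn_of_card_image_eq (by rw [himage, hcard, Finset.card_range])
  refine ⟨ψ, ?_, by rw [hextlen, himage], ?_⟩
  · rw [hextlen]
    exact fun i hi j hj h => hinj (by simpa using hi) (by simpa using hj) h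
  · rw [hextlen]
    intro j hj i
    rcases lt_trichotomy j (g.length + L.length) with hj' | rfl | hj'
    · rcases lt_or_ge j g.length with hj'' | hj''
      · have : (Folkman.extend g f).getD j 0 = g.getD j 0 := by
          rw [Folkman.extend, List.getD_append _ _ _ _ hj'']
        rw [this, hg.testBit j hj'']
        refine and_congr_right fun hi => ?_
        rw [ψ1 i (by omega), ψ1 j hj'']
      · obtain ⟨q, rfl⟩ := Nat.exists_eq_add_of_le hj''
        have hq : q < L.length := by omega
        have e : (Folkman.extend g f).getD (g.length + q) 0 = f[q]'(by omega) := by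
          rw [Folkman.extend, List.getD_append_right _ _ _ _ (by omega), Nat.add_sub_cancel_left,
            List.getD_append _ _ _ _ (by omega), List.getD_eq_getElem]
        have hc := hf.get hq (by omega)
        rw [e, ψ2 q hq]
        refine (hc i).trans ?_
        simp only [trace, Finset.mem_filter, Finset.mem_range, List.get_eq_getElem]
        constructor
        · rintro ⟨h1, h2⟩
          rw [ψ1 i h1]
          exact ⟨by omega, h2.symm⟩
        · rintro ⟨h1, h2⟩
          rcases lt_or_ge i g.length with hi | hi
          · rw [ψ1 i hi] at h2
            exact ⟨hi, h2.symm⟩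
          · obtain ⟨p, rfl⟩ := Nat.exists_eq_add_of_le hi
            rw [ψ2 p (by omega)] at h2
            exact absurd h2 (ht.indep_nb _ ((hLm _).1 (List.getElem_mem _)) _
              ((hLm _).1 (List.getElem_mem _)))
    · have e : (Folkman.extend g f).getD (g.length + L.length) 0 =
          2 ^ g.length * (2 ^ f.length - 1) := by
        rw [Folkman.extend, List.getD_append_right _ _ _ _ (by omega), Nat.add_sub_cancel_left,
            List.getD_append_right _ _ _ _ (by omega), hlen, Nat.sub_self]
        rfl
      rw [e, ψ3, Nat.testBit_two_pow_mul, Bool.and_eq_true, Nat.testBit_two_pow_sub_one]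
      simp only [decide_eq_true_eq]
      constructor
      · rintro ⟨h1, h2⟩
        obtain ⟨p, rfl⟩ := Nat.exists_eq_add_of_le h1
        refine ⟨by omega, ?_⟩
        rw [ψ2 p (by omega)]
        exact (mem_nb.1 ((hLm _).1 (List.getElem_mem _))).2.symm
      · rintro ⟨h1, h2⟩
        rcases lt_or_ge i g.length with hi | hi
        · rw [ψ1 i hi] at h2
          exact absurd h2.symm (mem_far.1 (hg.mem hi)).2.2
        · exact ⟨hi, by omega⟩
    · omega

/-- If the graph far from `v` is known, the graph on `S` is one of its extensions: a neighbour of `v`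
is determined by its neighbours far from `v`, since the neighbours of `v` are independent. -/
theorem Rep.exists_extend (ht : TriangleFree H) (hv : v ∈ S) (hg : Rep H φ g (far H S v))
    {k d E : ℕ} (hI : IndepLE H (k + 1) S) (hd : deg H S v = d) (hE : edges H S ≤ E) :
    ∃ f ∈ extensions g k d (E - edgeCount g - d), ∃ φ', Rep H φ' (Folkman.extend g f) S := by
  have hsub : ∀ u, trace H φ g.length u ⊆ Finset.range g.length := fun u =>
    Finset.filter_subset _ _
  obtain ⟨L, hL, hLn, f, hf, h⟩ := extensions_complete (e := E - edgeCount g - d) (k := k)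
    (trace H φ g.length) (nb H S v) (fun u _ => hsub u)
    (fun u _ => hg.rowIndep (hsub u) fun i hi j hj h =>
      ht u _ _ (Finset.mem_filter.1 hi).2 h (Finset.mem_filter.1 hj).2) hd
    (by
      have h1 := edges_eq_far' ht hv
      have h2 := hg.edgeCount_le
      simp only [hg.card_trace]
      omega)
    (by
      intro W hW B hB hBI hWB
      have hBI' := hg.indep hB hBI
      have hdisj : Disjoint W (B.image φ) := by
        rw [Finset.disjoint_left]
        intro x hx hx'
        obtain ⟨i, hi, rfl⟩ := Finset.mem_image.1 hx'
        exact Finset.disjoint_left.1 disjoint_nb_far (hW hx)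
          (hg.mem (Finset.mem_range.1 (hB hi)))
      have hBc : (B.image φ).card = B.card := Finset.card_image_of_injOn fun i hi j hj h =>
        hg.inj i (Finset.mem_range.1 (hB hi)) j (Finset.mem_range.1 (hB hj)) h
      have := hI (W ∪ B.image φ) (by
        intro x hx
        rcases Finset.mem_union.1 hx with hx | hx
        · exact nb_subset (hW hx)
        · obtain ⟨i, hi, rfl⟩ := Finset.mem_image.1 hx
          exact far_subset (hg.mem (Finset.mem_range.1 (hB hi)))) (by
        have key : ∀ x ∈ W, ∀ i ∈ B, ¬ H.Adj x (φ i) := fun x hx i hi h =>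
          Finset.disjoint_left.1 (hWB x hx) hi (Finset.mem_filter.2 ⟨hB hi, h⟩)
        intro x hx y hy
        rcases Finset.mem_union.1 hx with hx | hx <;> rcases Finset.mem_union.1 hy with hy | hy
        · exact ht.indep_nb x (hW hx) y (hW hy)
        · obtain ⟨i, hi, rfl⟩ := Finset.mem_image.1 hy
          exact key x hx i hi
        · obtain ⟨i, hi, rfl⟩ := Finset.mem_image.1 hx
          exact fun h => key y hy i hi h.symm
        · obtain ⟨i, hi, rfl⟩ := Finset.mem_image.1 hx
          obtain ⟨j, hj, rfl⟩ := Finset.mem_image.1 hy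
          exact hBI' i hi j hj)
      rw [Finset.card_union_of_disjoint hdisj, hBc] at this
      exact this)
  exact ⟨f, hf, hg.extend ht hv hL hLn h⟩

end

/-! ### Relabellings -/

section

open Classical

variable {V : Type*} {H : SimpleGraph V} {S : Finset V} {v : V} {φ : ℕ → V} {g g' : List ℕ}

theorem testBit_packRows_of_le (A : ℕ) (rs : List ℕ) (hrs : ∀ r ∈ rs, r < 2 ^ 16) (t : ℕ) :
    (packRows A rs).testBit (16 * rs.length + t) = A.testBit t := by
  induction rs generalizing A t with
  | nil => simp [packRows]
  | cons r rs ih =>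
    have e : (packRows A (r :: rs)) = packRows (2 ^ 16 * A + r) rs := by
      change packRows (A * 65536 + r) rs = _
      rw [mul_comm]
      rfl
    rw [e, List.length_cons, show 16 * (rs.length + 1) + t = 16 * rs.length + (16 + t) by ring,
      ih _ fun r hr => hrs r (List.mem_cons_of_mem _ hr),
      Nat.testBit_two_pow_mul_add _ (hrs r List.mem_cons_self), if_neg (by omega),
      Nat.add_sub_cancel_left]

theorem testBit_packRows (A : ℕ) (rs : List ℕ) (hrs : ∀ r ∈ rs, r < 2 ^ 16) {a b : ℕ}
    (ha : a < rs.length) (hb : b < 16) :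
    (packRows A rs).testBit (16 * (rs.length - 1 - a) + b) = (rs.getD a 0).testBit b := by
  induction rs generalizing A a with
  | nil => simp at ha
  | cons r rs ih =>
    have e : (packRows A (r :: rs)) = packRows (2 ^ 16 * A + r) rs := by
      change packRows (A * 65536 + r) rs = _
      rw [mul_comm]
      rfl
    rw [e, List.length_cons, Nat.add_sub_cancel]
    cases a with
    | zero =>
      rw [Nat.sub_zero, testBit_packRows_of_le _ _ fun r hr => hrs r (List.mem_cons_of_mem _ hr),
        Nat.testBit_two_pow_mul_add _ (hrs r List.mem_cons_self), if_pos hb]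
      rfl
    | succ a =>
      have := ih (2 ^ 16 * A + r) (fun r hr => hrs r (List.mem_cons_of_mem _ hr))
        (a := a) (by simpa using ha)
      rw [show rs.length - (a + 1) = rs.length - 1 - a by omega, this]
      rfl

theorem Rep.row_lt (hg : Rep H φ g S) (hn : g.length ≤ 16) : ∀ r ∈ g, r < 2 ^ 16 := by
  intro r hr
  obtain ⟨j, hj, rfl⟩ := List.mem_iff_getElem.1 hr
  refine Nat.lt_pow_two_of_testBit _ fun i hi => ?_
  rw [Bool.eq_false_iff]
  intro h
  have := (hg.testBit j hj i).1 (by rwa [List.getD_eq_getElem _ _ hj])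
  omega

theorem Rep.adjBit (hg : Rep H φ g S) (hn : g.length ≤ 16) {a b : ℕ} (ha : a < g.length)
    (hb : b < g.length) :
    adjBit (packRows 0 g) (Nat.sub g.length 1) a b = if H.Adj (φ a) (φ b) then 1 else 0 := by
  have h1 : Folkman.adjBit (packRows 0 g) (Nat.sub g.length 1) a b =
      ((packRows 0 g >>> (16 * (g.length - 1 - a) + b)) |||
        (packRows 0 g >>> (16 * (g.length - 1 - b) + a))) &&& 1 := rfl
  have h0 : ∀ x : ℕ, x % 2 = if x.testBit 0 = true then 1 else 0 := by
    intro x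
    rcases Nat.mod_two_eq_zero_or_one x with h | h <;> simp [Nat.testBit_zero, h]
  rw [h1, Nat.and_one_is_mod, h0, Nat.testBit_or, Nat.testBit_shiftRight,
    Nat.testBit_shiftRight, add_zero, add_zero, testBit_packRows _ _ (hg.row_lt hn) ha (by omega),
    testBit_packRows _ _ (hg.row_lt hn) hb (by omega)]
  have h2 : ((g.getD a 0).testBit b || (g.getD b 0).testBit a) = decide (H.Adj (φ a) (φ b)) := by
    rw [Bool.eq_iff_iff, Bool.or_eq_true, hg.testBit a ha, hg.testBit b hb, decide_eq_true_iff]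
    constructor
    · rintro (h | h)
      · exact h.2.symm
      · exact h.2
    · intro h
      rcases lt_trichotomy a b with hab | rfl | hab
      · exact Or.inr ⟨hab, h⟩
      · exact absurd h H.irrefl
      · exact Or.inl ⟨hab, h.symm⟩
  rw [h2]
  by_cases h : H.Adj (φ a) (φ b) <;> simp [h]

theorem testBit_rowOf (A m q : ℕ) (prev : List ℕ) (hA : ∀ p, adjBit A m p q < 2) (acc : ℕ) (t : ℕ) :
    (rowOf A m q prev acc).testBit t = true ↔
      (∃ p, prev.reverse[t]? = some p ∧ adjBit A m p q = 1) ∨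
        (prev.length ≤ t ∧ acc.testBit (t - prev.length) = true) := by
  induction prev generalizing acc with
  | nil => simp [rowOf]
  | cons p prev ih =>
    have e : rowOf A m q (p :: prev) acc = rowOf A m q prev (2 * acc + adjBit A m p q) := rfl
    have hp := hA p
    rw [e, ih, List.reverse_cons, List.length_cons]
    rcases lt_trichotomy t prev.length with ht | rfl | ht
    · rw [List.getElem?_append_left (by simpa using ht)]
      simp [show ¬ prev.length ≤ t by omega, show ¬ prev.length + 1 ≤ t by omega]
    · rw [List.getElem?_append_right (by simp)]
      have : (2 * acc + adjBit A m p q).testBit 0 = true ↔ adjBit A m p q = 1 := by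
        rw [Nat.testBit_zero, decide_eq_true_iff]
        omega
      rw [List.length_reverse, Nat.sub_self, this]
      simp
    · rw [List.getElem?_append_right (by simpa using ht.le), List.length_reverse]
      obtain ⟨s, rfl⟩ := Nat.exists_eq_add_of_lt ht
      have e1 : prev.length + s + 1 - prev.length = s + 1 := by omega
      have e2 : prev.length + s + 1 - (prev.length + 1) = s := by omega
      have e3 : (2 * acc + adjBit A m p q).testBit (s + 1) = acc.testBit s := by
        rw [Nat.testBit_succ, show (2 * acc + adjBit A m p q) / 2 = acc by omega]
      rw [e1, e2, e3]
      simp [show prev.length ≤ prev.length + s + 1 by omega]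

theorem adjBit_lt (A m p q : ℕ) : adjBit A m p q < 2 := by
  have : adjBit A m p q = _ &&& 1 := rfl
  rw [this, Nat.and_one_is_mod]
  exact Nat.mod_lt _ (by norm_num)

theorem checkRows_sound {A m : ℕ} {prev ps rs : List ℕ} (h : checkRows A m prev ps rs = true) :
    ps.length = rs.length ∧ ∀ j < rs.length, ∀ i, (rs.getD j 0).testBit i = true ↔
      i < prev.length + j ∧ ∃ p q, (prev.reverse ++ ps)[i]? = some p ∧ ps[j]? = some q ∧
        adjBit A m p q = 1 := by
  induction ps generalizing prev rs with
  | nil =>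
    cases rs with
    | nil => simp
    | cons r rs => simp [checkRows] at h
  | cons q ps ih =>
    cases rs with
    | nil => simp [checkRows] at h
    | cons r rs =>
      rw [checkRows, Bool.and_eq_true, beq_iff] at h
      obtain ⟨h1, h2⟩ := ih h.2
      refine ⟨by simp [h1], ?_⟩
      intro j hj i
      cases j with
      | zero =>
        rw [List.getD_cons_zero, ← h.1, testBit_rowOf _ _ _ _ (fun p => adjBit_lt A m p q)]
        simp only [Nat.zero_testBit, Bool.false_eq_true, and_false, or_false, add_zero,
          List.getElem?_cons_zero, Option.some.injEq]
        constructor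
        · rintro ⟨p, h1, h2⟩
          have hi := (List.getElem?_eq_some_iff.1 h1).1
          exact ⟨by simpa using hi, p, q, by rw [List.getElem?_append_left hi, h1], rfl, h2⟩
        · rintro ⟨hi, p, q', h1, rfl, h2⟩
          exact ⟨p, by rwa [List.getElem?_append_left (by simpa using hi)] at h1, h2⟩
      | succ j =>
        rw [List.getD_cons_succ, h2 j (by simpa using hj) i]
        simp only [List.length_cons, List.reverse_cons, List.append_assoc, List.singleton_append,
          List.getElem?_cons_succ]
        rw [show prev.length + 1 + j = prev.length + (j + 1) by ring]

theorem testBit_orPows (ps : List ℕ) (i : ℕ) : (orPows ps).testBit i = true ↔ i ∈ ps := by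
  induction ps with
  | nil => simp [orPows]
  | cons p ps ih =>
    have : orPows (p :: ps) = (1 <<< p) ||| orPows ps := rfl
    rw [this, Nat.testBit_or, Bool.or_eq_true, ih, Nat.shiftLeft_eq, one_mul, Nat.testBit_two_pow,
      decide_eq_true_iff, List.mem_cons, @eq_comm _ i]

theorem length_digits (n P : ℕ) : (digits n P).length = n := by
  induction n generalizing P with
  | zero => rfl
  | succ n ih => simp [digits, ih]

theorem Rep.relabel (hg : Rep H φ g S) (hn : g.length ≤ 16) {P : ℕ}
    (h : isRelabelling P g g' = true) : ∃ φ', Rep H φ' g' S := by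
  rw [isRelabelling, force_eq, forceList_eq, Bool.and_eq_true, beq_iff] at h
  set ps := digits g.length P with hps
  obtain ⟨h1, h2⟩ := h
  obtain ⟨h3, h4⟩ := checkRows_sound h2
  have hlen : ps.length = g.length := length_digits _ _
  have hmem : ∀ i, i ∈ ps ↔ i < g.length := by
    intro i
    rw [← testBit_orPows, h1]
    change (2 ^ g.length - 1).testBit i = true ↔ _
    simp
  have hlt : ∀ q, q < g.length → ps.getD q 0 < g.length := by
    intro q hq
    rw [← hmem, List.getD_eq_getElem _ _ (by omega)]
    exact List.getElem_mem _
  have himage : (Finset.range g'.length).image (fun q => φ (ps.getD q 0)) = S := by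
    rw [← hg.image, ← h3, hlen]
    ext x
    simp only [Finset.mem_image, Finset.mem_range]
    constructor
    · rintro ⟨q, hq, rfl⟩
      exact ⟨_, hlt q hq, rfl⟩
    · rintro ⟨i, hi, rfl⟩
      obtain ⟨q, hq, rfl⟩ := List.mem_iff_getElem.1 ((hmem i).2 hi)
      exact ⟨q, by omega, by rw [List.getD_eq_getElem _ _ hq]⟩
  have hinj : Set.InjOn (fun q => φ (ps.getD q 0)) (Finset.range g'.length) :=
    Finset.injOn_of_card_image_eq (by rw [himage, hg.card, Finset.card_range]; omega)
  refine ⟨fun q => φ (ps.getD q 0), ?_, himage, ?_⟩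
  · exact fun i hi j hj h => hinj (by simpa using hi) (by simpa using hj) h
  · intro j hj i
    rw [h4 j hj i]
    simp only [List.reverse_nil, List.nil_append, List.length_nil, zero_add]
    refine and_congr_right fun hij => ?_
    have hi' : i < ps.length := by omega
    have hj' : j < ps.length := by omega
    have := hg.adjBit hn (hlt i (by omega)) (hlt j (by omega))
    rw [List.getD_eq_getElem _ _ hi', List.getD_eq_getElem _ _ hj'] at this ⊢
    have key : Folkman.adjBit (packRows 0 g) (Nat.sub g.length 1) ps[i] ps[j] = 1 ↔
        H.Adj (φ ps[i]) (φ ps[j]) := by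
      rw [this]
      split_ifs with hadj <;> simp [hadj]
    rw [← key]
    constructor
    · rintro ⟨p, q, hp, hq, h⟩
      rw [List.getElem?_eq_getElem hi', Option.some.injEq] at hp
      rw [List.getElem?_eq_getElem hj', Option.some.injEq] at hq
      rwa [← hp, ← hq] at h
    · exact fun h => ⟨_, _, List.getElem?_eq_getElem hi', List.getElem?_eq_getElem hj', h⟩

theorem exists_of_all2 {α β : Type} {p : α → β → Bool} {as : List α} {bs : List β}
    (h : all2 p as bs = true) {a : α} (ha : a ∈ as) : ∃ b ∈ bs, p a b = true := by
  induction as generalizing bs with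
  | nil => simp at ha
  | cons x as ih =>
    cases bs with
    | nil => simp [all2] at h
    | cons b bs =>
      rw [all2, Bool.and_eq_true] at h
      rcases List.mem_cons.1 ha with rfl | ha
      · exact ⟨b, by simp, h.1⟩
      · obtain ⟨c, hc, hp⟩ := ih h.2 ha
        exact ⟨c, by simp [hc], hp⟩

/-- Soundness of `checkStage`: the graph on `S` is in the list `reps`. -/
theorem Rep.stage (ht : TriangleFree H) (hv : v ∈ S) (hg : Rep H φ g (far H S v)) {k d E : ℕ}
    (hI : IndepLE H (k + 1) S) (hd : deg H S v = d) (hE : edges H S ≤ E) (hS : S.card ≤ 16)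
    {reps : List (List ℕ)} {certs : List ℕ} (hc : checkStage k d E reps g certs = true) :
    ∃ h ∈ reps, ∃ φ', Rep H φ' h S := by
  obtain ⟨f, hf, φ', hf'⟩ := hg.exists_extend ht hv hI hd hE
  rw [checkStage, forceLists_eq] at hc
  obtain ⟨c, -, hc⟩ := exists_of_all2 hc hf
  obtain ⟨ψ, hψ⟩ := hf'.relabel (by rw [← hf'.card]; exact hS) hc
  refine ⟨_, ?_, ψ, hψ⟩
  have hpos : 0 < S.card := Finset.card_pos.2 ⟨v, hv⟩
  rw [hψ.card] at hpos
  by_contra hcon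
  rcases lt_or_ge (Nat.div c 18446744073709551616) reps.length with h | h
  · rw [List.getD_eq_getElem _ _ h] at hcon
    exact hcon (List.getElem_mem _)
  · rw [List.getD_eq_default _ _ h] at hpos
    simp at hpos

end

/-! ### Correctness of the gluing check -/

section

open Classical

variable {V : Type*} {H : SimpleGraph V} {S : Finset V} {v : V} {φ : ℕ → V} {g : List ℕ}

/-- The list `caps` stores the capacities `cap`. -/
def Levels (caps : List ℕ) (cap : ℕ → ℕ) : Prop :=
  ∀ i p, (caps.getD i 0).testBit p = true ↔ i < cap p

theorem Levels.tail {C : ℕ} {caps : List ℕ} {cap : ℕ → ℕ} (h : Levels (C :: caps) cap) :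
    Levels caps fun p => cap p - 1 := by
  intro i p
  have := h (i + 1) p
  rw [List.getD_cons_succ] at this
  rw [this]
  beta_reduce
  omega

theorem Levels.capOf {caps : List ℕ} {cap : ℕ → ℕ} (h : Levels caps cap) (w : ℕ) :
    capOf w caps = cap w := by
  induction caps generalizing cap with
  | nil =>
    have := h 0 w
    simp at this
    simp [Folkman.capOf, this]
  | cons C caps ih =>
    have h0 := h 0 w
    rw [List.getD_cons_zero] at h0
    rw [Folkman.capOf, ih h.tail]
    cases hC : C.testBit w
    · have : ¬ 0 < cap w := by rw [← h0, hC]; simp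
      rw [cond_false]
      omega
    · have := h0.1 hC
      rw [cond_true]
      omega

theorem Levels.consume {caps : List ℕ} {cap : ℕ → ℕ} (h : Levels caps cap) {c : ℕ}
    {A : Finset ℕ} (hc : Codes c A) :
    Levels (consume c caps) fun p => cap p - if p ∈ A then 1 else 0 := by
  induction caps generalizing cap with
  | nil =>
    intro i p
    have h0 : cap p = 0 := by
      have := h 0 p
      simpa using this
    simp [Folkman.consume, h0]
  | cons C caps ih =>
    intro i p
    have e : Folkman.consume c (C :: caps) =
        ((C ^^^ (C &&& c)) ||| (caps.headD 0 &&& c)) :: Folkman.consume c caps := rfl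
    rw [e]
    cases i with
    | zero =>
      have h0 := h 0 p
      have h1 := h 1 p
      rw [List.getD_cons_zero] at h0 ⊢
      rw [List.getD_cons_succ] at h1
      have e1 : caps.headD 0 = caps.getD 0 0 := by cases caps <;> rfl
      rw [Nat.testBit_or, Nat.testBit_xor, Nat.testBit_and, Nat.testBit_and, e1]
      have hcp := hc p
      by_cases hA : p ∈ A
      · rw [hcp.2 hA, Bool.and_true, Bool.and_true, Bool.xor_self, Bool.false_or, h1]
        beta_reduce
        rw [if_pos hA]
        omega
      · have : c.testBit p = false := by rw [Bool.eq_false_iff]; exact fun h => hA (hcp.1 h)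
        rw [this, Bool.and_false, Bool.and_false, Bool.xor_false, Bool.or_false, h0]
        beta_reduce
        rw [if_neg hA]
        omega
    | succ i =>
      rw [List.getD_cons_succ, ih h.tail i p]
      beta_reduce
      omega

theorem glue_zero (ws caps : List ℕ) (slack : ℕ) (cs : List (ℕ × ℕ)) :
    glue 0 ws caps slack cs = false := rfl

theorem glue_nil (r : ℕ) (caps : List ℕ) (slack : ℕ) (cs : List (ℕ × ℕ)) :
    glue (r + 1) [] caps slack cs = cs.isEmpty := rfl

/-- The branches of `glue` at the vertex `w`: `L` lists the candidates through `w` still to be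
tried. -/
def glueBranch (r w : ℕ) (ws caps : List ℕ) (slack : ℕ) (cs L : List (ℕ × ℕ)) : Bool :=
  List.rec (motive := fun _ => Bool)
    (Bool.rec
      (glue (r + 1) ws caps (Nat.sub slack (capOf w caps)) (filt (fun y => !Nat.testBit y.1 w) cs))
      true (Nat.ble (Nat.succ slack) (capOf w caps)))
    (fun x xs ih =>
      (forceList (consume x.1 caps) fun caps' =>
        glue r (w :: ws) caps' slack
          (filt (fun y => Bool.rec false (Nat.beq (Nat.land y.1 (caps'.headD 0)) y.1)
            (Nat.beq (Nat.land y.2 x.2) 0))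
            (x :: xs ++ filt (fun y => !Nat.testBit y.1 w) cs))) && ih) L

theorem glue_cons (r w : ℕ) (ws caps : List ℕ) (slack : ℕ) (cs : List (ℕ × ℕ)) :
    glue (r + 1) (w :: ws) caps slack cs =
      glueBranch r w ws caps slack cs (filt (fun y => Nat.testBit y.1 w) cs) := rfl

theorem glueBranch_cons (r w : ℕ) (ws caps : List ℕ) (slack : ℕ) (cs : List (ℕ × ℕ)) (x : ℕ × ℕ)
    (xs : List (ℕ × ℕ)) : glueBranch r w ws caps slack cs (x :: xs) =
      (glue r (w :: ws) (consume x.1 caps) slack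
        ((x :: xs ++ cs.filter fun y => !Nat.testBit y.1 w).filter fun y => Bool.rec false
          (Nat.beq (Nat.land y.1 ((consume x.1 caps).headD 0)) y.1)
            (Nat.beq (Nat.land y.2 x.2) 0)) && glueBranch r w ws caps slack cs xs) := by
  have : glueBranch r w ws caps slack cs (x :: xs) =
      ((forceList (consume x.1 caps) fun caps' =>
        glue r (w :: ws) caps' slack
          (filt (fun y => Bool.rec false (Nat.beq (Nat.land y.1 (caps'.headD 0)) y.1)
            (Nat.beq (Nat.land y.2 x.2) 0))
            (x :: xs ++ filt (fun y => !Nat.testBit y.1 w) cs))) &&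
              glueBranch r w ws caps slack cs xs) := rfl
  rw [this, forceList_eq, filt_eq, filt_eq]

theorem glueBranch_nil (r w : ℕ) (ws caps : List ℕ) (slack : ℕ) (cs : List (ℕ × ℕ))
    (h : capOf w caps ≤ slack) : glueBranch r w ws caps slack cs [] =
      glue (r + 1) ws caps (slack - capOf w caps) (cs.filter fun y => !Nat.testBit y.1 w) := by
  have h1 : glueBranch r w ws caps slack cs [] = Bool.rec
      (glue (r + 1) ws caps (Nat.sub slack (capOf w caps)) (filt (fun y => !Nat.testBit y.1 w) cs))
      true (Nat.ble (Nat.succ slack) (capOf w caps)) := rfl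
  have h2 : Nat.ble (Nat.succ slack) (capOf w caps) = false := by
    rw [Bool.eq_false_iff, ne_eq, Nat.ble_eq]
    omega
  rw [h1, h2, filt_eq]
  rfl

/-- The candidate `x` describes the set `A`. -/
structure Describes (sets : List ℕ) (x : ℕ × ℕ) (A : Finset ℕ) : Prop where
  codes : Codes x.1 A
  missed : x.2 = missedBits x.1 sets

/-- If the check `glue` succeeds, no family `T` as described there exists. Here `D` indexes the members
of the family still to be chosen. -/
theorem glue_sound {ι : Type*} [DecidableEq ι] {sets : List ℕ} (T : ι → Finset ℕ) (r : ℕ) :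
    ∀ (ws caps : List ℕ) (slack : ℕ) (cs : List (ℕ × ℕ)) (cap : ℕ → ℕ) (D : Finset ι),
      glue r ws caps slack cs = true → D.card = r → Levels caps cap →
      (∀ u ∈ D, ∃ x ∈ cs, Describes sets x (T u)) →
      (∀ u ∈ D, ∀ u' ∈ D, u ≠ u' → ∀ s ∈ sets, ∀ B, Codes s B →
        Disjoint B (T u) → ¬ Disjoint B (T u')) →
      (∀ s ∈ sets, ∃ B, Codes s B) →
      (∀ p, (D.filter fun u => p ∈ T u).card ≤ cap p) →
      (ws.map fun p => cap p - (D.filter fun u => p ∈ T u).card).sum ≤ slack → False := by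
  induction r with
  | zero =>
    intro ws caps slack cs cap D h
    rw [glue_zero] at h
    simp at h
  | succ r ihr =>
    intro ws
    induction ws with
    | nil =>
      intro caps slack cs cap D h hD _ hcs _ _ _ _
      rw [glue_nil, List.isEmpty_iff] at h
      obtain ⟨u, hu⟩ := Finset.card_pos.1 (show 0 < D.card by omega)
      obtain ⟨x, hx, -⟩ := hcs u hu
      simp [h] at hx
    | cons w ws ihw =>
      intro caps slack cs cap D h hD hcap hcs hhit hsets hle hsum
      rw [glue_cons, filt_eq] at h
      have key : ∀ L : List (ℕ × ℕ), glueBranch r w ws caps slack cs L = true →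
          ∀ u ∈ D, w ∈ T u → ¬ (∀ u ∈ D,
            ∃ x ∈ L ++ cs.filter fun y => !Nat.testBit y.1 w, Describes sets x (T u)) := by
        intro L hL u₀ hu₀ hwu₀
        induction L with
        | nil =>
          intro hcs'
          obtain ⟨x, hx, hd⟩ := hcs' u₀ hu₀
          rw [List.nil_append, List.mem_filter, (hd.codes w).2 hwu₀] at hx
          simp at hx
        | cons x xs ih =>
          rw [glueBranch_cons, Bool.and_eq_true] at hL
          intro hcs'
          by_cases hm : ∃ u ∈ D, Describes sets x (T u)
          · obtain ⟨u, hu, hxu⟩ := hm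
            have hcard : ∀ p, (D.filter fun u => p ∈ T u).card =
                ((D.erase u).filter fun u => p ∈ T u).card + if p ∈ T u then 1 else 0 := by
              intro p
              rw [← Finset.insert_erase hu, Finset.filter_insert, Finset.erase_insert_eq_erase,
                Finset.erase_idem]
              split_ifs with hp
              · rw [Finset.card_insert_of_notMem]
                simp
              · rfl
            have hcap' := hcap.consume hxu.codes
            refine ihr (w :: ws) _ slack _ _ (D.erase u) hL.1
              (by rw [Finset.card_erase_of_mem hu]; omega) hcap' ?_ ?_ hsets ?_ ?_
            · intro u' hu'
              have hu'D := Finset.mem_of_mem_erase hu'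
              obtain ⟨y, hy, hd⟩ := hcs' u' hu'D
              refine ⟨y, List.mem_filter.2 ⟨hy, ?_⟩, hd⟩
              have h1 : Nat.beq (Nat.land y.2 x.2) 0 = true := by
                rw [land_eq_zero_iff]
                intro t ht
                rw [hd.missed, testBit_missedBits] at ht
                obtain ⟨s, hs, hty⟩ := ht
                by_contra hR
                rw [Bool.not_eq_false, hxu.missed, testBit_missedBits] at hR
                obtain ⟨s', hs', htx⟩ := hR
                obtain rfl : s = s' := by rw [hs] at hs'; exact Option.some.inj hs'
                have hmem := List.mem_of_getElem? hs
                obtain ⟨B, hB⟩ := hsets s hmem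
                exact hhit u hu u' hu'D (Finset.ne_of_mem_erase hu').symm s hmem B hB
                  ((hB.land_eq_zero_iff hxu.codes).1 htx) ((hB.land_eq_zero_iff hd.codes).1 hty)
              have h2 : Nat.beq (Nat.land y.1 ((Folkman.consume x.1 caps).headD 0)) y.1 = true := by
                rw [beq_iff]
                apply Nat.eq_of_testBit_eq
                intro p
                change (y.1 &&& (Folkman.consume x.1 caps).headD 0).testBit p = _
                have e1 : (Folkman.consume x.1 caps).headD 0 =
                  (Folkman.consume x.1 caps).getD 0 0 := by
                    cases Folkman.consume x.1 caps <;> rfl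
                rw [Nat.testBit_and, e1]
                cases hp : y.1.testBit p
                · rfl
                · rw [Bool.true_and, hcap' 0 p]
                  beta_reduce
                  have hpT := (hd.codes p).1 hp
                  have h3 := hle p
                  rw [hcard p] at h3
                  have h4 : 0 < ((D.erase u).filter fun u => p ∈ T u).card :=
                    Finset.card_pos.2 ⟨u', Finset.mem_filter.2 ⟨hu', hpT⟩⟩
                  omega
              simp only [h1, h2]
            · exact fun u₁ h1 u₂ h2 => hhit u₁ (Finset.mem_of_mem_erase h1) u₂
                (Finset.mem_of_mem_erase h2)
            · intro p
              have := hle p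
              rw [hcard p] at this
              omega
            · refine le_trans (le_of_eq ?_) hsum
              congr 1
              refine List.map_congr_left fun p _ => ?_
              rw [hcard p]
              omega
          · refine ih hL.2 fun u hu => ?_
            obtain ⟨y, hy, hd⟩ := hcs' u hu
            rw [List.cons_append, List.mem_cons] at hy
            rcases hy with rfl | hy
            · exact absurd ⟨u, hu, hd⟩ hm
            · exact ⟨y, hy, hd⟩
      have hcs' : ∀ u ∈ D, ∃ x ∈ (cs.filter fun y => Nat.testBit y.1 w) ++
          cs.filter fun y => !Nat.testBit y.1 w, Describes sets x (T u) := by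
        intro u hu
        obtain ⟨x, hx, hd⟩ := hcs u hu
        refine ⟨x, ?_, hd⟩
        rw [List.mem_append, List.mem_filter, List.mem_filter]
        cases h : x.1.testBit w <;> simp [hx]
      by_cases hw : ∃ u ∈ D, w ∈ T u
      · obtain ⟨u, hu, hwu⟩ := hw
        exact key _ h u hu hwu hcs'
      · push Not at hw
        have hzero : (D.filter fun u => w ∈ T u).card = 0 := by
          rw [Finset.card_eq_zero, Finset.filter_eq_empty_iff]
          exact fun u hu => hw u hu
        rw [List.map_cons, List.sum_cons, hzero, Nat.sub_zero] at hsum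
        have hcw := hcap.capOf w
        have hend : ∀ L : List (ℕ × ℕ), glueBranch r w ws caps slack cs L = true →
            glueBranch r w ws caps slack cs [] = true := by
          intro L hL
          induction L with
          | nil => exact hL
          | cons x xs ih =>
            rw [glueBranch_cons, Bool.and_eq_true] at hL
            exact ih hL.2
        have h' := hend _ h
        rw [glueBranch_nil _ _ _ _ _ _ (by omega)] at h'
        refine ihw _ _ _ cap D h' hD hcap ?_ hhit hsets hle (by omega)
        intro u hu
        obtain ⟨x, hx, hd⟩ := hcs u hu
        refine ⟨x, List.mem_filter.2 ⟨hx, ?_⟩, hd⟩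
        rw [Bool.not_eq_true', Bool.eq_false_iff]
        exact fun h => hw u hu ((hd.codes w).1 h)

theorem Levels.foldl_consume {α : Type*} {f : α → ℕ} {A : α → Finset ℕ} {qs : List α}
    (hf : ∀ q ∈ qs, Codes (f q) (A q)) {caps : List ℕ} {cap : ℕ → ℕ} (h : Levels caps cap) :
    Levels (qs.foldl (fun caps q => Folkman.consume (f q) caps) caps)
      fun p => cap p - (qs.map fun q => if p ∈ A q then 1 else 0).sum := by
  induction qs generalizing caps cap with
  | nil => simpa using h
  | cons q qs ih =>
    have := ih (fun q hq => hf q (List.mem_cons_of_mem _ hq)) (h.consume (hf q List.mem_cons_self))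
    simp only [List.foldl_cons, List.map_cons, List.sum_cons]
    simpa only [Nat.sub_sub] using this

theorem sum_map_range (n : ℕ) (f : ℕ → ℕ) :
    ((List.range n).map f).sum = ∑ i ∈ Finset.range n, f i := by
  rw [sum_map_eq_sum_range, List.length_range]
  refine Finset.sum_congr rfl fun j hj => ?_
  rw [List.getD_eq_getElem _ _ (by simpa using hj), List.getElem_range]

theorem Rep.levels_startCaps (hg : Rep H φ g S) (hn : g.length ≤ 16) :
    Levels (startCaps (packRows 0 g) g.length)
      fun p => if p < g.length then 6 - deg H S (φ p) else 0 := by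
  have h0 : Levels (List.replicate 6 (Nat.sub (2 ^ g.length) 1))
      fun p => if p < g.length then 6 else 0 := by
    intro i p
    beta_reduce
    rcases lt_or_ge i 6 with hi | hi
    · rw [List.getD_eq_getElem _ _ (by simpa using hi), List.getElem_replicate]
      change (2 ^ g.length - 1).testBit p = true ↔ _
      rw [Nat.testBit_two_pow_sub_one, decide_eq_true_iff]
      split_ifs with hp <;> simp [hp, hi]
    · rw [List.getD_eq_default _ _ (by simpa using hi)]
      split_ifs <;> simp [hi]
  have h1 : ∀ q ∈ List.range g.length, Codes
      (rowOf (packRows 0 g) (Nat.sub g.length 1) q (List.range g.length).reverse 0)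
      ((Finset.range g.length).filter fun p => H.Adj (φ p) (φ q)) := by
    intro q hq i
    rw [List.mem_range] at hq
    rw [testBit_rowOf _ _ _ _ (fun p => adjBit_lt _ _ p q), List.reverse_reverse]
    simp only [Nat.zero_testBit, Bool.false_eq_true, and_false, or_false, Finset.mem_filter,
      Finset.mem_range]
    constructor
    · rintro ⟨p, hp, h⟩
      obtain ⟨hi, hip⟩ := List.getElem?_eq_some_iff.1 hp
      rw [List.getElem_range] at hip
      subst hip
      rw [List.length_range] at hi
      rw [hg.adjBit hn hi hq] at h
      refine ⟨hi, ?_⟩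
      by_contra hcon
      simp [hcon] at h
    · rintro ⟨hi, h⟩
      exact ⟨i, by simp [hi], by rw [hg.adjBit hn hi hq, if_pos h]⟩
  have h2 := h0.foldl_consume h1
  refine fun i p => (h2 i p).trans (iff_of_eq (congrArg (i < ·) ?_))
  beta_reduce
  rw [sum_map_range]
  split_ifs with hp
  · congr 1
    rw [deg, nb, Finset.card_filter, hg.sum]
    refine Finset.sum_congr rfl fun q _ => ?_
    simp [hp]
  · simp

theorem deg_eq_add (x : V) (hx : x ∈ far H S v) :
    deg H S x = deg H (far H S v) x + deg H (nb H S v) x := by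
  rw [deg, deg, deg, ← Finset.card_union_of_disjoint]
  · congr 1
    ext y
    simp only [mem_nb, Finset.mem_union, mem_far]
    constructor
    · rintro ⟨hy, hxy⟩
      by_cases hv : H.Adj v y
      · exact Or.inr ⟨⟨hy, hv⟩, hxy⟩
      · exact Or.inl ⟨⟨hy, fun h => (mem_far.1 hx).2.2 (h ▸ hxy).symm, hv⟩, hxy⟩
    · rintro (h | h)
      · exact ⟨h.1.1, h.2⟩
      · exact ⟨h.1.1, h.2⟩
  · exact disjoint_nb_far.symm.mono (nb_subset) (nb_subset)

/-- The neighbours `u` of `v` have cones `trace H φ g.length u` of five vertices, and a far vertex of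
degree `d` lies in at most `6 - d` of them. -/
theorem Rep.not_noGlue (ht : TriangleFree H) (hI : IndepLE H 6 S) (hv : v ∈ S) (hS : S.card = 23)
    (hd : deg H S v = 6) (hdn : ∀ u ∈ nb H S v, deg H S u = 6) (hg : Rep H φ g (far H S v)) :
    noGlue g = false := by
  rw [Bool.eq_false_iff]
  intro h
  have hlen : g.length = 16 := by
    have := card_far (H := H) hv
    rw [hg.card] at this
    omega
  rw [noGlue, forceList_eq, force_eq, forceList_eq, forcePairs_eq] at h
  have hlay := listsIndep_layers g
  have hsub : ∀ u, trace H φ g.length u ⊆ Finset.range g.length := fun u =>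
    Finset.filter_subset _ _
  have hdT : ∀ u ∈ nb H S v, (trace H φ g.length u).card = 5 := by
    intro u hu
    have := deg_eq_far ht hv hu
    rw [hg.card_trace]
    have := hdn u hu
    omega
  have hle : ∀ p < g.length, deg H (far H S v) (φ p) +
      ((nb H S v).filter fun u => p ∈ trace H φ g.length u).card ≤ 6 := by
    intro p hp
    rw [card_filter_trace hp, ← deg_eq_add _ (hg.mem hp)]
    exact hI.deg_le ht
  refine glue_sound (sets := (layers g).getD 5 []) (fun u => trace H φ g.length u) 6 _ _ _ _ _
    (nb H S v) h hd (hg.levels_startCaps hlen.le) ?_ ?_ ?_ ?_ ?_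
  · intro u hu
    obtain ⟨s, hs, hc⟩ := hlay.complete _ (hsub u) (hg.rowIndep (hsub u) fun i hi j hj h =>
      ht u _ _ (Finset.mem_filter.1 hi).2 h (Finset.mem_filter.1 hj).2)
    rw [hdT u hu] at hs
    exact ⟨(s, missedBits s ((layers g).getD 5 [])), List.mem_map.2 ⟨s, hs, rfl⟩, hc, rfl⟩
  · intro u hu u' hu' hne s hs B hB hBu hBu'
    obtain ⟨B', hB', hc, hcard, hBI⟩ := hlay.sound 5 s hs
    obtain rfl : B = B' := Finset.ext fun i => by rw [← hB i, hc i]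
    have hBI' := hg.indep hB' hBI
    have key : ∀ w, Disjoint B (trace H φ g.length w) → ∀ x ∈ B.image φ, ¬ H.Adj w x := by
      intro w hw x hx
      obtain ⟨i, hi, rfl⟩ := Finset.mem_image.1 hx
      exact fun h => Finset.disjoint_left.1 hw hi (Finset.mem_filter.2 ⟨hB' hi, h⟩)
    have hI1 : Indep H (B.image φ) := by
      intro x hx y hy
      obtain ⟨i, hi, rfl⟩ := Finset.mem_image.1 hx
      obtain ⟨j, hj, rfl⟩ := Finset.mem_image.1 hy
      exact hBI' i hi j hj
    have hfar : B.image φ ⊆ far H S v := by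
      intro x hx
      obtain ⟨i, hi, rfl⟩ := Finset.mem_image.1 hx
      exact hg.mem (Finset.mem_range.1 (hB' hi))
    have hnot : ∀ w ∈ nb H S v, w ∉ B.image φ := fun w hw hw' =>
      Finset.disjoint_left.1 disjoint_nb_far hw (hfar hw')
    have hI2 : Indep H (insert u (insert u' (B.image φ))) := by
      refine (hI1.insert_of (key u' hBu')).insert_of fun x hx => ?_
      rcases Finset.mem_insert.1 hx with rfl | hx
      · exact ht.indep_nb u hu x hu'
      · exact key u hBu x hx
    have := hI _ (by
      intro x hx
      simp only [Finset.mem_insert] at hx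
      rcases hx with rfl | rfl | hx
      · exact nb_subset hu
      · exact nb_subset hu'
      · exact far_subset (hfar hx)) hI2
    rw [Finset.card_insert_of_notMem, Finset.card_insert_of_notMem (hnot u' hu'),
      Finset.card_image_of_injOn, hcard] at this
    · omega
    · exact fun i hi j hj h =>
        hg.inj i (Finset.mem_range.1 (hB' hi)) j (Finset.mem_range.1 (hB' hj)) h
    · rw [Finset.mem_insert, not_or]
      exact ⟨hne, hnot u hu⟩
  · intro s hs
    obtain ⟨B, -, hB, -⟩ := hlay.sound 5 s hs
    exact ⟨B, hB⟩
  · intro p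
    split_ifs with hp
    · have := hle p hp
      omega
    · rw [Nat.le_zero, Finset.card_eq_zero, Finset.filter_eq_empty_iff]
      exact fun u _ h => hp (Finset.mem_range.1 (hsub u h))
  · rw [List.map_reverse, List.sum_reverse, sum_map_range]
    have h1 : ∑ p ∈ Finset.range g.length, deg H (far H S v) (φ p) = 2 * edges H (far H S v) := by
      rw [two_mul_edges, hg.sum]
    have h2 : ∑ p ∈ Finset.range g.length,
        ((nb H S v).filter fun u => p ∈ trace H φ g.length u).card = 30 := by
      simp only [Finset.card_filter]
      rw [Finset.sum_comm]
      have : ∀ u ∈ nb H S v, (∑ p ∈ Finset.range g.length,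
          if p ∈ trace H φ g.length u then 1 else 0) = 5 := by
        intro u hu
        rw [← Finset.card_filter, ← hdT u hu]
        congr 1
        ext i
        rw [Finset.mem_filter, and_iff_right_of_imp (fun h => hsub u h)]
      rw [Finset.sum_congr rfl this, Finset.sum_const, smul_eq_mul, ← deg, hd]
    have h3 : ∑ p ∈ Finset.range g.length, ((if p < g.length then 6 - deg H (far H S v) (φ p) else 0)
        - ((nb H S v).filter fun u => p ∈ trace H φ g.length u).card) +
        ∑ p ∈ Finset.range g.length, deg H (far H S v) (φ p) + ∑ p ∈ Finset.range g.length,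
        ((nb H S v).filter fun u => p ∈ trace H φ g.length u).card = 96 := by
      rw [← Finset.sum_add_distrib, ← Finset.sum_add_distrib, Finset.sum_congr rfl (g := fun _ => 6),
        Finset.sum_const, Finset.card_range, hlen]
      · rfl
      · intro p hp
        rw [Finset.mem_range] at hp
        rw [if_pos hp]
        have := hle p hp
        omega
    have h4 := hg.edgeCount_le
    change _ ≤ 66 - 2 * edgeCount g
    omega

end

/-! ### The computations -/

/-- The edge as an extension of the empty graph. The statements up to `stage_sixteen'` are the
further steps of the two chains of extensions that lead to graphs with sixteen vertices. -/
theorem stage_edge : checkStage 0 1 1 [[0, 1]] [] [0x10] = true := by decide +kernel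

theorem stage_five : checkStage 1 2 5 [cycleFive] [0, 1] [0x43210] = true := by decide +kernel

theorem stage_eight : checkStage 2 2 11 reps8 cycleFive certs8 = true := by decide +kernel

theorem stage_eleven : all2 (checkStage 3 2 16 reps11) reps8 certs11 = true := by decide +kernel

theorem stage_sixteen : all2 (checkStage 4 4 33 reps16) reps11 certs16 = true := by decide +kernel

theorem stage_seven : checkStage 2 1 6 [[0, 1, 1, 2, 12, 0, 32]] cycleFive [0x6543210] = true := by
  decide +kernel

theorem stage_ten : checkStage 3 2 10 [[0, 1, 1, 2, 12, 0, 32, 32, 64, 384]]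
    [0, 1, 1, 2, 12, 0, 32] [0x9876543210] = true := by decide +kernel

theorem stage_sixteen' : checkStage 4 5 33 [] [0, 1, 1, 2, 12, 0, 32, 32, 64, 384] [] = true := by
  decide +kernel

theorem not_glue_sixteen : reps16.all noGlue = true := by decide +kernel

theorem edgeCount_sixteen : (reps16.all fun g => Nat.ble 32 (edgeCount g)) = true := by decide +kernel

section

open Classical

variable {V : Type*} {H : SimpleGraph V} {S : Finset V} {v : V}

/-! ### Triangle-free graphs with small independence number -/

theorem eq_empty_of_indepLE_zero (hI : IndepLE H 0 S) : S = ∅ := by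
  by_contra h
  obtain ⟨v, hv⟩ := Finset.nonempty_iff_ne_empty.2 h
  have := hI {v} (by simpa using hv) (by
    intro x hx y hy
    rw [Finset.mem_singleton] at hx hy
    rw [hx, hy]
    exact H.irrefl)
  simp at this

theorem exists_mem_of_card {n : ℕ} (h : n + 1 ≤ S.card) : ∃ v, v ∈ S :=
  Finset.card_pos.1 (by omega)

theorem card_le_two (ht : TriangleFree H) (hI : IndepLE H 1 S) : S.card ≤ 2 := by
  by_contra! h
  obtain ⟨v, hv⟩ := exists_mem_of_card h
  have h1 := card_far (H := H) hv
  have h2 := hI.deg_le ht (v := v)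
  rw [eq_empty_of_indepLE_zero (hI.far hv), Finset.card_empty] at h1
  omega

theorem card_le_five (ht : TriangleFree H) (hI : IndepLE H 2 S) : S.card ≤ 5 := by
  by_contra! h
  obtain ⟨v, hv⟩ := exists_mem_of_card h
  have h1 := card_far (H := H) hv
  have h2 := hI.deg_le ht (v := v)
  have h3 := card_le_two ht (hI.far hv)
  omega

/-- A regular graph of odd degree has an even number of vertices. -/
theorem even_card_of_odd_deg {d : ℕ} (hd : Odd d) (h : ∀ v ∈ S, deg H S v = d) : Even S.card := by
  have := two_mul_edges H S
  rw [Finset.sum_congr rfl h, Finset.sum_const, smul_eq_mul] at this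
  have h2 : Even (S.card * d) := ⟨edges H S, by omega⟩
  rcases Nat.even_mul.1 h2 with h2 | h2
  · exact h2
  · exact absurd hd (by simpa using h2)

theorem card_le_eight (ht : TriangleFree H) (hI : IndepLE H 3 S) : S.card ≤ 8 := by
  have key : ∀ v ∈ S, S.card ≤ 6 + deg H S v ∧ deg H S v ≤ 3 := fun v hv => by
    have h1 := card_far (H := H) hv
    have h2 := hI.deg_le ht (v := v)
    have h3 := card_le_five ht (hI.far hv)
    omega
  by_contra! h
  obtain ⟨v, hv⟩ := exists_mem_of_card h
  have h9 : S.card = 9 := by have := key v hv; omega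
  have := even_card_of_odd_deg (H := H) (d := 3) (by decide) fun v hv => by have := key v hv; omega
  rw [h9] at this
  revert this
  decide

theorem card_le_thirteen (ht : TriangleFree H) (hI : IndepLE H 4 S) : S.card ≤ 13 := by
  by_contra! h
  obtain ⟨v, hv⟩ := exists_mem_of_card h
  have h1 := card_far (H := H) hv
  have h2 := hI.deg_le ht (v := v)
  have h3 := card_le_eight ht (hI.far hv)
  omega

theorem card_le_eighteen (ht : TriangleFree H) (hI : IndepLE H 5 S) : S.card ≤ 18 := by
  have key : ∀ v ∈ S, S.card ≤ 14 + deg H S v ∧ deg H S v ≤ 5 := fun v hv => by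
    have h1 := card_far (H := H) hv
    have h2 := hI.deg_le ht (v := v)
    have h3 := card_le_thirteen ht (hI.far hv)
    omega
  by_contra! h
  obtain ⟨v, hv⟩ := exists_mem_of_card h
  have h9 : S.card = 19 := by have := key v hv; omega
  have := even_card_of_odd_deg (H := H) (d := 5) (by decide) fun v hv => by have := key v hv; omega
  rw [h9] at this
  revert this
  decide

theorem card_mul_le_of_le_deg {d : ℕ} (h : ∀ v ∈ S, d ≤ deg H S v) :
    S.card * d ≤ 2 * edges H S := by
  rw [two_mul_edges, ← smul_eq_mul]
  exact Finset.card_nsmul_le_sum _ _ _ h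

theorem le_card_mul_of_deg_le {d : ℕ} (h : ∀ v ∈ S, deg H S v ≤ d) :
    2 * edges H S ≤ S.card * d := by
  rw [two_mul_edges, ← smul_eq_mul]
  exact Finset.sum_le_card_nsmul _ _ _ h

theorem deg_two (hI : IndepLE H 1 S) (hS : S.card = 2) (hv : v ∈ S) :
    deg H S v = 1 := by
  have h1 := card_far (H := H) hv
  rw [eq_empty_of_indepLE_zero (hI.far hv), Finset.card_empty] at h1
  omega

theorem edges_two (hI : IndepLE H 1 S) (hS : S.card = 2) :
    edges H S = 1 := by
  have h1 := card_mul_le_of_le_deg fun v hv => (deg_two hI hS (v := v) hv).ge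
  have h2 := le_card_mul_of_deg_le fun v hv => (deg_two hI hS (v := v) hv).le
  omega

theorem edges_four (ht : TriangleFree H) (hI : IndepLE H 2 S) (hS : S.card = 4) :
    2 ≤ edges H S := by
  have := card_mul_le_of_le_deg (H := H) (S := S) (d := 1) fun v hv => by
    have h1 := card_far (H := H) hv
    have h3 := card_le_two ht (hI.far hv)
    omega
  omega

theorem deg_five (ht : TriangleFree H) (hI : IndepLE H 2 S) (hS : S.card = 5) (hv : v ∈ S) :
    deg H S v = 2 := by
  have h1 := card_far (H := H) hv
  have h2 := hI.deg_le ht (v := v)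
  have h3 := card_le_two ht (hI.far hv)
  omega

theorem edges_five (ht : TriangleFree H) (hI : IndepLE H 2 S) (hS : S.card = 5) :
    edges H S = 5 := by
  have h1 := card_mul_le_of_le_deg fun v hv => (deg_five ht hI hS (v := v) hv).ge
  have h2 := le_card_mul_of_deg_le fun v hv => (deg_five ht hI hS (v := v) hv).le
  omega

theorem edges_six (ht : TriangleFree H) (hI : IndepLE H 3 S) (hS : S.card = 6) :
    3 ≤ edges H S := by
  have := edges_of_line ht (S := S) (A := 0) (B := 3) fun v hv => by
    have hc := card_far (H := H) hv
    have hd := hI.deg_le ht (v := v)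
    obtain h | h | h : deg H S v = 0 ∨ deg H S v = 1 ∨ 2 ≤ deg H S v := by omega
    · have := edges_five ht (hI.far hv) (by omega)
      rw [h]
      push_cast
      omega
    · have := edges_four ht (hI.far hv) (by omega)
      rw [h]
      push_cast
      omega
    · have : (2 : ℤ) ≤ deg H S v := by exact_mod_cast h
      nlinarith
  rw [hS] at this
  omega

theorem edges_seven (ht : TriangleFree H) (hI : IndepLE H 3 S) (hS : S.card = 7) :
    6 ≤ edges H S := by
  have := edges_of_line ht (S := S) (A := 0) (B := 6) fun v hv => by
    have hc := card_far (H := H) hv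
    have hd := hI.deg_le ht (v := v)
    have hf := card_le_five ht (hI.far hv)
    obtain h | h | h : deg H S v = 1 ∨ deg H S v = 2 ∨ deg H S v = 3 := by omega
    · have := edges_five ht (hI.far hv) (by omega)
      rw [h]
      push_cast
      omega
    · have := edges_four ht (hI.far hv) (by omega)
      rw [h]
      push_cast
      omega
    · rw [h]
      push_cast
      omega
  rw [hS] at this
  omega

theorem edges_eight (ht : TriangleFree H) (hI : IndepLE H 3 S) (hS : S.card = 8) :
    10 ≤ edges H S := by
  have := edges_of_line ht (S := S) (A := 2) (B := 5) fun v hv => by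
    have hc := card_far (H := H) hv
    have hd := hI.deg_le ht (v := v)
    have hf := card_le_five ht (hI.far hv)
    obtain h | h : deg H S v = 2 ∨ deg H S v = 3 := by omega
    · have := edges_five ht (hI.far hv) (by omega)
      rw [h]
      push_cast
      omega
    · have := edges_four ht (hI.far hv) (by omega)
      rw [h]
      push_cast
      omega
  rw [hS] at this
  omega

/-- With ten vertices and independence number four, the line in `edges_of_line` is horizontal, and
only vertices of degree two can lie on it. -/
theorem line_ten (ht : TriangleFree H) (hI : IndepLE H 4 S) (hS : S.card = 10) (hv : v ∈ S) :
    10 ≤ deg H S v ^ 2 + edges H (far H S v) ∧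
      (deg H S v ^ 2 + edges H (far H S v) ≤ 10 → deg H S v = 2) := by
  have hc := card_far (H := H) hv
  have hd := hI.deg_le ht (v := v)
  have hf := card_le_eight ht (hI.far hv)
  obtain h | h | h | h : deg H S v = 1 ∨ deg H S v = 2 ∨ deg H S v = 3 ∨ deg H S v = 4 := by omega
  · have := edges_eight ht (hI.far hv) (by omega)
    rw [h]
    omega
  · have := edges_seven ht (hI.far hv) (by omega)
    rw [h]
    omega
  · have := edges_six ht (hI.far hv) (by omega)
    rw [h]
    omega
  · rw [h]
    omega

theorem edges_ten (ht : TriangleFree H) (hI : IndepLE H 4 S) (hS : S.card = 10) :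
    10 ≤ edges H S := by
  have := edges_of_line ht (S := S) (A := 0) (B := 10) fun v hv => by
    have := (line_ten ht hI hS hv).1
    zify at this
    omega
  rw [hS] at this
  omega

theorem edges_eleven (ht : TriangleFree H) (hI : IndepLE H 4 S) (hS : S.card = 11) :
    15 ≤ edges H S := by
  have := edges_of_line ht (S := S) (A := 1) (B := 12) fun v hv => by
    have hc := card_far (H := H) hv
    have hd := hI.deg_le ht (v := v)
    have hf := card_le_eight ht (hI.far hv)
    obtain h | h | h : deg H S v = 2 ∨ deg H S v = 3 ∨ deg H S v = 4 := by omega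
    · have := edges_eight ht (hI.far hv) (by omega)
      rw [h]
      push_cast
      omega
    · have := edges_seven ht (hI.far hv) (by omega)
      rw [h]
      push_cast
      omega
    · have := edges_six ht (hI.far hv) (by omega)
      rw [h]
      push_cast
      omega
  rw [hS] at this
  omega

theorem edges_twelve (ht : TriangleFree H) (hI : IndepLE H 4 S) (hS : S.card = 12) :
    20 ≤ edges H S := by
  have := edges_of_line ht (S := S) (A := 3) (B := 10) fun v hv => by
    have hc := card_far (H := H) hv
    have hd := hI.deg_le ht (v := v)
    have hf := card_le_eight ht (hI.far hv)
    obtain h | h : deg H S v = 3 ∨ deg H S v = 4 := by omega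
    · have := edges_eight ht (hI.far hv) (by omega)
      rw [h]
      push_cast
      omega
    · have := edges_seven ht (hI.far hv) (by omega)
      rw [h]
      push_cast
      omega
  rw [hS] at this
  omega

theorem edges_thirteen (ht : TriangleFree H) (hI : IndepLE H 4 S) (hS : S.card = 13) :
    26 ≤ edges H S := by
  have := card_mul_le_of_le_deg (H := H) (S := S) (d := 4) fun v hv => by
    have h1 := card_far (H := H) hv
    have h3 := card_le_eight ht (hI.far hv)
    omega
  omega

theorem edges_seventeen (ht : TriangleFree H) (hI : IndepLE H 5 S) (hS : S.card = 17) :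
    38 ≤ edges H S := by
  have := edges_of_line ht (S := S) (A := 4) (B := 20) fun v hv => by
    have hc := card_far (H := H) hv
    have hd := hI.deg_le ht (v := v)
    have hf := card_le_thirteen ht (hI.far hv)
    obtain h | h | h : deg H S v = 3 ∨ deg H S v = 4 ∨ deg H S v = 5 := by omega
    · have := edges_thirteen ht (hI.far hv) (by omega)
      rw [h]
      push_cast
      omega
    · have := edges_twelve ht (hI.far hv) (by omega)
      rw [h]
      push_cast
      omega
    · have := edges_eleven ht (hI.far hv) (by omega)
      rw [h]
      push_cast
      omega
  rw [hS] at this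
  omega

theorem edges_eighteen (ht : TriangleFree H) (hI : IndepLE H 5 S) (hS : S.card = 18) :
    45 ≤ edges H S := by
  have := edges_of_line ht (S := S) (A := 3) (B := 30) fun v hv => by
    have hc := card_far (H := H) hv
    have hd := hI.deg_le ht (v := v)
    have hf := card_le_thirteen ht (hI.far hv)
    obtain h | h : deg H S v = 4 ∨ deg H S v = 5 := by omega
    · have := edges_thirteen ht (hI.far hv) (by omega)
      rw [h]
      push_cast
      omega
    · have := edges_twelve ht (hI.far hv) (by omega)
      rw [h]
      push_cast
      omega
  rw [hS] at this
  omega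

end

/-! ### The Ramsey bound for independence number six -/

section

open Classical

variable {V : Type*} {H : SimpleGraph V} {S : Finset V} {v u : V}

theorem exists_rep_five (ht : TriangleFree H) (hI : IndepLE H 2 S) (hS : S.card = 5) :
    ∃ φ, Rep H φ cycleFive S := by
  obtain ⟨v, hv⟩ := exists_mem_of_card (n := 4) hS.ge
  have hd := deg_five ht hI hS hv
  have hc := card_far (H := H) hv
  have hI1 := hI.far hv
  have h2 : (far H S v).card = 2 := by omega
  obtain ⟨w, hw⟩ := exists_mem_of_card (n := 1) h2.ge
  have h0 : Rep H (fun _ => w) [] (far H (far H S v) w) :=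
    ⟨by simp, by rw [eq_empty_of_indepLE_zero (hI1.far hw)]; rfl, by simp⟩
  obtain ⟨g, hg, φ, h1⟩ := h0.stage ht hw hI1 (deg_two hI1 h2 hw) (edges_two hI1 h2).le (by omega)
    stage_edge
  rw [List.mem_singleton] at hg
  subst hg
  obtain ⟨g, hg, φ, h2⟩ := h1.stage ht hv hI hd (edges_five ht hI hS).le (by omega) stage_five
  rw [List.mem_singleton] at hg
  subst hg
  exact ⟨φ, h2⟩

theorem exists_rep_eight (ht : TriangleFree H) (hI : IndepLE H 3 S) (hS : S.card = 8)
    (he : edges H S ≤ 11) : ∃ g ∈ reps8, ∃ φ, Rep H φ g S := by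
  obtain ⟨z, hz, hd⟩ : ∃ z ∈ S, deg H S z = 2 := by
    by_contra! hcon
    have := card_mul_le_of_le_deg (H := H) (S := S) (d := 3) fun v hv => by
      have h1 := card_far (H := H) hv
      have h3 := card_le_five ht (hI.far hv)
      have := hcon v hv
      omega
    omega
  have hc := card_far (H := H) hz
  obtain ⟨φ, hφ⟩ := exists_rep_five ht (hI.far hz) (by omega)
  exact hφ.stage ht hz hI hd he (by omega) stage_eight

/-- The bound for a vertex of degree two in a triangle-free graph with eleven vertices, at most sixteen edges and
independence number at most four: if both of its neighbours had degree two, at least six vertices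
would be adjacent to neither of them. -/
theorem edges_far_le_eleven (ht : TriangleFree H) (hI : IndepLE H 4 S) (hS : S.card = 11)
    (he : edges H S ≤ 16) (hu : u ∈ S) (hd : deg H S u = 2) : edges H (far H S u) ≤ 11 := by
  have hdeg : ∀ x ∈ S, 2 ≤ deg H S x := by
    intro x hx
    have h1 := card_far (H := H) hx
    have h3 := card_le_eight ht (hI.far hx)
    omega
  obtain ⟨x, y, hxy, hn⟩ := Finset.card_eq_two.1 hd
  have h1 := edges_eq_far ht hu
  rw [hn, Finset.sum_pair hxy] at h1
  have hx : x ∈ nb H S u := by simp [hn]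
  have hy : y ∈ nb H S u := by simp [hn]
  have hx2 := hdeg x (nb_subset hx)
  have hy2 := hdeg y (nb_subset hy)
  by_contra! hcon
  have hdx : deg H S x = 2 := by omega
  have hdy : deg H S y = 2 := by omega
  have hyx : y ∈ far H S x :=
    mem_far.2 ⟨nb_subset hy, hxy.symm, ht.indep_nb x hx y hy⟩
  have h2 := card_far (H := H) (nb_subset hx)
  have h3 := card_far (H := H) hyx
  have h4 := deg_eq_add y hyx
  have h5 : 0 < deg H (nb H S x) y := Finset.card_pos.2
    ⟨u, mem_nb.2 ⟨mem_nb.2 ⟨hu, (mem_nb.1 hx).2.symm⟩, (mem_nb.1 hy).2.symm⟩⟩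
  have h6 := card_le_five ht ((hI.far (nb_subset hx)).far hyx)
  omega

theorem exists_rep_eleven (ht : TriangleFree H) (hI : IndepLE H 4 S) (hS : S.card = 11)
    (he : edges H S ≤ 16) : ∃ g ∈ reps11, ∃ φ, Rep H φ g S := by
  obtain ⟨u, hu, hd⟩ : ∃ z ∈ S, deg H S z = 2 := by
    by_contra! hcon
    have := card_mul_le_of_le_deg (H := H) (S := S) (d := 3) fun v hv => by
      have h1 := card_far (H := H) hv
      have h3 := card_le_eight ht (hI.far hv)
      have := hcon v hv
      omega
    omega
  have hc := card_far (H := H) hu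
  obtain ⟨g, hg, φ, hφ⟩ := exists_rep_eight ht (hI.far hu) (by omega)
    (edges_far_le_eleven ht hI hS he hu hd)
  obtain ⟨c, -, hc'⟩ := exists_of_all2 stage_eleven hg
  exact hφ.stage ht hu hI hd he (by omega) hc'

theorem exists_rep_sixteen_of_deg_four (ht : TriangleFree H) (hI : IndepLE H 5 S)
    (hS : S.card = 16) (he : edges H S ≤ 33) (hv : v ∈ S) (hd : deg H S v = 4)
    (hf : edges H (far H S v) ≤ 16) : ∃ g ∈ reps16, ∃ φ, Rep H φ g S := by
  have hc := card_far (H := H) hv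
  obtain ⟨g, hg, φ, hφ⟩ := exists_rep_eleven ht (hI.far hv) (by omega) hf
  obtain ⟨c, -, hc'⟩ := exists_of_all2 stage_sixteen hg
  exact hφ.stage ht hv hI hd he (by omega) hc'

theorem exists_rep_seven (ht : TriangleFree H) (hI : IndepLE H 3 S) (hS : S.card = 7)
    (he : edges H S ≤ 6) : ∃ φ, Rep H φ [0, 1, 1, 2, 12, 0, 32] S := by
  obtain ⟨z, hz, hd⟩ : ∃ z ∈ S, deg H S z = 1 := by
    by_contra! hcon
    have := card_mul_le_of_le_deg (H := H) (S := S) (d := 2) fun v hv => by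
      have h1 := card_far (H := H) hv
      have h3 := card_le_five ht (hI.far hv)
      have := hcon v hv
      omega
    omega
  have hc := card_far (H := H) hz
  obtain ⟨φ, hφ⟩ := exists_rep_five ht (hI.far hz) (by omega)
  obtain ⟨g, hg, φ, h2⟩ := hφ.stage ht hz hI hd he (by omega) stage_seven
  rw [List.mem_singleton] at hg
  subst hg
  exact ⟨φ, h2⟩

theorem exists_rep_ten (ht : TriangleFree H) (hI : IndepLE H 4 S) (hS : S.card = 10)
    (he : edges H S ≤ 10) : ∃ φ, Rep H φ [0, 1, 1, 2, 12, 0, 32, 32, 64, 384] S := by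
  obtain ⟨u, hu⟩ := exists_mem_of_card (n := 9) hS.ge
  have hle : deg H S u ^ 2 + edges H (far H S u) ≤ 10 := by
    by_contra! hcon
    have h1 := Finset.sum_lt_sum (f := fun _ => 10)
      (fun v hv => (line_ten ht hI hS (v := v) hv).1) ⟨u, hu, hcon⟩
    rw [sum_sq_add_far ht, Finset.sum_const, hS, smul_eq_mul] at h1
    omega
  have hd := (line_ten ht hI hS hu).2 hle
  rw [hd] at hle
  have hc := card_far (H := H) hu
  obtain ⟨φ, hφ⟩ := exists_rep_seven ht (hI.far hu) (by omega) (by omega)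
  obtain ⟨g, hg, φ, h2⟩ := hφ.stage ht hu hI hd he (by omega) stage_ten
  rw [List.mem_singleton] at hg
  subst hg
  exact ⟨φ, h2⟩

/-- With at most ten edges, the graph far from `v` would be the one in `exists_rep_ten`, which has no
extension with a vertex of degree five and at most 33 edges. -/
theorem eleven_le_edges_far_of_deg_five (ht : TriangleFree H) (hI : IndepLE H 5 S)
    (hS : S.card = 16) (he : edges H S ≤ 33) (hv : v ∈ S) (hd : deg H S v = 5) :
    11 ≤ edges H (far H S v) := by
  by_contra! hcon
  have hc := card_far (H := H) hv
  obtain ⟨φ, hφ⟩ := exists_rep_ten ht (hI.far hv) (by omega) (by omega)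
  obtain ⟨g, hg, -⟩ := hφ.stage ht hv hI hd he (by omega) stage_sixteen'
  simp at hg

/-- The bound fails only if some vertex of degree four has at most fifteen edges far from it; then the
graph is in the list `reps16`, and has at least 32 edges after all. -/
theorem edges_sixteen (ht : TriangleFree H) (hI : IndepLE H 5 S) (hS : S.card = 16) :
    32 ≤ edges H S := by
  by_contra! hcon
  have hall : ∀ v ∈ S, deg H S v = 4 → 16 ≤ edges H (far H S v) := by
    intro v hv hd
    by_contra! hf
    obtain ⟨g, hg, φ, hφ⟩ := exists_rep_sixteen_of_deg_four ht hI hS (by omega) hv hd (by omega)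
    have h1 := List.all_eq_true.1 edgeCount_sixteen g hg
    rw [Nat.ble_eq] at h1
    have := hφ.edgeCount_le
    omega
  have := edges_of_line ht (S := S) (A := 3) (B := 20) fun v hv => by
    have hc := card_far (H := H) hv
    have hd := hI.deg_le ht (v := v)
    have hf := card_le_thirteen ht (hI.far hv)
    obtain h | h | h | h : deg H S v = 2 ∨ deg H S v = 3 ∨ deg H S v = 4 ∨ deg H S v = 5 := by omega
    · have := edges_thirteen ht (hI.far hv) (by omega)
      rw [h]
      push_cast
      omega
    · have := edges_twelve ht (hI.far hv) (by omega)
      rw [h]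
      push_cast
      omega
    · have := hall v hv h
      rw [h]
      push_cast
      omega
    · have := edges_ten ht (hI.far hv) (by omega)
      rw [h]
      push_cast
      omega
  rw [hS] at this
  omega

/-- If neither search applied, `4 d + 17 ≤ d ^ 2 + edges (far v)` would hold for the degree `d` of
every vertex `v`, up to one for `d = 5`. As at most six vertices have degree five, the sum over all
vertices would give at least 34 edges. -/
theorem exists_rep_sixteen (ht : TriangleFree H) (hI : IndepLE H 5 S) (hS : S.card = 16)
    (he : edges H S ≤ 33) (h5 : (S.filter fun x => deg H S x = 5).card ≤ 6) :
    ∃ g ∈ reps16, ∃ φ, Rep H φ g S := by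
  by_contra hcon
  have hall : ∀ v ∈ S, 4 * deg H S v + 17 ≤
      deg H S v ^ 2 + edges H (far H S v) + if deg H S v = 5 then 1 else 0 := by
    intro v hv
    have hc := card_far (H := H) hv
    have hd := hI.deg_le ht (v := v)
    have hf := card_le_thirteen ht (hI.far hv)
    obtain h | h | h | h : deg H S v = 2 ∨ deg H S v = 3 ∨ deg H S v = 4 ∨ deg H S v = 5 := by omega
    · have := edges_thirteen ht (hI.far hv) (by omega)
      rw [h]
      norm_num
      omega
    · have := edges_twelve ht (hI.far hv) (by omega)
      rw [h]
      norm_num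
      omega
    · have : 17 ≤ edges H (far H S v) := by
        by_contra! hf
        exact hcon (exists_rep_sixteen_of_deg_four ht hI hS he hv h (by omega))
      rw [h]
      norm_num
      omega
    · have := eleven_le_edges_far_of_deg_five ht hI hS he hv h
      rw [h]
      norm_num
      omega
  have h1 := Finset.sum_le_sum hall
  rw [Finset.sum_add_distrib, Finset.sum_add_distrib, sum_sq_add_far ht, ← Finset.mul_sum,
    ← two_mul_edges, Finset.sum_const, hS, ← Finset.card_filter, smul_eq_mul] at h1
  omega

/-- A vertex of degree five in the graph far from `v` has exactly one neighbour in common with `v`, as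
otherwise the independent set of the neighbours of `v` could be enlarged; and no two such vertices share
it, as otherwise they could replace it there. -/
theorem card_deg_five_le (ht : TriangleFree H) (hI : IndepLE H 6 S) (hd : deg H S v = 6) :
    ((far H S v).filter fun x => deg H (far H S v) x = 5).card ≤ 6 := by
  have hone : ∀ p ∈ far H S v, deg H (far H S v) p = 5 → ∃ x, nb H (nb H S v) p = {x} := by
    intro p hp hp5
    have h1 := deg_eq_add p hp
    have h2 := hI.deg_le ht (v := p)
    refine Finset.card_eq_one.1 (le_antisymm ?_ ?_)
    · change deg H (nb H S v) p ≤ 1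
      omega
    · by_contra! hlt
      have h0 : nb H (nb H S v) p = ∅ := Finset.card_eq_zero.1 (by omega)
      have hpn : p ∉ nb H S v := fun h => Finset.disjoint_left.1 disjoint_nb_far h hp
      have := hI (insert p (nb H S v)) (by
        intro x hx
        rcases Finset.mem_insert.1 hx with rfl | hx
        · exact far_subset hp
        · exact nb_subset hx) (ht.indep_nb.insert_of fun x hx h => by
          have : x ∈ nb H (nb H S v) p := mem_nb.2 ⟨hx, h⟩
          simp [h0] at this)
      rw [Finset.card_insert_of_notMem hpn] at this
      change deg H S v + 1 ≤ 6 at this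
      omega
  have hmaps : ∀ p ∈ (far H S v).filter fun x => deg H (far H S v) x = 5,
      ∃ x ∈ nb H S v, nb H (nb H S v) p = {x} := by
    intro p hp
    obtain ⟨hp, hp5⟩ := Finset.mem_filter.1 hp
    obtain ⟨x, hx⟩ := hone p hp hp5
    have : x ∈ nb H (nb H S v) p := by simp [hx]
    exact ⟨x, nb_subset this, hx⟩
  choose! f hf hfn using hmaps
  change deg H S v = 6 at hd
  rw [← hd]
  refine Finset.card_le_card_of_injOn f hf fun p hp q hq hpq => ?_
  by_contra hne
  have hpf := (Finset.mem_filter.1 hp).1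
  have hqf := (Finset.mem_filter.1 hq).1
  have hpn : p ∉ nb H S v := fun h => Finset.disjoint_left.1 disjoint_nb_far h hpf
  have hqn : q ∉ nb H S v := fun h => Finset.disjoint_left.1 disjoint_nb_far h hqf
  have hpa : H.Adj p (f p) := by
    have : f p ∈ nb H (nb H S v) p := by rw [hfn p hp]; simp
    exact (mem_nb.1 this).2
  have hqa : H.Adj q (f p) := by
    have : f q ∈ nb H (nb H S v) q := by rw [hfn q hq]; simp
    rw [hpq]
    exact (mem_nb.1 this).2
  have hindep : Indep H (insert p (insert q ((nb H S v).erase (f p)))) := by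
    refine ((ht.indep_nb.mono (Finset.erase_subset _ _)).insert_of fun x hx h => ?_).insert_of
      fun x hx h => ?_
    · have : x ∈ nb H (nb H S v) q := mem_nb.2 ⟨Finset.mem_of_mem_erase hx, h⟩
      rw [hfn q hq, Finset.mem_singleton, ← hpq] at this
      exact Finset.ne_of_mem_erase hx this
    · rcases Finset.mem_insert.1 hx with rfl | hx
      · exact ht p x (f p) h hqa hpa
      · have : x ∈ nb H (nb H S v) p := mem_nb.2 ⟨Finset.mem_of_mem_erase hx, h⟩
        rw [hfn p hp, Finset.mem_singleton] at this
        exact Finset.ne_of_mem_erase hx this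
  have := hI _ (by
    intro x hx
    simp only [Finset.mem_insert] at hx
    rcases hx with rfl | rfl | hx
    · exact far_subset hpf
    · exact far_subset hqf
    · exact nb_subset (Finset.mem_of_mem_erase hx)) hindep
  rw [Finset.card_insert_of_notMem, Finset.card_insert_of_notMem,
    Finset.card_erase_of_mem (hf p hp)] at this
  · change deg H S v - 1 + 1 + 1 ≤ 6 at this
    omega
  · exact fun h => hqn (Finset.mem_of_mem_erase h)
  · rw [Finset.mem_insert, not_or]
    exact ⟨hne, fun h => hpn (Finset.mem_of_mem_erase h)⟩

/-- The Ramsey bound `R(3, 7) ≤ 23`. -/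
theorem card_le_twentyTwo (ht : TriangleFree H) (hI : IndepLE H 6 S) : S.card ≤ 22 := by
  by_contra! hlt
  obtain ⟨S', hS', h23⟩ := Finset.exists_subset_card_eq (show 23 ≤ S.card by omega)
  replace hI := hI.mono hS'
  clear hlt hS'
  generalize S' = S at *
  have hdeg : ∀ v ∈ S, 4 ≤ deg H S v ∧ deg H S v ≤ 6 := by
    intro v hv
    have h1 := card_far (H := H) hv
    have h2 := hI.deg_le ht (v := v)
    have h3 := card_le_eighteen ht (hI.far hv)
    omega
  have hline : ∀ v ∈ S, 23 * deg H S v + 13 * (if deg H S v < 6 then 1 else 0) ≤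
      2 * (deg H S v ^ 2 + edges H (far H S v)) + 2 := by
    intro v hv
    have hc := card_far (H := H) hv
    have hd := hdeg v hv
    obtain h | h | h : deg H S v = 4 ∨ deg H S v = 5 ∨ deg H S v = 6 := by omega
    · have := edges_eighteen ht (hI.far hv) (by omega)
      rw [h]
      norm_num
      omega
    · have := edges_seventeen ht (hI.far hv) (by omega)
      rw [h]
      norm_num
      omega
    · have := edges_sixteen ht (hI.far hv) (by omega)
      rw [h]
      norm_num
      omega
  -- Summing the previous bound over all vertices leaves at most three vertices of degree below six.
  set B := S.filter fun v => deg H S v < 6 with hB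
  have hBcard : B.card ≤ 3 := by
    have h1 := Finset.sum_le_sum hline
    rw [Finset.sum_add_distrib, Finset.sum_add_distrib, ← Finset.mul_sum, ← Finset.mul_sum,
      ← Finset.mul_sum, sum_sq_add_far ht, ← two_mul_edges, Finset.sum_const, h23,
      ← Finset.card_filter, smul_eq_mul, ← hB] at h1
    omega
  obtain ⟨v, hv, hvB⟩ : ∃ v ∈ S, v ∉ B ∪ B.biUnion (nb H S) := by
    by_contra! hcon
    have h1 := Finset.card_le_card hcon
    have h2 : (B.biUnion (nb H S)).card ≤ B.card * 5 :=
      Finset.card_biUnion_le_card_mul _ _ _ fun b hb => by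
        have := (Finset.mem_filter.1 hb).2
        change deg H S b ≤ 5
        omega
    have h3 := Finset.card_union_le B (B.biUnion (nb H S))
    omega
  rw [Finset.mem_union, not_or, Finset.mem_biUnion] at hvB
  have hd : deg H S v = 6 := by
    have := hdeg v hv
    have h : ¬ deg H S v < 6 := fun h => hvB.1 (Finset.mem_filter.2 ⟨hv, h⟩)
    omega
  have hdn : ∀ u ∈ nb H S v, deg H S u = 6 := by
    intro u hu
    have := hdeg u (nb_subset hu)
    have h : ¬ deg H S u < 6 := fun h => hvB.2
      ⟨u, Finset.mem_filter.2 ⟨nb_subset hu, h⟩, mem_nb.2 ⟨hv, (mem_nb.1 hu).2.symm⟩⟩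
    omega
  have hc := card_far (H := H) hv
  have he := edges_eq_far ht hv
  rw [Finset.sum_congr rfl hdn, Finset.sum_const, smul_eq_mul, ← deg, hd] at he
  have he' := le_card_mul_of_deg_le fun v hv => (hdeg v hv).2
  obtain ⟨g, hg, φ, hφ⟩ := exists_rep_sixteen ht (hI.far hv) (by omega) (by omega)
    (card_deg_five_le ht hI hd)
  have h1 := List.all_eq_true.1 not_glue_sixteen g hg
  rw [hφ.not_noGlue ht hI hv h23 hd hdn] at h1
  simp at h1

end

section

open Classical

variable {V : Type*} {H : SimpleGraph V} {S A B : Finset V} {σ τ : V → V} {r : ℕ} {u v x y t : V}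

/-! ### Clique covers and pairings -/

/-- `S` is covered by `r` cliques of `H`, given as the colour classes of `c`. -/
def Cover (H : SimpleGraph V) (S : Finset V) (r : ℕ) : Prop :=
  ∃ c : V → ℕ, (∀ x ∈ S, c x < r) ∧ ∀ x ∈ S, ∀ y ∈ S, x ≠ y → c x = c y → H.Adj x y

/-- A matching of `H` inside `S`, as an involution whose fixed points are the unmatched vertices. -/
structure IsPairing (H : SimpleGraph V) (S : Finset V) (σ : V → V) : Prop where
  mem : ∀ x ∈ S, σ x ∈ S
  invol : ∀ x ∈ S, σ (σ x) = x
  adj : ∀ x ∈ S, σ x ≠ x → H.Adj x (σ x)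

/-- The number of vertices of `S` left unmatched by `σ`. -/
noncomputable def fixCount (S : Finset V) (σ : V → V) : ℕ := (S.filter fun x => σ x = x).card

theorem Cover.mono {r' : ℕ} (h : Cover H S r) (hr : r ≤ r') : Cover H S r' := by
  obtain ⟨c, h1, h2⟩ := h
  exact ⟨c, fun x hx => (h1 x hx).trans_le hr, h2⟩

/-- Vertices with distinct images in a set of at most `r` labels can be coloured by these. -/
theorem Cover.of_labels {β : Type*} (f : V → β) {P : Finset β} (hf : ∀ x ∈ S, f x ∈ P)
    (hP : P.card ≤ r) (h : ∀ x ∈ S, ∀ y ∈ S, x ≠ y → f x = f y → H.Adj x y) : Cover H S r := by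
  refine ⟨fun x => if hx : f x ∈ P then (P.equivFin ⟨f x, hx⟩ : ℕ) else 0, ?_, ?_⟩
  · intro x hx
    beta_reduce
    rw [dif_pos (hf x hx)]
    exact (P.equivFin ⟨f x, hf x hx⟩).2.trans_le hP
  · intro x hx y hy hxy hc
    refine h x hx y hy hxy ?_
    simp only [dif_pos (hf x hx), dif_pos (hf y hy)] at hc
    simpa using P.equivFin.injective (Fin.ext hc)

theorem Cover.of_card_le (h : S.card ≤ r) : Cover H S r :=
  Cover.of_labels id (fun _ hx => hx) h fun _ _ _ _ hxy h => absurd h hxy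

theorem Cover.card_le {T : Finset V} (h : Cover H S r) (hT : T ⊆ S) (hI : Indep H T) :
    T.card ≤ r := by
  obtain ⟨c, h1, h2⟩ := h
  have := Finset.card_le_card_of_injOn (s := T) (t := Finset.range r) c
    (fun x hx => Finset.mem_coe.2 (Finset.mem_range.2 (h1 x (hT hx))))
    (fun x hx y hy hc => by
      by_contra hne
      exact hI x hx y hy (h2 x (hT hx) y (hT hy) hne hc))
  simpa using this

theorem Cover.union {r' : ℕ} (hA : Cover H A r) (hB : Cover H B r') : Cover H (A ∪ B) (r + r') := by
  obtain ⟨c, h1, h2⟩ := hA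
  obtain ⟨d, h3, h4⟩ := hB
  refine ⟨fun x => if x ∈ A then c x else r + d x, ?_, ?_⟩
  · intro x hx
    beta_reduce
    split_ifs with h
    · exact (h1 x h).trans_le (Nat.le_add_right _ _)
    · exact Nat.add_lt_add_left (h3 x ((Finset.mem_union.1 hx).resolve_left h)) r
  · intro x hx y hy hxy hc
    beta_reduce at hc
    split_ifs at hc with hxA hyA hyA
    · exact h2 x hxA y hyA hxy hc
    · have := h1 x hxA
      omega
    · have := h1 y hyA
      omega
    · exact h4 x ((Finset.mem_union.1 hx).resolve_left hxA) y
        ((Finset.mem_union.1 hy).resolve_left hyA) hxy (by omega)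

theorem Cover.of_clique (h : ∀ x ∈ S, ∀ y ∈ S, x ≠ y → H.Adj x y) : Cover H S 1 :=
  ⟨fun _ => 0, fun _ _ => one_pos, fun x hx y hy hxy _ => h x hx y hy hxy⟩

theorem card_add_fixCount : S.card + fixCount S σ = ∑ x ∈ S, (1 + if σ x = x then 1 else 0) := by
  rw [Finset.sum_add_distrib, fixCount, Finset.card_filter, Finset.card_eq_sum_ones]

/-- The pairs and the unmatched vertices together number half of `S.card + fixCount S σ`. -/
theorem IsPairing.two_mul_card_image (h : IsPairing H S σ) :
    2 * (S.image fun x => ({x, σ x} : Finset V)).card = S.card + fixCount S σ := by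
  rw [card_add_fixCount, ← Finset.sum_fiberwise_of_maps_to (t := S.image fun x => {x, σ x})
    (g := fun x => ({x, σ x} : Finset V)) fun x hx => Finset.mem_image_of_mem _ hx,
    Finset.sum_const_nat (m := 2), mul_comm]
  intro p hp
  obtain ⟨x, hx, rfl⟩ := Finset.mem_image.1 hp
  have e : (S.filter fun y => ({y, σ y} : Finset V) = {x, σ x}) = {x, σ x} := by
    ext y
    rw [Finset.mem_filter, Finset.mem_insert, Finset.mem_singleton]
    constructor
    · rintro ⟨-, hy⟩
      have : y ∈ ({y, σ y} : Finset V) := Finset.mem_insert_self _ _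
      rw [hy] at this
      simpa using this
    · rintro (rfl | rfl)
      · exact ⟨hx, rfl⟩
      · exact ⟨h.mem x hx, by rw [h.invol x hx, Finset.pair_comm]⟩
  rw [e]
  by_cases hfix : σ x = x
  · simp [hfix]
  · rw [Finset.sum_pair (Ne.symm hfix), h.invol x hx, if_neg hfix, if_neg (Ne.symm hfix)]

theorem IsPairing.cover (h : IsPairing H S σ) (hr : S.card + fixCount S σ ≤ 2 * r) :
    Cover H S r := by
  rw [← h.two_mul_card_image] at hr
  refine Cover.of_labels (fun x => ({x, σ x} : Finset V))
    (fun x hx => Finset.mem_image_of_mem _ hx) (by omega) fun x hx y hy hxy hc => ?_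
  have : y ∈ ({y, σ y} : Finset V) := Finset.mem_insert_self _ _
  rw [← hc, Finset.mem_insert, Finset.mem_singleton] at this
  obtain rfl : y = σ x := this.resolve_left hxy.symm
  exact h.adj x hx hxy.symm

theorem Cover.exists_isPairing (h : Cover H S r)
    (ht : ∀ x ∈ S, ∀ y ∈ S, ∀ z ∈ S, H.Adj x y → H.Adj y z → ¬ H.Adj x z) :
    ∃ σ, IsPairing H S σ ∧ S.card + fixCount S σ ≤ 2 * r := by
  obtain ⟨c, h1, h2⟩ := h
  have key : ∀ x ∈ S, ∃ x' ∈ S, (x' ≠ x → c x' = c x) ∧ (x' = x → ∀ y ∈ S, c y = c x → y = x) := by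
    intro x hx
    by_cases hy : ∃ y ∈ S, y ≠ x ∧ c y = c x
    · obtain ⟨y, hy, hyx, hc⟩ := hy
      exact ⟨y, hy, fun _ => hc, fun h => absurd h hyx⟩
    · push Not at hy
      exact ⟨x, hx, fun h => absurd rfl h, fun _ y hyS hc => by
        by_contra hne
        exact hy y hyS hne hc⟩
  choose! σ hσ hσ1 hσ2 using key
  have hc : ∀ x ∈ S, c (σ x) = c x := by
    intro x hx
    by_cases h : σ x = x
    · rw [h]
    · exact hσ1 x hx h
  have huniq : ∀ x ∈ S, ∀ y ∈ S, y ≠ x → c y = c x → y = σ x := by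
    intro x hx y hy hyx hcy
    by_contra hne
    have hsx : σ x ≠ x := fun h => hyx (hσ2 x hx h y hy hcy)
    have h3 := h2 x hx y hy hyx.symm hcy.symm
    have h4 := h2 y hy (σ x) (hσ x hx) hne (by rw [hc x hx, hcy])
    exact ht x hx y hy (σ x) (hσ x hx) h3 h4 (h2 x hx _ (hσ x hx) hsx.symm (hc x hx).symm)
  refine ⟨σ, ⟨hσ, ?_, ?_⟩, ?_⟩
  · intro x hx
    by_cases h : σ x = x
    · rw [h, h]
    · exact (huniq _ (hσ x hx) x hx (Ne.symm h) (hc x hx).symm).symm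
  · intro x hx h
    exact h2 x hx _ (hσ x hx) h.symm (hc x hx).symm
  · rw [card_add_fixCount, ← Finset.sum_fiberwise_of_maps_to (t := Finset.range r) (g := c)
      fun x hx => Finset.mem_range.2 (h1 x hx)]
    refine (Finset.sum_le_card_nsmul _ _ 2 fun i _ => ?_).trans (by simp [mul_comm])
    rcases (S.filter fun x => c x = i).eq_empty_or_nonempty with h | ⟨x, hx⟩
    · simp [h]
    · obtain ⟨hxS, rfl⟩ := Finset.mem_filter.1 hx
      have hsub : (S.filter fun y => c y = c x) ⊆ {x, σ x} := by
        intro y hy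
        obtain ⟨hyS, hyc⟩ := Finset.mem_filter.1 hy
        rw [Finset.mem_insert, Finset.mem_singleton]
        by_cases hyx : y = x
        · exact Or.inl hyx
        · exact Or.inr (huniq x hxS y hyS hyx hyc)
      refine (Finset.sum_le_sum_of_subset hsub).trans ?_
      by_cases hfix : σ x = x
      · simp [hfix]
      · have h5 : σ (σ x) = x :=
          (huniq _ (hσ x hxS) x hxS (Ne.symm hfix) (hc x hxS).symm).symm
        rw [Finset.sum_pair (Ne.symm hfix), h5, if_neg hfix, if_neg (Ne.symm hfix)]

/-! ### Gallai's lemma -/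

theorem IsPairing.comp_swap (h : IsPairing H S σ) (hx : x ∈ S) (hy : y ∈ S)
    (hxy : (σ x = x ∧ σ y = y ∧ H.Adj x y) ∨ σ x = y) :
    IsPairing H S (σ ∘ Equiv.swap x y) := by
  have hinj : ∀ a ∈ S, ∀ b ∈ S, σ a = b → a = σ b := fun a ha b _ hab => by
    rw [← hab, h.invol a ha]
  have hrec : ∀ a ∈ S, a ≠ x → a ≠ y → σ a ≠ x ∧ σ a ≠ y := by
    intro a ha hax hay
    rcases hxy with ⟨h1, h2, -⟩ | h1
    · exact ⟨fun h => hax ((hinj a ha x hx h).trans h1), fun h => hay ((hinj a ha y hy h).trans h2)⟩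
    · exact ⟨fun h => hay ((hinj a ha x hx h).trans h1),
        fun h => hax ((hinj a ha y hy h).trans (hinj x hx y hy h1).symm)⟩
  have hx' : (σ ∘ Equiv.swap x y) x = σ y := by simp
  have hy' : (σ ∘ Equiv.swap x y) y = σ x := by simp
  have ho : ∀ a, a ≠ x → a ≠ y → (σ ∘ Equiv.swap x y) a = σ a := fun a hax hay => by
    simp [Equiv.swap_apply_of_ne_of_ne hax hay]
  have key : ∀ a ∈ S, (σ ∘ Equiv.swap x y) a ∈ S ∧
      (σ ∘ Equiv.swap x y) ((σ ∘ Equiv.swap x y) a) = a ∧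
      ((σ ∘ Equiv.swap x y) a ≠ a → H.Adj a ((σ ∘ Equiv.swap x y) a)) := by
    intro a ha
    by_cases hax : a = x
    · subst hax
      rw [hx']
      rcases hxy with ⟨h1, h2, h3⟩ | h1
      · rw [h2, hy']
        exact ⟨hy, h1, fun _ => h3⟩
      · rw [← hinj a hx y hy h1, hx', ← hinj a hx y hy h1]
        exact ⟨hx, rfl, fun h => absurd rfl h⟩
    by_cases hay : a = y
    · subst hay
      rw [hy']
      rcases hxy with ⟨h1, h2, h3⟩ | h1
      · rw [h1, hx']
        exact ⟨hx, h2, fun _ => h3.symm⟩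
      · rw [h1, hy', h1]
        exact ⟨hy, rfl, fun h => absurd rfl h⟩
    rw [ho a hax hay, ho _ (hrec a ha hax hay).1 (hrec a ha hax hay).2]
    exact ⟨h.mem a ha, h.invol a ha, h.adj a ha⟩
  exact ⟨fun a ha => (key a ha).1, fun a ha => (key a ha).2.1, fun a ha => (key a ha).2.2⟩

theorem fixCount_comp_swap (hx : x ∈ S) (hy : y ∈ S) (hxy : x ≠ y) (h1 : σ x = x) (h2 : σ y = y) :
    fixCount S σ = fixCount S (σ ∘ Equiv.swap x y) + 2 := by
  have e : (S.filter fun a => σ a = a) =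
      insert x (insert y (S.filter fun a => (σ ∘ Equiv.swap x y) a = a)) := by
    ext a
    simp only [Finset.mem_insert, Finset.mem_filter, Function.comp_apply]
    by_cases hax : a = x
    · simp [hax, hx, h1]
    by_cases hay : a = y
    · simp [hay, hy, h2]
    rw [Equiv.swap_apply_of_ne_of_ne hax hay]
    simp [hax, hay]
  rw [fixCount, e, Finset.card_insert_of_notMem, Finset.card_insert_of_notMem]
  · rfl
  · simp [h1, hxy]
  · simp [h2, hxy, hxy.symm]

/-- Gallai's lemma. Suppose that every vertex is left unmatched by some maximum matching. If no
maximum matching leaves both `u` and `t` unmatched, and none both `t` and `v`, then none leaves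
both `u` and `v` unmatched: otherwise, for such a matching `σ` and a maximum matching `τ` leaving
`t` unmatched that agrees with `σ` as much as possible, a vertex `x ≠ t` unmatched by `τ` only can
be matched in `τ` to `σ x` in place of the partner of `σ x`. -/
theorem gallai {n : ℕ} (hmin : ∀ σ, IsPairing H S σ → n ≤ fixCount S σ)
    (hcrit : ∀ v ∈ S, ∃ σ, IsPairing H S σ ∧ fixCount S σ = n ∧ σ v = v)
    (hu : u ∈ S) (ht : t ∈ S) (hv : v ∈ S) (huv : u ≠ v)
    (hut : ∀ σ, IsPairing H S σ → fixCount S σ = n → σ u = u → σ t ≠ t)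
    (htv : ∀ σ, IsPairing H S σ → fixCount S σ = n → σ t = t → σ v ≠ v)
    (hσ : IsPairing H S σ) (hσn : fixCount S σ = n) (hσu : σ u = u) : σ v ≠ v := by
  intro hσv
  have hσt := hut σ hσ hσn hσu
  have key : ∀ k τ, IsPairing H S τ → fixCount S τ = n → τ t = t →
      S.card ≤ (S.filter fun a => σ a = τ a).card + k → False := by
    intro k
    induction k with
    | zero =>
      intro τ _ _ hτt hk
      have := Finset.eq_of_subset_of_card_le (Finset.filter_subset (fun a => σ a = τ a) S) hk
      rw [← this, Finset.mem_filter] at ht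
      exact hσt (ht.2.trans hτt)
    | succ k ih =>
      intro τ hτ hτn hτt hk
      have hτu : τ u ≠ u := fun h => hut τ hτ hτn h hτt
      have hτv := htv τ hτ hτn hτt
      obtain ⟨x, hxS, hxt, hτx, hσx⟩ : ∃ x ∈ S, x ≠ t ∧ τ x = x ∧ σ x ≠ x := by
        by_contra! hcon
        have hsub : (S.filter fun a => τ a = a) ⊆
            insert t (((S.filter fun a => σ a = a).erase u).erase v) := by
          intro a ha
          obtain ⟨haS, hτa⟩ := Finset.mem_filter.1 ha
          rw [Finset.mem_insert]
          by_cases hat : a = t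
          · exact Or.inl hat
          · refine Or.inr (Finset.mem_erase.2 ⟨?_, Finset.mem_erase.2 ⟨?_, Finset.mem_filter.2
              ⟨haS, hcon a haS hat hτa⟩⟩⟩)
            · rintro rfl
              exact hτv hτa
            · rintro rfl
              exact hτu hτa
        have h1 := (Finset.card_le_card hsub).trans (Finset.card_insert_le _ _)
        have h2 : v ∈ (S.filter fun a => σ a = a).erase u :=
          Finset.mem_erase.2 ⟨huv.symm, Finset.mem_filter.2 ⟨hv, hσv⟩⟩
        have h3 : u ∈ S.filter fun a => σ a = a := Finset.mem_filter.2 ⟨hu, hσu⟩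
        unfold fixCount at hτn hσn
        rw [← Finset.card_erase_add_one h3, ← Finset.card_erase_add_one h2] at hσn
        omega
      have hyS := hσ.mem x hxS
      have hadj := hσ.adj x hxS hσx
      have hσy := hσ.invol x hxS
      set y := σ x with hy
      have hτy : τ y ≠ y := by
        intro hτy
        have h1 := hmin _ (hτ.comp_swap hxS hyS (Or.inl ⟨hτx, hτy, hadj⟩))
        have h2 := fixCount_comp_swap hxS hyS (Ne.symm hσx) hτx hτy
        omega
      have hzS := hτ.mem y hyS
      have hτz := hτ.invol y hyS
      set z := τ y with hz
      have hzx : z ≠ x := by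
        intro h
        rw [h, hτx] at hτz
        exact hσx hτz.symm
      have hyx : y ≠ x := hσx
      have ht1 : t ≠ y := fun h => hτy (by rw [hz, ← h, hτt])
      have ht2 : t ≠ z := fun h => hτy (by rw [← h, hτt] at hτz; rw [← h, hτz])
      -- unmatch `y` and `z`, then match `x` and `y`
      set τ₁ := τ ∘ Equiv.swap y z with hτ₁
      have h1 : IsPairing H S τ₁ := hτ.comp_swap hyS hzS (Or.inr hz.symm)
      have h1y : τ₁ y = y := by simp [hτ₁, hτz]
      have h1z : τ₁ z = z := by simp [hτ₁, ← hz]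
      have h1x : τ₁ x = x := by
        simp [hτ₁, Equiv.swap_apply_of_ne_of_ne hyx.symm hzx.symm, hτx]
      have h1t : τ₁ t = t := by
        simp [hτ₁, Equiv.swap_apply_of_ne_of_ne ht1 ht2, hτt]
      have h1n := fixCount_comp_swap hyS hzS hτy.symm h1y h1z
      have e : τ₁ ∘ Equiv.swap y z = τ := by
        funext a
        simp [hτ₁]
      rw [e] at h1n
      have h2n := fixCount_comp_swap hxS hyS hyx.symm h1x h1y
      refine ih (τ₁ ∘ Equiv.swap x y) (h1.comp_swap hxS hyS (Or.inl ⟨h1x, h1y, hadj⟩)) (by omega)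
        (by simp [Equiv.swap_apply_of_ne_of_ne hxt.symm ht1, h1t]) ?_
      have hlt : (S.filter fun a => σ a = τ a).card <
          (S.filter fun a => σ a = (τ₁ ∘ Equiv.swap x y) a).card := by
        refine Finset.card_lt_card ⟨?_, fun hsub => ?_⟩
        · intro a ha
          obtain ⟨haS, ha⟩ := Finset.mem_filter.1 ha
          refine Finset.mem_filter.2 ⟨haS, ?_⟩
          have hax : a ≠ x := by
            rintro rfl
            exact hσx (ha.trans hτx)
          have hay : a ≠ y := by
            rintro rfl
            rw [hσy] at ha
            exact hzx ha.symm
          have haz : a ≠ z := by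
            rintro rfl
            rw [hτz] at ha
            have h3 := hσ.invol z hzS
            rw [ha, hσy] at h3
            exact hzx h3.symm
          simp [hτ₁, Equiv.swap_apply_of_ne_of_ne hax hay, Equiv.swap_apply_of_ne_of_ne hay haz, ha]
        · have hx2 : x ∈ S.filter fun a => σ a = (τ₁ ∘ Equiv.swap x y) a :=
            Finset.mem_filter.2 ⟨hxS, by simp [h1y, ← hy]⟩
          have := (Finset.mem_filter.1 (hsub hx2)).2
          exact hσx (this.trans hτx)
      omega
  obtain ⟨τ, hτ, hτn, hτt⟩ := hcrit t ht
  exact key S.card τ hτ hτn hτt (Nat.le_add_left _ _)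

end

/-! ### The lower bound -/

section

open Classical

variable {V : Type*} {H : SimpleGraph V} {S A B : Finset V} {r j : ℕ}

/-- The Ramsey bounds `R(3, s + 1) ≤ 4 s - 1` for `1 ≤ s ≤ 6`, for a graph that is triangle-free
on `S`. -/
theorem card_lt_of_indepLE {s : ℕ} (h1 : 1 ≤ s) (h6 : s ≤ 6)
    (ht : ∀ x ∈ S, ∀ y ∈ S, ∀ z ∈ S, H.Adj x y → H.Adj y z → ¬ H.Adj x z)
    (hI : IndepLE H s S) : S.card < 4 * s - 1 := by
  let K : SimpleGraph V :=
    { Adj := fun x y => H.Adj x y ∧ x ∈ S ∧ y ∈ S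
      symm := ⟨fun _ _ h => ⟨h.1.symm, h.2.2, h.2.1⟩⟩
      loopless := ⟨fun _ h => H.irrefl h.1⟩ }
  have hK : TriangleFree K := fun x y z hxy hyz hxz =>
    ht x hxy.2.1 y hxy.2.2 z hyz.2.2 hxy.1 hyz.1 hxz.1
  have hKI : IndepLE K s S := fun T hT hTI => hI T hT fun x hx y hy h =>
    hTI x hx y hy ⟨h, hT hx, hT hy⟩
  interval_cases s
  · have := card_le_two hK hKI; omega
  · have := card_le_five hK hKI; omega
  · have := card_le_eight hK hKI; omega
  · have := card_le_thirteen hK hKI; omega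
  · have := card_le_eighteen hK hKI; omega
  · have := card_le_twentyTwo hK hKI; omega

theorem indep_singleton (v : V) : Indep H {v} := by
  intro x hx y hy
  rw [Finset.mem_singleton] at hx hy
  rw [hx, hy]
  exact H.irrefl

theorem exists_cover_number (hA : A.Nonempty) : ∃ r, ¬ Cover H A r ∧ Cover H A (r + 1) := by
  have hex : ∃ r, Cover H A r := ⟨_, Cover.of_card_le le_rfl⟩
  have h0 : ¬ Cover H A 0 := by
    rintro ⟨c, h, -⟩
    obtain ⟨x, hx⟩ := hA
    exact absurd (h x hx) (Nat.not_lt_zero _)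
  have hpos : 0 < Nat.find hex := by
    rw [Nat.find_pos]
    exact h0
  refine ⟨Nat.find hex - 1, Nat.find_min hex (by omega), ?_⟩
  rw [Nat.sub_add_cancel hpos]
  exact Nat.find_spec hex

theorem exists_indep_number (H : SimpleGraph V) (A : Finset V) :
    ∃ T ⊆ A, Indep H T ∧ IndepLE H T.card A := by
  obtain ⟨T, hT, hmax⟩ := (A.powerset.filter (Indep H)).exists_max_image Finset.card
    ⟨∅, by simp [Indep]⟩
  simp only [Finset.mem_filter, Finset.mem_powerset] at hT hmax
  exact ⟨T, hT.1, hT.2, fun U hU hI => hmax U ⟨hU, hI⟩⟩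

/-- The lower bound for the number of vertices, passed to the complement: if `S` cannot be covered
by `r` cliques of `H` while every independent set of `H` inside `S` has at most `r + 1 - j`
vertices, and `j ≤ 6`, then `S` has at least `r + 1 + 2 j` vertices. -/
theorem le_card_of_not_cover (S : Finset V) : ∀ r j : ℕ, j ≤ 6 → ¬ Cover H S r →
    (∀ T ⊆ S, Indep H T → T.card + j ≤ r + 1) → r + 1 + 2 * j ≤ S.card := by
  induction S using Finset.strongInduction with
  | H S ih =>
  intro r j hj hS hI
  have hrS : r + 1 ≤ S.card := by
    by_contra! hcon
    exact hS (Cover.of_card_le (by omega))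
  rcases Nat.eq_zero_or_pos j with rfl | hjpos
  · omega
  obtain ⟨u, hu⟩ := exists_mem_of_card hrS
  have hr : j ≤ r := by
    have := hI {u} (by simpa using hu) (indep_singleton u)
    rw [Finset.card_singleton] at this
    omega
  by_cases hdel : ∃ v ∈ S, ¬ Cover H (S.erase v) r
  · obtain ⟨v, hv, hvS⟩ := hdel
    have := ih _ (Finset.erase_ssubset hv) r j hj hvS fun T hT =>
      hI T (hT.trans (Finset.erase_subset v S))
    exact this.trans (Finset.card_le_card (Finset.erase_subset v S))
  push Not at hdel
  by_cases ht : ∀ x ∈ S, ∀ y ∈ S, ∀ z ∈ S, H.Adj x y → H.Adj y z → ¬ H.Adj x z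
  swap
  · push Not at ht
    obtain ⟨x, hx, y, hy, z, hz, hxy, hyz, hxz⟩ := ht
    have hsub : ({x, y, z} : Finset V) ⊆ S := by
      intro a ha
      simp only [Finset.mem_insert, Finset.mem_singleton] at ha
      rcases ha with rfl | rfl | rfl <;> assumption
    have hcard : ({x, y, z} : Finset V).card = 3 :=
      Finset.card_eq_three.2 ⟨x, y, z, hxy.ne, hxz.ne, hyz.ne, rfl⟩
    have hcl : Cover H {x, y, z} 1 := Cover.of_clique fun a ha b hb hab => by
      simp only [Finset.mem_insert, Finset.mem_singleton] at ha hb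
      rcases ha with rfl | rfl | rfl <;> rcases hb with rfl | rfl | rfl <;>
        first | exact absurd rfl hab | assumption | (apply SimpleGraph.Adj.symm; assumption)
    have := ih (S \ {x, y, z}) (Finset.sdiff_ssubset hsub ⟨x, by simp⟩) (r - 1) (j - 1) (by omega)
      (fun h => hS (by
        have := h.union hcl
        rwa [Finset.sdiff_union_of_subset hsub, Nat.sub_add_cancel (by omega)] at this))
      (fun T hT hTI => by
        have := hI T (hT.trans Finset.sdiff_subset) hTI
        omega)
    rw [Finset.card_sdiff_of_subset hsub, hcard] at this
    have := Finset.card_le_card hsub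
    omega
  -- From here on `S` is critical and triangle-free, so optimal covers are maximum matchings.
  have hmin : ∀ σ, IsPairing H S σ → 2 * r + 2 - S.card ≤ fixCount S σ := by
    intro σ hσ
    by_contra! hcon
    have := hσ.two_mul_card_image
    exact hS (hσ.cover (by omega))
  have hcard : S.card ≤ 2 * r + 1 := by
    have h1 := Finset.card_erase_add_one hu
    obtain ⟨σ, hσ, hle⟩ := (hdel u hu).exists_isPairing fun x hx y hy z hz =>
      ht x (Finset.mem_of_mem_erase hx) y (Finset.mem_of_mem_erase hy) z (Finset.mem_of_mem_erase hz)
    omega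
  have hcrit : ∀ v ∈ S, ∃ σ, IsPairing H S σ ∧ fixCount S σ = 2 * r + 2 - S.card ∧ σ v = v := by
    intro v hv
    obtain ⟨σ, hσ, hle⟩ := (hdel v hv).exists_isPairing fun x hx y hy z hz =>
      ht x (Finset.mem_of_mem_erase hx) y (Finset.mem_of_mem_erase hy) z (Finset.mem_of_mem_erase hz)
    have hτ : ∀ x ∈ S, x ≠ v → Function.update σ v v x = σ x ∧ σ x ∈ S.erase v := fun x hx hxv =>
      ⟨Function.update_of_ne hxv _ _, hσ.mem x (Finset.mem_erase.2 ⟨hxv, hx⟩)⟩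
    have hτv : Function.update σ v v v = v := Function.update_self _ _ _
    have hpair : IsPairing H S (Function.update σ v v) := by
      refine ⟨fun x hx => ?_, fun x hx => ?_, fun x hx => ?_⟩ <;> by_cases hxv : x = v
      · rw [hxv, hτv]
        exact hv
      · rw [(hτ x hx hxv).1]
        exact Finset.mem_of_mem_erase (hτ x hx hxv).2
      · rw [hxv, hτv, hτv]
      · obtain ⟨h1, h2⟩ := Finset.mem_erase.1 (hτ x hx hxv).2
        rw [(hτ x hx hxv).1, (hτ _ h2 h1).1, hσ.invol x (Finset.mem_erase.2 ⟨hxv, hx⟩)]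
      · rw [hxv, hτv]
        exact fun h => absurd rfl h
      · rw [(hτ x hx hxv).1]
        exact hσ.adj x (Finset.mem_erase.2 ⟨hxv, hx⟩)
    refine ⟨_, hpair, le_antisymm ?_ (hmin _ hpair), hτv⟩
    have h1 := Finset.card_erase_add_one hv
    have h2 : fixCount S (Function.update σ v v) ≤ fixCount (S.erase v) σ + 1 := by
      refine (Finset.card_le_card (t := insert v ((S.erase v).filter fun x => σ x = x)) ?_).trans
        (Finset.card_insert_le _ _)
      intro x hx
      obtain ⟨hxS, hxf⟩ := Finset.mem_filter.1 hx
      rw [Finset.mem_insert]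
      by_cases hxv : x = v
      · exact Or.inl hxv
      · rw [(hτ x hxS hxv).1] at hxf
        exact Or.inr (Finset.mem_filter.2 ⟨Finset.mem_erase.2 ⟨hxv, hxS⟩, hxf⟩)
    omega
  set R : V → V → Prop := fun x y => ∀ σ, IsPairing H S σ →
    fixCount S σ = 2 * r + 2 - S.card → σ x = x → σ y ≠ y with hR
  have hsymm : ∀ x y, R x y → R y x := fun x y h σ h1 h2 h3 h4 => h σ h1 h2 h4 h3
  have htrans : ∀ x ∈ S, ∀ y ∈ S, ∀ z ∈ S, x ≠ z → R x y → R y z → R x z :=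
    fun x hx y hy z hz hxz hxy hyz σ h1 h2 h3 =>
      gallai hmin hcrit hx hy hz hxz hxy hyz h1 h2 h3
  have hadj : ∀ x ∈ S, ∀ y ∈ S, H.Adj x y → R x y := by
    intro x hx y hy hxy σ h1 h2 h3 h4
    have h5 := hmin _ (h1.comp_swap hx hy (Or.inl ⟨h3, h4, hxy⟩))
    have h6 := fixCount_comp_swap hx hy hxy.ne h3 h4
    omega
  set A := S.filter fun x => x = u ∨ R u x with hA
  by_cases hAS : A = S
  · -- A maximum matching leaves at most one vertex unmatched.
    have hall : ∀ x ∈ S, ∀ y ∈ S, x ≠ y → R x y := by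
      have hux : ∀ x ∈ S, x ≠ u → R u x := fun x hx hxu => by
        rw [← hAS] at hx
        exact (Finset.mem_filter.1 hx).2.resolve_left hxu
      intro x hx y hy hxy
      by_cases hxu : x = u
      · rw [hxu] at hxy ⊢
        exact hux y hy hxy.symm
      by_cases hyu : y = u
      · rw [hyu]
        exact hsymm _ _ (hux x hx hxu)
      exact htrans x hx u hu y hy hxy (hsymm _ _ (hux x hx hxu)) (hux y hy hyu)
    obtain ⟨σ, h1, h2, h3⟩ := hcrit u hu
    have h4 : fixCount S σ ≤ 1 := by
      refine Finset.card_le_one.2 fun x hx y hy => ?_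
      by_contra hxy
      obtain ⟨hxS, hx⟩ := Finset.mem_filter.1 hx
      obtain ⟨hyS, hy⟩ := Finset.mem_filter.1 hy
      exact hall x hxS y hyS hxy σ h1 h2 hx hy
    by_contra! hlt
    have h5 := card_lt_of_indepLE (s := r + 1 - j) (by omega) (by omega) ht fun T hT hTI => by
      have := hI T hT hTI
      omega
    omega
  · have hAsub : A ⊆ S := Finset.filter_subset _ _
    have huA : u ∈ A := Finset.mem_filter.2 ⟨hu, Or.inl rfl⟩
    have hBne : (S \ A).Nonempty := by
      rw [Finset.sdiff_nonempty]
      exact fun h => hAS (hAsub.antisymm h)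
    have hsep : ∀ x ∈ A, ∀ y ∈ S \ A, ¬ H.Adj x y := by
      intro x hx y hy hxy
      obtain ⟨hyS, hyA⟩ := Finset.mem_sdiff.1 hy
      obtain ⟨hxS, hx⟩ := Finset.mem_filter.1 hx
      refine hyA (Finset.mem_filter.2 ⟨hyS, ?_⟩)
      by_cases hyu : y = u
      · exact Or.inl hyu
      have h1 := hadj x hxS y hyS hxy
      rcases hx with rfl | hx
      · exact Or.inr h1
      · exact Or.inr (htrans u hu x hxS y hyS (Ne.symm hyu) hx h1)
    obtain ⟨a, ha, ha'⟩ := exists_cover_number (H := H) ⟨u, huA⟩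
    obtain ⟨b, hb, hb'⟩ := exists_cover_number (H := H) hBne
    obtain ⟨T, hTA, hTI, hTmax⟩ := exists_indep_number H A
    obtain ⟨U, hUB, hUI, hUmax⟩ := exists_indep_number H (S \ A)
    have hab : r ≤ a + b + 1 := by
      by_contra! hcon
      have := ha'.union hb'
      rw [Finset.union_sdiff_of_subset hAsub] at this
      exact hS (this.mono (by omega))
    have hTU : T.card + U.card + j ≤ r + 1 := by
      rw [← Finset.card_union_of_disjoint (Finset.disjoint_sdiff.mono hTA hUB)]
      refine hI _ (Finset.union_subset (hTA.trans hAsub) (hUB.trans Finset.sdiff_subset)) ?_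
      intro x hx y hy
      rcases Finset.mem_union.1 hx with hx | hx <;> rcases Finset.mem_union.1 hy with hy | hy
      · exact hTI x hx y hy
      · exact hsep x (hTA hx) y (hUB hy)
      · exact fun h => hsep y (hTA hy) x (hUB hx) h.symm
      · exact hUI x hx y hy
    have hTa := ha'.card_le hTA hTI
    have hUb := hb'.card_le hUB hUI
    have h1 := ih A (Finset.ssubset_iff_subset_ne.2 ⟨hAsub, hAS⟩) a (min 6 (a + 1 - T.card))
      (min_le_left _ _) ha fun W hW hWI => by
        have := hTmax W hW hWI
        omega
    have h2 := ih (S \ A) (Finset.sdiff_ssubset hAsub ⟨u, huA⟩) b (min 6 (b + 1 - U.card))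
      (min_le_left _ _) hb fun W hW hWI => by
        have := hUmax W hW hWI
        omega
    have h3 := Finset.card_sdiff_add_card_eq_card hAsub
    omega

end

section

open Classical

/-! ### Graphs attaining the bound -/

/-- There is a graph on `n` vertices that is not `r`-colourable and has no clique on more than `w`
vertices. The graph is given by its complement `H`. -/
def Realizable (r w n : ℕ) : Prop :=
  ∃ (V : Type) (_ : Fintype V) (H : SimpleGraph V), Fintype.card V = n ∧
    ¬ Cover H Finset.univ r ∧ IndepLE H w Finset.univ

/-- The join of two graphs is the disjoint sum of the complements. -/
theorem Realizable.join {r r' w w' n n' : ℕ} (h : Realizable r w n) (h' : Realizable r' w' n') :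
    Realizable (r + r' + 1) (w + w') (n + n') := by
  obtain ⟨V, _, H, hn, hr, hw⟩ := h
  obtain ⟨V', _, H', hn', hr', hw'⟩ := h'
  refine ⟨V ⊕ V', inferInstance, H ⊕g H', by rw [Fintype.card_sum, hn, hn'], ?_, ?_⟩
  · rintro ⟨c, h1, h2⟩
    have hdisj : Disjoint (Finset.univ.image fun x : V => c (Sum.inl x))
        (Finset.univ.image fun x : V' => c (Sum.inr x)) := by
      rw [Finset.disjoint_left]
      intro a ha hb
      obtain ⟨x, -, rfl⟩ := Finset.mem_image.1 ha
      obtain ⟨y, -, hxy⟩ := Finset.mem_image.1 hb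
      have := h2 (Sum.inl x) (Finset.mem_univ _) (Sum.inr y) (Finset.mem_univ _) (by simp) hxy.symm
      simp at this
    have hsub : (Finset.univ.image fun x : V => c (Sum.inl x)) ∪
        (Finset.univ.image fun x : V' => c (Sum.inr x)) ⊆ Finset.range (r + r' + 1) := by
      intro a ha
      rcases Finset.mem_union.1 ha with ha | ha
      all_goals
        obtain ⟨x, -, rfl⟩ := Finset.mem_image.1 ha
        exact Finset.mem_range.2 (h1 _ (Finset.mem_univ _))
    have hcard := Finset.card_le_card hsub
    rw [Finset.card_union_of_disjoint hdisj, Finset.card_range] at hcard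
    have hle : (Finset.univ.image fun x : V => c (Sum.inl x)).card ≤ r ∨
        (Finset.univ.image fun x : V' => c (Sum.inr x)).card ≤ r' := by omega
    rcases hle with hle | hle
    · refine hr (Cover.of_labels (fun x => c (Sum.inl x))
        (fun x hx => Finset.mem_image_of_mem (fun x => c (Sum.inl x)) hx) hle
        fun x _ y _ hxy hc => ?_)
      have := h2 (Sum.inl x) (Finset.mem_univ _) (Sum.inl y) (Finset.mem_univ _) (by simpa) hc
      simpa using this
    · refine hr' (Cover.of_labels (fun x => c (Sum.inr x))
        (fun x hx => Finset.mem_image_of_mem (fun x => c (Sum.inr x)) hx) hle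
        fun x _ y _ hxy hc => ?_)
      have := h2 (Sum.inr x) (Finset.mem_univ _) (Sum.inr y) (Finset.mem_univ _) (by simpa) hc
      simpa using this
  · intro T _ hT
    rw [← Finset.card_toLeft_add_card_toRight]
    refine add_le_add (hw _ (Finset.subset_univ _) fun x hx y hy h => ?_)
      (hw' _ (Finset.subset_univ _) fun x hx y hy h => ?_)
    · exact hT _ (Finset.mem_toLeft.1 hx) _ (Finset.mem_toLeft.1 hy) (by simpa using h)
    · exact hT _ (Finset.mem_toRight.1 hx) _ (Finset.mem_toRight.1 hy) (by simpa using h)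

theorem realizable_complete (t : ℕ) : Realizable t (t + 1) (t + 1) := by
  refine ⟨Fin (t + 1), inferInstance, ⊥, by simp, fun h => ?_, fun T _ _ => ?_⟩
  · have := h.card_le (Finset.Subset.refl _) fun x _ y _ h => h
    simp at this
  · exact (Finset.card_le_univ T).trans (by simp)

theorem Realizable.add {r w n : ℕ} (h : Realizable r w n) (t : ℕ) :
    Realizable (r + t) (w + t) (n + t) := by
  cases t with
  | zero => exact h
  | succ t => exact h.join (realizable_complete t)

/-- The graph with the given rows: row `j` has the bits of the vertices `i < j` adjacent to `j`. -/
def ofRows (g : List ℕ) : SimpleGraph (Fin g.length) where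
  Adj a b := (a < b ∧ (g.getD b 0).testBit a = true) ∨ (b < a ∧ (g.getD a 0).testBit b = true)
  symm := ⟨fun _ _ h => h.symm⟩
  loopless := ⟨fun a h => by simp at h⟩

/-- A test for triangle-freeness. -/
def noTriangle (g : List ℕ) : Bool :=
  (List.range g.length).all fun j => (List.range j).all fun i =>
    !Nat.testBit (g.getD j 0) i || Nat.beq (Nat.land (g.getD i 0) (g.getD j 0)) 0

theorem triangleFree_ofRows {g : List ℕ} (h : noTriangle g = true) : TriangleFree (ofRows g) := by
  have key : ∀ a b c : Fin g.length, a < b → b < c → (g.getD b 0).testBit a = true →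
      (g.getD c 0).testBit a = true → (g.getD c 0).testBit b = true → False := by
    intro a b c _ hbc h1 h2 h3
    have := List.all_eq_true.1 (List.all_eq_true.1 h c (List.mem_range.2 c.2)) b
      (List.mem_range.2 hbc)
    rw [h3, Bool.not_true, Bool.false_or, land_eq_zero_iff] at this
    rw [this a h1] at h2
    simp at h2
  intro x y z hxy hyz hxz
  rcases hxy with ⟨h1, h1'⟩ | ⟨h1, h1'⟩ <;> rcases hyz with ⟨h2, h2'⟩ | ⟨h2, h2'⟩ <;>
    rcases hxz with ⟨h3, h3'⟩ | ⟨h3, h3'⟩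
  · exact key x y z h1 h2 h1' h3' h2'
  · exact absurd (h1.trans h2) h3.asymm
  · exact key x z y h3 h2 h3' h1' h2'
  · exact key z x y h3 h1 h3' h2' h1'
  · exact key y x z h1 h3 h1' h2' h3'
  · exact key y z x h2 h3 h2' h1' h3'
  · exact absurd (h2.trans h1) h3.asymm
  · exact key z y x h2 h1 h2' h3' h1'

/-- A triangle-free graph on `2 r + 1` vertices is not covered by `r` cliques. -/
theorem realizable_of_triangleFree {r w : ℕ} {g : List ℕ} (hg : g.length = 2 * r + 1)
    (ht : noTriangle g = true) (hw : ((layers g).drop (w + 1)).all List.isEmpty = true) :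
    Realizable r w (2 * r + 1) := by
  have ht' := triangleFree_ofRows ht
  refine ⟨Fin g.length, inferInstance, ofRows g, by simp [hg], fun h => ?_, fun T _ hT => ?_⟩
  · obtain ⟨σ, -, hσ⟩ := h.exists_isPairing fun x _ y _ z _ => ht' x y z
    simp only [Finset.card_univ, Fintype.card_fin] at hσ
    omega
  · obtain ⟨s, hs, -⟩ := (listsIndep_layers g).complete (T.map Fin.valEmbedding)
      (by
        intro i hi
        obtain ⟨a, -, rfl⟩ := Finset.mem_map.1 hi
        exact Finset.mem_range.2 a.2)
      (by
        intro j hj i hi hij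
        obtain ⟨b, hb, rfl⟩ := Finset.mem_map.1 hj
        obtain ⟨a, ha, rfl⟩ := Finset.mem_map.1 hi
        rw [Bool.eq_false_iff]
        exact fun h => hT a ha b hb (Or.inl ⟨hij, h⟩))
    rw [Finset.card_map] at hs
    by_contra! hlt
    have h1 : (layers g).getD T.card [] = ((layers g).drop (w + 1)).getD (T.card - (w + 1)) [] := by
      rw [List.getD_eq_getElem?_getD, List.getD_eq_getElem?_getD, List.getElem?_drop]
      congr 3
      omega
    rw [h1] at hs
    rcases lt_or_ge (T.card - (w + 1)) ((layers g).drop (w + 1)).length with h | h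
    · rw [List.getD_eq_getElem _ _ h] at hs
      have := List.all_eq_true.1 hw _ (List.getElem_mem h)
      rw [List.isEmpty_iff] at this
      simp [this] at hs
    · rw [List.getD_eq_default _ _ h] at hs
      simp at hs

theorem realizable_five : Realizable 2 2 5 :=
  realizable_of_triangleFree (g := cycleFive) (w := 2) rfl (by decide +kernel) (by decide +kernel)

/-- The complement is the circulant graph on `ℤ/13` with differences `±1, ±5`. -/
theorem realizable_thirteen : Realizable 6 4 13 :=
  realizable_of_triangleFree (w := 4)
    (g := [0, 1, 2, 4, 8, 17, 34, 68, 137, 274, 548, 1096, 2193])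
    rfl (by decide +kernel) (by decide +kernel)

theorem realizable_seventeen : Realizable 8 5 17 :=
  realizable_of_triangleFree (w := 5)
    (g := [0, 0, 1, 2, 12, 9, 3, 6, 18, 36, 72, 129, 1921, 3602, 3364, 2888, 240])
    rfl (by decide +kernel) (by decide +kernel)

/-- The complement is the circulant graph on `ℤ/21` with differences `±1, ±3, ±8`. -/
theorem realizable_twentyOne : Realizable 10 6 21 :=
  realizable_of_triangleFree (w := 6)
    (g := [0, 1, 2, 5, 10, 20, 40, 80, 161, 322, 644, 1288, 2576, 5153, 10306, 20612, 41224, 82448,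
      164897, 329794, 659589])
    rfl (by decide +kernel) (by decide +kernel)

/-- The complement is the circulant graph on `ℤ/26` with differences `±1, ±3, ±8, 13`, less one
vertex. -/
theorem realizable_twentyFive : Realizable 12 7 25 :=
  realizable_of_triangleFree (w := 7)
    (g := [0, 1, 2, 5, 10, 20, 40, 80, 161, 322, 644, 1288, 2576, 5153, 10306, 20612, 41224, 82448,
      164897, 329794, 659588, 1319176, 2638352, 5276705, 10553410])
    rfl (by decide +kernel) (by decide +kernel)

/-- The shift graph: the pairs `(a, b)` with `a < b`, each joined to all `(b, c)`. -/
def shiftGraph (N : ℕ) : SimpleGraph (Fin N × Fin N) where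
  Adj p q := p.1 < p.2 ∧ q.1 < q.2 ∧ (p.2 = q.1 ∨ q.2 = p.1)
  symm := ⟨fun _ _ h => ⟨h.2.1, h.1, h.2.2.symm⟩⟩
  loopless := ⟨fun p h => by
    rcases h.2.2 with h' | h'
    · exact absurd h.1 (by rw [h']; exact lt_irrefl _)
    · exact absurd h.1 (by rw [h']; exact lt_irrefl _)⟩

/-- In an `r`-colouring of the shift graph, the vertices `a < b` see different sets of colours
on the pairs starting with them, so there are at most `2 ^ r` of them. -/
theorem exists_realizable (r : ℕ) : ∃ n, Realizable r 2 n := by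
  refine ⟨_, Fin (2 ^ r + 1) × Fin (2 ^ r + 1), inferInstance, (shiftGraph (2 ^ r + 1))ᶜ, rfl,
    ?_, ?_⟩
  · rintro ⟨c, h1, h2⟩
    have hinj : Function.Injective fun a : Fin (2 ^ r + 1) =>
        (Finset.univ.filter fun b => a < b).image fun b => c (a, b) := by
      have key : ∀ a b : Fin (2 ^ r + 1), a < b →
          ((Finset.univ.filter fun b => a < b).image fun b => c (a, b)) ≠
          (Finset.univ.filter fun b' => b < b').image fun b' => c (b, b') := by
        intro a b hab heq
        have hmem : c (a, b) ∈ (Finset.univ.filter fun b => a < b).image fun b => c (a, b) :=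
          Finset.mem_image_of_mem _ (by simpa using hab)
        rw [heq, Finset.mem_image] at hmem
        obtain ⟨d, hd, hc⟩ := hmem
        have hbd : b < d := by simpa using hd
        have hne : (a, b) ≠ (b, d) := fun h => hab.ne (congrArg Prod.fst h)
        have := h2 (a, b) (Finset.mem_univ _) (b, d) (Finset.mem_univ _) hne hc.symm
        rw [SimpleGraph.compl_adj] at this
        exact this.2 ⟨hab, hbd, Or.inl rfl⟩
      intro a b hab
      rcases lt_trichotomy a b with h | h | h
      · exact absurd hab (key a b h)
      · exact h
      · exact absurd hab.symm (key b a h)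
    have := Finset.card_le_card_of_injOn (s := Finset.univ) (t := (Finset.range r).powerset) _
      (fun a _ => by
        rw [Finset.mem_coe, Finset.mem_powerset]
        intro x hx
        obtain ⟨b, -, rfl⟩ := Finset.mem_image.1 hx
        exact Finset.mem_range.2 (h1 _ (Finset.mem_univ _))) hinj.injOn
    simp at this
  · intro T _ hT
    by_contra! h3
    obtain ⟨p, hp, q, hq, s, hs, hpq, hps, hqs⟩ := Finset.two_lt_card.1 h3
    have hadj : ∀ x ∈ T, ∀ y ∈ T, x ≠ y → (shiftGraph (2 ^ r + 1)).Adj x y := by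
      intro x hx y hy hxy
      by_contra hcon
      exact hT x hx y hy ((SimpleGraph.compl_adj _ _ _).2 ⟨hxy, hcon⟩)
    have e1 := hadj p hp q hq hpq
    have e2 := hadj p hp s hs hps
    have e3 := hadj q hq s hs hqs
    simp only [shiftGraph, Fin.lt_def, Fin.ext_iff] at e1 e2 e3
    omega

/-! ### The Folkman numbers -/

theorem isNClique_two_iff {V : Type*} [DecidableEq V] {G : SimpleGraph V} {Q : Finset V} :
    G.IsNClique 2 Q ↔ ∃ x y, G.Adj x y ∧ Q = {x, y} := by
  rw [SimpleGraph.isNClique_iff, Finset.card_eq_two]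
  constructor
  · rintro ⟨h, x, y, hxy, rfl⟩
    exact ⟨x, y, h (by simp) (by simp) hxy, rfl⟩
  · rintro ⟨x, y, hxy, rfl⟩
    refine ⟨?_, x, y, hxy.ne, rfl⟩
    rw [Finset.coe_pair, SimpleGraph.isClique_pair]
    exact fun _ => hxy

theorem mem_vertexFolkmanOrders {r w n : ℕ} {q : ℤ} (h : Realizable r w n) (hq : (w : ℤ) < q) :
    n ∈ vertexFolkmanOrders (twos r) q := by
  obtain ⟨V, _, H, rfl, hr, hw⟩ := h
  have e := Fintype.equivFin V
  refine ⟨Hᶜ.comap e.symm, ?_, ?_⟩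
  · intro c
    by_contra! hcon
    refine hr ⟨fun x => c (e x), fun x _ => (c (e x)).2, fun x _ y _ hxy hc => ?_⟩
    by_contra hadj
    obtain ⟨z, hz, hzc⟩ := hcon (c (e x)) {e x, e y} (by
      change SimpleGraph.IsNClique _ 2 _
      rw [isNClique_two_iff]
      exact ⟨e x, e y, by simp [hxy, hadj], rfl⟩)
    rcases Finset.mem_insert.1 hz with rfl | hz
    · exact hzc rfl
    · rw [Finset.mem_singleton.1 hz] at hzc
      exact hzc (Fin.ext hc.symm)
  · refine lt_of_le_of_lt ?_ hq
    obtain ⟨Q, hQ⟩ := (Hᶜ.comap e.symm).exists_isNClique_cliqueNum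
    rw [← hQ.card_eq, ← Finset.card_map e.symm.toEmbedding]
    refine Nat.cast_le.2 (hw _ (Finset.subset_univ _) fun x hx y hy hxy => ?_)
    obtain ⟨a, ha, rfl⟩ := Finset.mem_map.1 hx
    obtain ⟨b, hb, rfl⟩ := Finset.mem_map.1 hy
    have hab : a ≠ b := by
      rintro rfl
      exact H.irrefl hxy
    have := hQ.isClique ha hb hab
    rw [SimpleGraph.comap_adj, SimpleGraph.compl_adj] at this
    exact this.2 hxy

theorem le_of_mem_vertexFolkmanOrders {r j n : ℕ} {q : ℤ} (hj : j ≤ 6) (hq : q + j = r + 2)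
    (h : n ∈ vertexFolkmanOrders (twos r) q) : r + 1 + 2 * j ≤ n := by
  obtain ⟨G, hG, hcl⟩ := h
  have := le_card_of_not_cover (H := Gᶜ) Finset.univ r j hj (by
    rintro ⟨c, h1, h2⟩
    obtain ⟨i, Q, hQ, hQc⟩ := hG fun v => ⟨c v, h1 v (Finset.mem_univ _)⟩
    change G.IsNClique 2 Q at hQ
    rw [isNClique_two_iff] at hQ
    obtain ⟨x, y, hxy, rfl⟩ := hQ
    have hc := (hQc x (by simp)).trans (hQc y (by simp)).symm
    have := h2 x (Finset.mem_univ _) y (Finset.mem_univ _) hxy.ne (Fin.mk.inj_iff.1 hc)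
    exact ((SimpleGraph.compl_adj _ _ _).1 this).2 hxy)
    (by
      intro T _ hT
      have hclique : G.IsClique T := by
        intro x hx y hy hxy
        by_contra hcon
        exact hT x hx y hy ((SimpleGraph.compl_adj _ _ _).2 ⟨hxy, hcon⟩)
      have := hclique.card_le_cliqueNum
      omega)
  simpa using this

/-- The graphs attaining the bound, for `j = k + 1`. -/
theorem realizable_of_le {r j : ℕ} (hj : j ≤ 6)
    (hr : (j ≠ 0 ∧ j ≠ 2 ∧ 2 * j ≤ r) ∨ ((j = 0 ∨ j = 2) ∧ 2 * j + 1 ≤ r)) :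
    Realizable r (r + 1 - j) (r + 1 + 2 * j) := by
  have key : ∀ {r₀ w n : ℕ}, Realizable r₀ w n → r₀ ≤ r → w + j = r₀ + 1 → n = r₀ + 1 + 2 * j →
      Realizable r (r + 1 - j) (r + 1 + 2 * j) := by
    intro r₀ w n h hle hw hn
    have := h.add (r - r₀)
    rwa [show r₀ + (r - r₀) = r by omega, show w + (r - r₀) = r + 1 - j by omega,
      show n + (r - r₀) = r + 1 + 2 * j by omega] at this
  interval_cases j
  · exact key (realizable_complete 0) (by omega) rfl rfl
  · exact key realizable_five (by omega) rfl rfl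
  · exact key (realizable_five.join realizable_five) (by omega) rfl rfl
  · exact key realizable_thirteen (by omega) rfl rfl
  · exact key realizable_seventeen (by omega) rfl rfl
  · exact key realizable_twentyOne (by omega) rfl rfl
  · exact key realizable_twentyFive (by omega) rfl rfl

end

end Folkman

theorem theorem1p1 (k : ℤ) (r : ℕ) (hk : -1 ≤ k) (hk' : k ≤ 5) (hr : k + 2 ≤ (r : ℤ)) :
    (vertexFolkmanOrders (twos r) ((r : ℤ) - k + 1)).Nonempty ∧
    (r : ℤ) + 2 * k + 3 ≤ (vertexFolkman (twos r) ((r : ℤ) - k + 1) : ℤ) ∧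
    ((k ∈ ({0, 2, 3, 4, 5} : Set ℤ) ∧ 2 * k + 2 ≤ (r : ℤ)) ∨
      (k ∈ ({-1, 1} : Set ℤ) ∧ 2 * k + 3 ≤ (r : ℤ)) →
        (vertexFolkman (twos r) ((r : ℤ) - k + 1) : ℤ) = (r : ℤ) + 2 * k + 3) := by
  obtain ⟨j, rfl⟩ : ∃ j : ℕ, k = j - 1 := ⟨(k + 1).toNat, by omega⟩
  have hne : (vertexFolkmanOrders (twos r) ((r : ℤ) - (j - 1) + 1)).Nonempty := by
    obtain ⟨n, hn⟩ := Folkman.exists_realizable r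
    exact ⟨n, Folkman.mem_vertexFolkmanOrders hn (by push_cast; omega)⟩
  have hle : ∀ n ∈ vertexFolkmanOrders (twos r) ((r : ℤ) - (j - 1) + 1), r + 1 + 2 * j ≤ n :=
    fun n hn => Folkman.le_of_mem_vertexFolkmanOrders (by omega) (by omega) hn
  have hinf : r + 1 + 2 * j ≤ vertexFolkman (twos r) ((r : ℤ) - (j - 1) + 1) :=
    hle _ (Nat.sInf_mem hne)
  refine ⟨hne, by omega, fun h => ?_⟩
  have hreal : Folkman.Realizable r (r + 1 - j) (r + 1 + 2 * j) := by
    refine Folkman.realizable_of_le (by omega) ?_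
    simp only [Set.mem_insert_iff, Set.mem_singleton_iff] at h
    omega
  have hmem : vertexFolkman (twos r) ((r : ℤ) - (j - 1) + 1) ≤ r + 1 + 2 * j :=
    Nat.sInf_le (Folkman.mem_vertexFolkmanOrders hreal (by omega))
  omega
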